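/- **Setting.** Let $(X,A,D,Y^*)\sim P$ with features $X\in\mathcal X$, attribute $A\in\{0,1\}$, decision $D\in\{0,1\}$ and outcome $Y^*\in[0,1]$, observed only if $D=1$. Assume *selection on observables*, $D\perp Y^*\mid X$, and *positivity*, $\mathbb P(D=1\mid X)>0$ almost surely. Let $\mu(x)=\mathbb E[Y^*\mid X=x]$. Let $l:[0,1]^2\to[0,1]$ be 1-Lipschitz for the $\ell_1$-norm, and let $\mathcal F$ be a nonempty class of functions $f:\mathcal X\to[0,1]$ (measurable, with the usual measurability of suprema over the class). For a discrete distribution $Q$ on $\mathcal F$ put $\operatorname{loss}(Q)=\sum_fQ(f)\,\mathbb E[l(Y^*,f(X))]$ and $\operatorname{loss}_\mu(Q)=\sum_fQ(f)\,\mathbb E[l(\mu(X),f(X))]$. For $a\in\{0,1\}$ let $\mathcal E_a=\{A\in S_a\}$ with $g_a(m)=1$, or $\mathcal E_a=\{A\in S_a,Y^*=1\}$ with $g_a(m)=m$, or $\mathcal E_a=\{A\in S_a,Y^*=0\}$ with $g_a(m)=1-m$, where $S_a\subseteq\{0,1\}$ (typically $S_a=\{a\}$). If one of the events involves $Y^*$,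 assume $Y^*\in\{0,1\}$ almost surely and $Y^*\perp A\mid X$ (for instance, $A$ is a function of $X$). Let $\beta_0,\beta_1\in\mathbb R$, with $\mathbb P(\mathcal E_a)>0$ whenever $\beta_a\ne0$, and let $\operatorname{disparity}(f)=\sum_a\beta_a\mathbb E[f(X)\mid\mathcal E_a]$, extended linearly to distributions $Q$. Fix a tolerance $\epsilon\ge0$ and call $Q$ *feasible* if $\operatorname{loss}_\mu(Q)\le\epsilon$. **Algorithm.** Given $n$ i.i.d. draws, the input data are the oracle triples $(X_i,A_i,\mu(X_i))$; $\hat{\mathbb E}$ is the sample mean. Let $\alpha=1/N$, let $Z$ be uniform on $\{\alpha,2\alpha,\dots,1\}$ and independent of the data, let $\underline\mu_i$ be the smallest point within $\alpha/2$ of $\mu(X_i)$ in a finite $\alpha/2$-cover of $[0,1]$ contained in $[0,1]$, and let $h_f(x,z)=1\{f(x)\ge z\}$. Put $c(y,z)=N\big(l(y,\min\{z+\tfrac\alpha2,1\})-l(y,z-\tfrac\alpha2)\big)$, $\widehat{\operatorname{cost}}(f)=\hat{\mathbb E}\,\mathbb E_Z[c(\underline\mu_i,Z)h_f(X_i,Z)]$,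 $\hat c_0=\hat{\mathbb E}[l(\underline\mu_i,\tfrac\alpha2)]$ and $$\widehat{\operatorname{disparity}}(f)=\sum_a\beta_a\frac{\hat{\mathbb E}\big[1\{A_i\in S_a\}g_a(\mu(X_i))\,\mathbb E_Z h_f(X_i,Z)\big]}{\hat{\mathbb E}\big[1\{A_i\in S_a\}g_a(\mu(X_i))\big]},$$ with linear extensions to $Q$; let $L(Q,\lambda)=\widehat{\operatorname{disparity}}(Q)+\lambda(\widehat{\operatorname{cost}}(Q)-\hat\epsilon)$. The exponentiated gradient algorithm starts from $\theta_1=0$; in iteration $t$ it sets $\lambda_t=B_\lambda e^{\theta_t}/(1+e^{\theta_t})$, lets $f_t$ be an exact minimizer of $L(\cdot,\lambda_t)$ over $\mathcal F$, and lets $\hat Q_t$, $\hat\lambda_t$ be the uniform averages of the iterates so far. It stops as soon as both $L(\hat Q_t,\hat\lambda_t)-\min_fL(f,\hat\lambda_t)$ and $\max_{0\le\lambda\le B_\lambda}L(\hat Q_t,\lambda)-L(\hat Q_t,\hat\lambda_t)$ are at most $\nu$; it then returns $\hat Q=\hat Q_t$ if $\widehat{\operatorname{cost}}(\hat Q_t)\le\hat\epsilon+(|\beta_0|+|\beta_1|+2\nu)/B_\lambda$,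 and null otherwise. If it does not stop, $\theta_{t+1}=\theta_t+\eta(\widehat{\operatorname{cost}}(f_t)-\hat\epsilon)$, where $\eta=\nu/(2\rho^2B_\lambda)$ and $\rho=\sup_f|\widehat{\operatorname{cost}}(f)-\hat\epsilon|$. **Conditions.** Let $\mathcal H=\{h_f:f\in\mathcal F\}$ on $\mathcal X\times[0,1]$. Its Rademacher complexity $R_n(\mathcal H)=\sup_{u_1,\dots,u_n}\mathbb E_\sigma\sup_{h\in\mathcal H}|\tfrac1n\sum_i\sigma_ih(u_i)|$ satisfies $R_n(\mathcal H)\le Cn^{-\phi}$ for all $n\ge1$, with $C>0$ and $0\le\phi\le\frac12$. Moreover $\hat\epsilon=\epsilon-\hat c_0+C'n^{-\phi}+C''n^{-1/2}$ with $C'\ge2C+2+\sqrt{2\ln(8N/\delta)}$ and $C''\ge\sqrt{\ln(8/\delta)/2}$, both at most a fixed multiple of these lower bounds; $\nu\propto n^{-\phi}$, $B_\lambda\propto n^\phi$, and $N\propto n^\phi$ up to fixed positive factors from below and above; $0<\delta<1$. **Theorem 2 (Selective Labels).** (i) *Identification:* if $\mathbb P(\mathcal E_a)>0$, then $\mathbb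 E[g_a(\mu(X))\mid A\in S_a]>0$ and, for all $f\in\mathcal F$, $\mathbb E[f(X)\mid\mathcal E_a]=\mathbb E[f(X)g_a(\mu(X))\mid A\in S_a]\,/\,\mathbb E[g_a(\mu(X))\mid A\in S_a]$. (ii) The algorithm terminates on every sample in at most $K(1+\ln\frac1\delta)\,n^{4\phi}$ iterations; for fixed $\delta$ this is $O(n^{4\phi})$. (iii) For all sufficiently large $n$, with probability at least $1-\delta$ one of the following holds: 1) $\hat Q\ne$ null, $\operatorname{loss}_\mu(\hat Q)\le\epsilon+\tilde O(n^{-\phi})$, and $\operatorname{disparity}(\hat Q)\le\operatorname{disparity}(\tilde Q)+\tilde O(n_0^{-\phi})+\tilde O(n_1^{-\phi})$ for every feasible $\tilde Q$, where $n_a$ is the number of samples with $A_i\in S_a$ (read as $1$ if there are none); or 2) $\hat Q=$ null and no $Q$ is feasible. (iv) If $l(\cdot,u)$ is convex for every $u$, then $\operatorname{loss}_\mu(Q)\le\operatorname{loss}(Q)$ for all $Q$, so the guarantees in (iii) then also hold with feasibility defined by $\operatorname{loss}(Q)\le\epsilon$. Here $\tilde O(r)$ means at most $K(1+\ln n+\ln\frac1\delta)^k\,r$.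 The constants $K$, $k$ and the threshold for $n$ depend only on $\beta_0,\beta_1,\phi,C,\epsilon$, the proportionality factors, and a positive lower bound for those $\mathbb P(\mathcal E_a)$ with $\beta_a\ne0$. -/

import Mathlib

open MeasureTheory ProbabilityTheory

/-! ### Population, selection, outcome regression -/

/-- One unit `(X, A, D, Y*)`: features, protected attribute, decision, outcome.
The outcome is observed exactly when `D = 1`. -/
abbrev Unit4 (𝒳 : Type*) := 𝒳 × Fin 2 × Fin 2 × ℝ

namespace Unit4

variable {𝒳 : Type*}

/-- The features `X`. -/
def feat (o : Unit4 𝒳) : 𝒳 := o.1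
/-- The protected attribute `A`. -/
def attr (o : Unit4 𝒳) : Fin 2 := o.2.1
/-- The decision `D`. -/
def dec (o : Unit4 𝒳) : Fin 2 := o.2.2.1
/-- The outcome `Y*`. -/
def out (o : Unit4 𝒳) : ℝ := o.2.2.2

end Unit4

/-- The σ-algebra `σ(X)` on the space of units. -/
@[reducible] def sigmaFeat (𝒳 : Type*) [MeasurableSpace 𝒳] : MeasurableSpace (Unit4 𝒳) :=
  MeasurableSpace.comap Unit4.feat inferInstance

/-- `U` and `V` are conditionally independent given the features `X` under `P`:
`P(U ∈ s, V ∈ t | X) = P(U ∈ s | X) P(V ∈ t | X)` almost surely, for all measurable `s`, `t`. -/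
def CondIndepGivenFeat {𝒳 : Type*} [MeasurableSpace 𝒳] (P : Measure (Unit4 𝒳))
    {S T : Type*} [MeasurableSpace S] [MeasurableSpace T]
    (U : Unit4 𝒳 → S) (V : Unit4 𝒳 → T) : Prop :=
  ∀ (s : Set S) (t : Set T), MeasurableSet s → MeasurableSet t →
    P⟦U ⁻¹' s ∩ V ⁻¹' t | sigmaFeat 𝒳⟧ =ᵐ[P]
      P⟦U ⁻¹' s | sigmaFeat 𝒳⟧ * P⟦V ⁻¹' t | sigmaFeat 𝒳⟧

/-- Selective labels with selection on observables and positivity; `μ` is (a `[0,1]`-valued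
version of) the outcome regression function `μ(x) = E[Y* | X = x]`. -/
structure SelectiveLabels {𝒳 : Type*} [MeasurableSpace 𝒳] (P : Measure (Unit4 𝒳))
    (μ : 𝒳 → ℝ) : Prop where
  out_mem : ∀ᵐ o ∂P, o.out ∈ Set.Icc (0 : ℝ) 1
  selection_on_observables : CondIndepGivenFeat P Unit4.dec Unit4.out
  positivity : ∀ᵐ o ∂P, 0 < (P⟦{o : Unit4 𝒳 | o.dec = 1} | sigmaFeat 𝒳⟧) o
  measurable_reg : Measurable μ
  reg_mem : ∀ x, μ x ∈ Set.Icc (0 : ℝ) 1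
  reg_eq : (fun o : Unit4 𝒳 => μ o.feat) =ᵐ[P] P[Unit4.out | sigmaFeat 𝒳]

/-! ### Conditioning events and disparities -/

/-- How a conditioning event restricts the outcome. -/
inductive LabelCond
  /-- no restriction -/
  | free
  /-- `Y* = 1` -/
  | pos
  /-- `Y* = 0` -/
  | neg

/-- The set of outcomes that satisfy the restriction. -/
def LabelCond.outcomes : LabelCond → Set ℝ
  | .free => Set.univ
  | .pos => {1}
  | .neg => {0}

/-- The weight `g` applied to the outcome regression: `g = 1`, `g(m) = m`, `g(m) = 1 - m`. -/
def LabelCond.weight : LabelCond → ℝ → ℝ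
  | .free, _ => 1
  | .pos, m => m
  | .neg, m => 1 - m

/-- A conditioning event `{A ∈ attrs, Y* satisfies label}`, e.g. `{A = a}`, `{Y* = 1, A = a}`. -/
structure GroupEvent where
  attrs : Finset (Fin 2)
  label : LabelCond

namespace GroupEvent

variable {𝒳 : Type*}

/-- The part `{A ∈ attrs}` of the event. -/
def attrSet (e : GroupEvent) : Set (Unit4 𝒳) := {o | o.attr ∈ e.attrs}

/-- The full event, as a set of units. -/
def toSet (e : GroupEvent) : Set (Unit4 𝒳) :=
  {o | o.attr ∈ e.attrs ∧ o.out ∈ e.label.outcomes}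

end GroupEvent

/-- `disparity(f) = β₀ E[f(X) | ℰ₀] + β₁ E[f(X) | ℰ₁]`. -/
noncomputable def disparity {𝒳 : Type*} [MeasurableSpace 𝒳] (P : Measure (Unit4 𝒳))
    (β : Fin 2 → ℝ) (ev : Fin 2 → GroupEvent) (f : 𝒳 → ℝ) : ℝ :=
  ∑ a, β a * ∫ o, f o.feat ∂(P[|(ev a).toSet])

/-! ### Losses, prediction functions, randomized prediction functions -/

/-- A loss `l : [0,1] × [0,1] → [0,1]`, 1-Lipschitz for the `ℓ₁` norm
(values outside the unit square are never used). -/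
structure IsLoss (l : ℝ → ℝ → ℝ) : Prop where
  mem : ∀ y ∈ Set.Icc (0 : ℝ) 1, ∀ u ∈ Set.Icc (0 : ℝ) 1, l y u ∈ Set.Icc (0 : ℝ) 1
  lipschitz : ∀ y ∈ Set.Icc (0 : ℝ) 1, ∀ u ∈ Set.Icc (0 : ℝ) 1,
    ∀ y' ∈ Set.Icc (0 : ℝ) 1, ∀ u' ∈ Set.Icc (0 : ℝ) 1,
      |l y u - l y' u'| ≤ |y - y'| + |u - u'|

/-- `loss(f) = E[l(Y*, f(X))]`. -/
noncomputable def loss {𝒳 : Type*} [MeasurableSpace 𝒳] (P : Measure (Unit4 𝒳))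
    (l : ℝ → ℝ → ℝ) (f : 𝒳 → ℝ) : ℝ := ∫ o, l o.out (f o.feat) ∂P

/-- `loss_μ(f) = E[l(μ(X), f(X))]`. -/
noncomputable def lossReg {𝒳 : Type*} [MeasurableSpace 𝒳] (P : Measure (Unit4 𝒳))
    (μ : 𝒳 → ℝ) (l : ℝ → ℝ → ℝ) (f : 𝒳 → ℝ) : ℝ := ∫ o, l (μ o.feat) (f o.feat) ∂P

/-- `v(Q) = ∑ᵢ Q(i) v(i)`, the average of `v` under a (discrete) distribution `Q`. -/
noncomputable def avg {ι : Type*} (Q : PMF ι) (v : ι → ℝ) : ℝ := ∑' i, (Q i).toReal * v i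

/-- The threshold classifier `h_f(x, z) = 1{f(x) ≥ z}`. -/
noncomputable def thr {𝒳 : Type*} (f : 𝒳 → ℝ) (x : 𝒳) (z : ℝ) : ℝ := if z ≤ f x then 1 else 0

/-- The class `ℋ` of threshold classifiers of functions in `F`, with cutoffs in `[0,1]`. -/
def thrClass {𝒳 : Type*} (F : Set (𝒳 → ℝ)) : Set (𝒳 × Set.Icc (0 : ℝ) 1 → ℝ) :=
  {h | ∃ f ∈ F, h = fun u => thr f u.1 u.2}

/-- The (worst-case) Rademacher complexity
`R_n(G) = sup_{u₁,…,u_n} E_σ sup_{g ∈ G} |n⁻¹ ∑ σᵢ g(uᵢ)|`, with `σ` uniform on `{-1,1}ⁿ`. -/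
noncomputable def rademacher {U : Type*} (G : Set (U → ℝ)) (n : ℕ) : ℝ :=
  ⨆ u : Fin n → U, (∑ σ : Fin n → Bool,
    ⨆ g : G, |(∑ i, (if σ i then (1 : ℝ) else -1) * (g : U → ℝ) (u i)) / n|) / 2 ^ n

/-- A nonempty class `F` of measurable functions `𝒳 → [0,1]` whose classes of threshold
classifiers are measurable for `P` in the usual sense of empirical process theory (weighted
suprema over the class are measurable for the completion of the sampling law). -/
structure IsPredictionClass {𝒳 : Type*} [MeasurableSpace 𝒳] (P : Measure (Unit4 𝒳))
    (F : Set (𝒳 → ℝ)) : Prop where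
  nonempty : F.Nonempty
  measurable : ∀ f ∈ F, Measurable f
  mem : ∀ f ∈ F, ∀ x, f x ∈ Set.Icc (0 : ℝ) 1
  measurable_sup : ∀ (m : ℕ) (w : Fin m → ℝ), ∀ z ∈ Set.Icc (0 : ℝ) 1,
    AEMeasurable (fun x : Fin m → 𝒳 => ⨆ f : F, |∑ i, w i * thr (f : 𝒳 → ℝ) (x i) z|)
      (Measure.pi fun _ : Fin m => P.map Unit4.feat)

/-! ### Discretization and sample analogues -/

/-- `T` is a finite `α/2`-cover of `[0,1]` by points of `[0,1]`, with `α = 1/N`. -/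
def IsHalfCover (N : ℕ) (T : Finset ℝ) : Prop :=
  (∀ t ∈ T, t ∈ Set.Icc (0 : ℝ) 1) ∧
    ∀ y ∈ Set.Icc (0 : ℝ) 1, ∃ t ∈ T, |y - t| ≤ 1 / (2 * (N : ℝ))

/-- The rounded outcome: the smallest point of the cover within `α/2` of `y`. -/
noncomputable def roundOut (N : ℕ) (T : Finset ℝ) (y : ℝ) : ℝ :=
  sInf {t : ℝ | t ∈ T ∧ |y - t| ≤ 1 / (2 * (N : ℝ))}

/-- `c(y, z) = N (l(y, z + α/2) - l(y, z - α/2))`; at `z = 1` the loss is extended beyond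
`[0,1]` by its value at the endpoint. -/
noncomputable def costFun (l : ℝ → ℝ → ℝ) (N : ℕ) (y z : ℝ) : ℝ :=
  N * (l y (min (z + 1 / (2 * (N : ℝ))) 1) - l y (z - 1 / (2 * (N : ℝ))))

/-- A data set of triples (features, attribute, (pseudo-)outcome). -/
abbrev Data (𝒳 : Type*) (n : ℕ) := Fin n → 𝒳 × Fin 2 × ℝ

section Empirical

variable {𝒳 : Type*} {n : ℕ}

/-- The oracle training data `(Xᵢ, Aᵢ, μ(Xᵢ))`. -/
def oracleData (μ : 𝒳 → ℝ) (s : Fin n → Unit4 𝒳) : Data 𝒳 n :=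
  fun i => ((s i).feat, (s i).attr, μ (s i).feat)

/-- The number of units of the sample in `{A ∈ attrs}`. -/
def groupCount (e : GroupEvent) (s : Fin n → Unit4 𝒳) : ℕ :=
  (Finset.univ.filter fun i => (s i).attr ∈ e.attrs).card

/-- `E_{Z_α} h_f(x, Z_α)`, the average over the grid `{1/N, …, N/N}`. -/
noncomputable def gridThr (N : ℕ) (f : 𝒳 → ℝ) (x : 𝒳) : ℝ :=
  (∑ j ∈ Finset.Icc 1 N, thr f x ((j : ℝ) / N)) / N

/-- The weight `1{Aᵢ ∈ attrs} g(yᵢ)`. -/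
def obsWeight (e : GroupEvent) (r : 𝒳 × Fin 2 × ℝ) : ℝ :=
  if r.2.1 ∈ e.attrs then e.label.weight r.2.2 else 0

/-- The empirical disparity of `h_f`:
`∑ₐ βₐ Ê[1{A ∈ attrsₐ} gₐ(y) h_f(X, Z_α)] / Ê[1{A ∈ attrsₐ} gₐ(y)]`. -/
noncomputable def empDisparity (β : Fin 2 → ℝ) (ev : Fin 2 → GroupEvent) (N : ℕ)
    (d : Data 𝒳 n) (f : 𝒳 → ℝ) : ℝ :=
  ∑ a, β a * ((∑ i, obsWeight (ev a) (d i) * gridThr N f (d i).1) / ∑ i, obsWeight (ev a) (d i))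

/-- The empirical cost of `h_f`: `Ê[c(y̲, Z_α) h_f(X, Z_α)]`. -/
noncomputable def empCost (l : ℝ → ℝ → ℝ) (N : ℕ) (T : Finset ℝ)
    (d : Data 𝒳 n) (f : 𝒳 → ℝ) : ℝ :=
  (∑ i, (∑ j ∈ Finset.Icc 1 N,
    costFun l N (roundOut N T (d i).2.2) ((j : ℝ) / N) * thr f (d i).1 ((j : ℝ) / N)) / N) / n

/-- `ĉ₀ = Ê[l(y̲, α/2)]`. -/
noncomputable def empConst (l : ℝ → ℝ → ℝ) (N : ℕ) (T : Finset ℝ) (d : Data 𝒳 n) : ℝ :=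
  (∑ i, l (roundOut N T (d i).2.2) (1 / (2 * (N : ℝ)))) / n

end Empirical

/-! ### The exponentiated gradient algorithm

Classifiers `h_f` are represented by the functions `f` they come from, so that distributions over
classifiers are directly distributions over prediction functions. -/

/-- The input of the algorithm: empirical disparity and cost of every classifier, empirical
tolerance `ε̂`, dual bound `B_λ`, accuracy `ν`, learning rate `η`, and the range
`|β₀| + |β₁|` of the disparity. -/
structure EGInput (ι : Type*) where
  disp : ι → ℝ
  cost : ι → ℝ
  tol : ℝ
  bound : ℝ
  acc : ℝ
  rate : ℝ
  range : ℝ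

namespace EGInput

variable {ι : Type*} (I : EGInput ι)

/-- The Lagrangian `L(Q, λ) = disp(Q) + λ (cost(Q) - ε̂)`. -/
noncomputable def lagrangian (Q : PMF ι) (lam : ℝ) : ℝ :=
  avg Q I.disp + lam * (avg Q I.cost - I.tol)

/-- `best` is an exact best response of the `Q`-player (a cost-sensitive classification oracle). -/
def IsBestResponse (best : ℝ → ι) : Prop :=
  ∀ lam ∈ Set.Icc 0 I.bound, ∀ i : ι,
    I.disp (best lam) + lam * (I.cost (best lam) - I.tol) ≤ I.disp i + lam * (I.cost i - I.tol)

/-- `λ = B_λ exp(θ) / (1 + exp(θ))`. -/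
noncomputable def dualOf (th : ℝ) : ℝ := I.bound * (Real.exp th / (1 + Real.exp th))

/-- The best response of the `λ`-player. -/
noncomputable def bestDual (Q : PMF ι) : ℝ :=
  if avg Q I.cost - I.tol ≤ 0 then 0 else I.bound

variable (best : ℝ → ι)

/-- `θ_{t+1}`, where `θ₁ = 0` and `θ_{t+1} = θ_t + η (cost(h_t) - ε̂)`. -/
noncomputable def theta : ℕ → ℝ
  | 0 => 0
  | t + 1 => theta t + I.rate * (I.cost (best (I.dualOf (theta t))) - I.tol)

/-- The dual iterate `λ_{t+1}`. -/
noncomputable def dual (t : ℕ) : ℝ := I.dualOf (I.theta best t)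

/-- The primal iterate `h_{t+1}`. -/
noncomputable def primal (t : ℕ) : ι := best (I.dual best t)

/-- The uniform distribution on the first `t + 1` primal iterates. -/
noncomputable def avgPrimal (t : ℕ) : PMF ι :=
  (PMF.uniformOfFintype (Fin (t + 1))).map fun s => I.primal best s

/-- The average of the first `t + 1` dual iterates. -/
noncomputable def avgDual (t : ℕ) : ℝ :=
  (∑ s ∈ Finset.range (t + 1), I.dual best s) / ((t : ℝ) + 1)

/-- The saddle point gap `ν_{t+1}`. -/
noncomputable def gap (t : ℕ) : ℝ :=
  max (I.lagrangian (I.avgPrimal best t) (I.avgDual best t)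
        - I.lagrangian (PMF.pure (best (I.avgDual best t))) (I.avgDual best t))
      (I.lagrangian (I.avgPrimal best t) (I.bestDual (I.avgPrimal best t))
        - I.lagrangian (I.avgPrimal best t) (I.avgDual best t))

/-- The algorithm stops in iteration `t + 1`: this is the first one whose gap is at most `ν`. -/
def StopsAt (t : ℕ) : Prop := IsLeast {t : ℕ | I.gap best t ≤ I.acc} t

open Classical in
/-- What the algorithm returns when it stops in iteration `t + 1`; `none` stands for `null`. -/
noncomputable def returned (t : ℕ) : Option (PMF ι) :=
  if avg (I.avgPrimal best t) I.cost ≤ I.tol + (I.range + 2 * I.acc) / I.bound then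
    some (I.avgPrimal best t)
  else none

end EGInput

/-- The algorithm's input for the data set `d`: empirical disparity and cost, tolerance
`ε̂ = ε - ĉ₀ + C' n^{-φ} + C'' n^{-1/2}`, dual bound `B`, accuracy `ν` and learning rate
`η = ν / (2 ρ² B)`, where `ρ = sup_f |ĉost(h_f) - ε̂|`. -/
noncomputable def egInput {𝒳 : Type*} {n : ℕ} (F : Set (𝒳 → ℝ)) (β : Fin 2 → ℝ)
    (ev : Fin 2 → GroupEvent) (l : ℝ → ℝ → ℝ) (N : ℕ) (T : Finset ℝ)
    (φ ε C' C'' B ν : ℝ) (d : Data 𝒳 n) : EGInput F :=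
  let tol := ε - empConst l N T d + C' * (n : ℝ) ^ (-φ) + C'' * (n : ℝ) ^ (-(1 / 2) : ℝ)
  { disp := fun f => empDisparity β ev N d f
    cost := fun f => empCost l N T d f
    tol := tol
    bound := B
    acc := ν
    rate := ν / (2 * (⨆ f : F, |empCost l N T d f - tol|) ^ 2 * B)
    range := |β 0| + |β 1| }

/-- The factor `K (1 + ln n + ln(1/δ))^k` that the notation `Õ` hides. -/
noncomputable def polylog (K : ℝ) (k n : ℕ) (δ : ℝ) : ℝ :=
  K * (1 + Real.log n + Real.log (1 / δ)) ^ k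

/-!
The tower property replaces every expectation that involves the unobserved outcome by one that
involves only its regression `μ`. A prediction `f` is, up to `1 / N`, the average over a grid of
levels `z` of its threshold classifiers `1 {f ≥ z}`; hence the loss and each group average of `f`
are averages over `z` of means of a threshold classifier times a bounded weight. By bounded
differences, symmetrization and the contraction principle, the sample versions of these means are
uniformly within a deviation radius of order `n ^ (-φ)`, up to logarithms, with probability at
least `1 - δ`. The tolerance `ε̂` exceeds `ε` by a margin that dominates this radius, so every
feasible `Q` is also feasible on the sample.

The multiplier updates are online learning with logistic weights, and their regret bound yields a
`ν`-approximate saddle point of the Lagrangian within `O((ρ B / ν) ^ 2)` iterations. Such a saddle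
point has nearly optimal sample disparity among the sample-feasible `Q`, and sample cost at most
`ε̂` plus a multiple of `1 / B` as soon as some `Q` is sample-feasible. Uniform closeness carries
both facts back to the population; for a disparity, a ratio of two means, this uses that the
denominators are bounded away from zero.
-/

/-! ### Averages -/

section Avg

variable {ι κ : Type*} {Q : PMF ι} {v w : ι → ℝ}

/-- The series defining the average `avg Q v` converges; without this, `avg Q v` is the junk
value `0`. -/
def AvgSummable (Q : PMF ι) (v : ι → ℝ) : Prop := Summable fun i => (Q i).toReal * v i

lemma avgSummable_const (Q : PMF ι) (c : ℝ) : AvgSummable Q fun _ => c :=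
  (ENNReal.summable_toReal Q.tsum_coe_ne_top).mul_right c

lemma avgSummable_of_abs_le (Q : PMF ι) {b : ℝ} (hv : ∀ i, |v i| ≤ b) : AvgSummable Q v := by
  refine Summable.of_norm_bounded (avgSummable_const Q b) fun i => ?_
  rw [Real.norm_eq_abs, abs_mul, ENNReal.abs_toReal]
  exact mul_le_mul_of_nonneg_left (hv i) ENNReal.toReal_nonneg

lemma AvgSummable.add (hv : AvgSummable Q v) (hw : AvgSummable Q w) :
    AvgSummable Q fun i => v i + w i := by
  simpa only [AvgSummable, mul_add] using Summable.add hv hw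

lemma AvgSummable.const_mul (hv : AvgSummable Q v) (c : ℝ) : AvgSummable Q fun i => c * v i := by
  simpa only [AvgSummable, mul_left_comm] using Summable.mul_left c hv

lemma avg_const (Q : PMF ι) (c : ℝ) : avg Q (fun _ => c) = c := by
  rw [avg, tsum_mul_right, ← ENNReal.tsum_toReal_eq Q.apply_ne_top, Q.tsum_coe,
    ENNReal.toReal_one, one_mul]

lemma avg_mono (hv : AvgSummable Q v) (hw : AvgSummable Q w) (h : ∀ i, v i ≤ w i) :
    avg Q v ≤ avg Q w :=
  Summable.tsum_le_tsum (fun i => mul_le_mul_of_nonneg_left (h i) ENNReal.toReal_nonneg) hv hw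

lemma avg_add (hv : AvgSummable Q v) (hw : AvgSummable Q w) :
    avg Q (fun i => v i + w i) = avg Q v + avg Q w := by
  simp only [avg, mul_add]
  exact Summable.tsum_add hv hw

lemma avg_const_mul (c : ℝ) : avg Q (fun i => c * v i) = c * avg Q v := by
  simp only [avg, mul_left_comm _ c, tsum_mul_left]

lemma avg_le_avg_add_const (hv : AvgSummable Q v) (hw : AvgSummable Q w) {c : ℝ}
    (h : ∀ i, v i ≤ w i + c) : avg Q v ≤ avg Q w + c := by
  simpa only [avg_add hw (avgSummable_const Q c), avg_const] using
    avg_mono hv (hw.add (avgSummable_const Q c)) h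

lemma avg_pure (i : ι) (v : ι → ℝ) : avg (PMF.pure i) v = v i := by
  rw [avg, tsum_eq_single i fun j hj => by simp [PMF.pure_apply, hj]]
  simp

lemma avg_eq_integral [MeasurableSpace ι] [MeasurableSingletonClass ι]
    (hv : Integrable v Q.toMeasure) : avg Q v = ∫ i, v i ∂Q.toMeasure := by
  simp only [avg, PMF.integral_eq_tsum Q v hv, smul_eq_mul]

lemma avg_map_uniformOfFintype [Fintype κ] [Nonempty κ] (g : κ → ι) (v : ι → ℝ) :
    avg ((PMF.uniformOfFintype κ).map g) v = (∑ s, v (g s)) / Fintype.card κ := by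
  let _ : MeasurableSpace ι := ⊤
  let _ : MeasurableSpace κ := ⊤
  have hg : Measurable g := measurable_from_top
  have hv : Measurable v := measurable_from_top
  have hint : Integrable v ((PMF.uniformOfFintype κ).map g).toMeasure := by
    rw [← PMF.toMeasure_map _ _ hg, integrable_map_measure hv.aestronglyMeasurable hg.aemeasurable]
    exact .of_finite
  rw [avg_eq_integral hint, ← PMF.toMeasure_map _ _ hg,
    integral_map hg.aemeasurable hv.aestronglyMeasurable, PMF.integral_eq_sum]
  simp [← Finset.mul_sum, div_eq_inv_mul]

end Avg

/-! ### Online learning -/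

section OnlineLearning

lemma exp_le_self_add_exp_sq (x : ℝ) : Real.exp x ≤ x + Real.exp (x ^ 2) := by
  have hsq := Real.add_one_le_exp (x ^ 2)
  rcases le_total |x| 1 with h | h
  · linarith [(abs_le.1 (Real.abs_exp_sub_one_sub_id_le h)).2]
  rcases le_total 0 x with hx | hx
  · rw [abs_of_nonneg hx] at h
    linarith [Real.exp_le_exp.2 (show x ≤ x ^ 2 by nlinarith)]
  · rw [abs_of_nonpos hx] at h
    nlinarith [Real.exp_le_one_iff.2 hx]

/-- A cheap form of Hoeffding's lemma for a Bernoulli variable of mean `p`. -/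
lemma one_sub_add_mul_exp_le {p : ℝ} (hp₀ : 0 ≤ p) (hp₁ : p ≤ 1) (x : ℝ) :
    1 - p + p * Real.exp x ≤ Real.exp (p * x + x ^ 2) := by
  have hsmall : ∀ c : ℝ, c ^ 2 ≤ 1 → Real.exp (c * x) ≤ c * x + Real.exp (x ^ 2) := fun c hc =>
    (exp_le_self_add_exp_sq _).trans <| by
      rw [mul_pow]
      gcongr
      exact mul_le_of_le_one_left (sq_nonneg x) hc
  have hcentred : (1 - p) * Real.exp (-p * x) + p * Real.exp ((1 - p) * x) ≤ Real.exp (x ^ 2) := by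
    nlinarith [mul_le_mul_of_nonneg_left (hsmall (1 - p) (by nlinarith)) hp₀,
      mul_le_mul_of_nonneg_left (hsmall (-p) (by nlinarith)) (sub_nonneg.2 hp₁)]
  calc 1 - p + p * Real.exp x
      = Real.exp (p * x)
          * ((1 - p) * Real.exp (-p * x) + p * Real.exp ((1 - p) * x)) := by
        rw [mul_add, mul_left_comm, ← Real.exp_add, mul_left_comm, ← Real.exp_add]
        ring_nf
        rw [Real.exp_zero, mul_one]
        ring
    _ ≤ Real.exp (p * x + x ^ 2) := by
        rw [Real.exp_add]
        exact mul_le_mul_of_nonneg_left hcentred (Real.exp_pos _).le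

lemma sigmoid_eq_exp_div (θ : ℝ) : Real.sigmoid θ = Real.exp θ / (1 + Real.exp θ) := by
  rw [Real.sigmoid_def, Real.exp_neg]
  field_simp
  ring

/-- The softplus function `log (1 + exp θ)`, whose derivative is the sigmoid, lies below its
tangents up to a quadratic error. -/
lemma log_one_add_exp_add_le (θ x : ℝ) :
    Real.log (1 + Real.exp (θ + x)) ≤
      Real.log (1 + Real.exp θ) + Real.sigmoid θ * x + x ^ 2 := by
  have hp₀ := Real.sigmoid_pos θ
  have hp₁ := Real.sigmoid_lt_one θ
  have hpos : 0 < 1 - Real.sigmoid θ + Real.sigmoid θ * Real.exp x := by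
    have := Real.exp_pos x
    nlinarith
  have hfactor : 1 + Real.exp (θ + x)
      = (1 + Real.exp θ) * (1 - Real.sigmoid θ + Real.sigmoid θ * Real.exp x) := by
    rw [Real.exp_add, sigmoid_eq_exp_div]
    field_simp
    ring
  rw [hfactor, Real.log_mul (by positivity) hpos.ne', add_assoc]
  gcongr
  exact (Real.log_le_iff_le_exp hpos).2 (one_sub_add_mul_exp_le hp₀.le hp₁.le x)

/-- The regret bound of exponentiated gradient ascent with two actions, by the potential method:
softplus dominates every `θ ↦ q * θ`, `q ∈ [0, 1]`, and increases in each step by at most the gain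
of the learner plus a quadratic error. -/
lemma mul_sum_le_sum_sigmoid_mul_add {η r : ℝ} (hη : 0 < η) {g : ℕ → ℝ} (hg : ∀ s, |g s| ≤ r)
    {q : ℝ} (hq : q ∈ Set.Icc (0 : ℝ) 1) (m : ℕ) :
    q * ∑ s ∈ Finset.range m, g s ≤
      ∑ s ∈ Finset.range m, Real.sigmoid (η * ∑ j ∈ Finset.range s, g j) * g s
        + (Real.log 2 / η + m * (η * r ^ 2)) := by
  set θ : ℕ → ℝ := fun s => η * ∑ j ∈ Finset.range s, g j with hθ
  have hpotential : ∀ t, Real.log (1 + Real.exp (θ t)) ≤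
      Real.log 2 + η * ∑ s ∈ Finset.range t, Real.sigmoid (θ s) * g s + t * (η * r) ^ 2 := by
    intro t
    induction t with
    | zero => simp [hθ, one_add_one_eq_two]
    | succ t ih =>
      have hsq : (η * g t) ^ 2 ≤ (η * r) ^ 2 := by
        rw [mul_pow, mul_pow]
        refine mul_le_mul_of_nonneg_left ?_ (sq_nonneg η)
        exact sq_le_sq' (abs_le.1 (hg t)).1 (abs_le.1 (hg t)).2
      have hstep := log_one_add_exp_add_le (θ t) (η * g t)
      rw [show θ (t + 1) = θ t + η * g t by simp only [hθ, Finset.sum_range_succ, mul_add],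
        Finset.sum_range_succ]
      push_cast
      linarith
  have hdominates : q * θ m ≤ Real.log (1 + Real.exp (θ m)) := by
    rw [Real.le_log_iff_exp_le (by positivity)]
    rcases le_total 0 (θ m) with h | h
    · exact (Real.exp_le_exp.2 (mul_le_of_le_one_left h hq.2)).trans (by linarith)
    · exact (Real.exp_le_one_iff.2 (mul_nonpos_of_nonneg_of_nonpos hq.1 h)).trans
        (by linarith [Real.exp_pos (θ m)])
  refine le_of_mul_le_mul_left ?_ hη
  calc η * (q * ∑ s ∈ Finset.range m, g s) = q * θ m := mul_left_comm _ _ _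
    _ ≤ _ := hdominates.trans (hpotential m)
    _ = _ := by field_simp; ring

end OnlineLearning

/-! ### The exponentiated gradient algorithm -/

namespace EGInput

variable {ι : Type*} (I : EGInput ι) (best : ℝ → ι)

/-- The constraint violation `cost(f_t) - ε̂` of the `t`-th primal iterate. -/
noncomputable def slack (t : ℕ) : ℝ := I.cost (I.primal best t) - I.tol

/-- The Lagrangian payoffs `L(f_s, λ_s)` of the rounds up to `t`, averaged. -/
noncomputable def payoff (t : ℕ) : ℝ :=
  (∑ s ∈ Finset.range (t + 1),
    (I.disp (I.primal best s) + I.dual best s * I.slack best s)) / ((t : ℝ) + 1)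

lemma theta_eq_mul_sum (t : ℕ) :
    I.theta best t = I.rate * ∑ s ∈ Finset.range t, I.slack best s := by
  induction t with
  | zero => simp [theta]
  | succ t ih => rw [theta, ih, Finset.sum_range_succ, mul_add, slack, primal, dual, ih]

lemma dual_eq_mul_sigmoid (t : ℕ) :
    I.dual best t = I.bound * Real.sigmoid (I.rate * ∑ s ∈ Finset.range t, I.slack best s) := by
  rw [dual, dualOf, theta_eq_mul_sum, sigmoid_eq_exp_div]

lemma dual_mem_Icc (hB : 0 ≤ I.bound) (t : ℕ) : I.dual best t ∈ Set.Icc 0 I.bound := by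
  rw [dual_eq_mul_sigmoid]
  exact ⟨mul_nonneg hB (Real.sigmoid_nonneg _), mul_le_of_le_one_right hB (Real.sigmoid_le_one _)⟩

lemma avgDual_mem_Icc (hB : 0 ≤ I.bound) (t : ℕ) : I.avgDual best t ∈ Set.Icc 0 I.bound := by
  have hpos : (0 : ℝ) < t + 1 := by positivity
  refine ⟨div_nonneg (Finset.sum_nonneg fun s _ => (I.dual_mem_Icc best hB s).1) hpos.le, ?_⟩
  rw [avgDual, div_le_iff₀ hpos]
  refine (Finset.sum_le_card_nsmul _ _ _ fun s _ => (I.dual_mem_Icc best hB s).2).trans_eq ?_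
  simp [mul_comm]

lemma bestDual_mem_Icc (hB : 0 ≤ I.bound) (Q : PMF ι) : I.bestDual Q ∈ Set.Icc 0 I.bound := by
  unfold bestDual
  split_ifs
  exacts [⟨le_rfl, hB⟩, ⟨hB, le_rfl⟩]

lemma lagrangian_le_lagrangian_bestDual (Q : PMF ι) {lam : ℝ} (hlam : lam ∈ Set.Icc 0 I.bound) :
    I.lagrangian Q lam ≤ I.lagrangian Q (I.bestDual Q) := by
  unfold lagrangian bestDual
  split_ifs with h
  · linarith [mul_nonpos_of_nonneg_of_nonpos hlam.1 h]
  · have := mul_le_mul_of_nonneg_right hlam.2 (not_le.1 h).le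
    linarith

lemma avg_avgPrimal (v : ι → ℝ) (t : ℕ) :
    avg (I.avgPrimal best t) v
      = (∑ s ∈ Finset.range (t + 1), v (I.primal best s)) / ((t : ℝ) + 1) := by
  -- The definition coerces `Fin (t + 1)` to `ℕ` inside the monad, that is, by a map of its own.
  change avg (PMF.map (fun s : ℕ => I.primal best s)
    (PMF.map (fun a : Fin (t + 1) => (a : ℕ)) (PMF.uniformOfFintype (Fin (t + 1))))) v = _
  rw [PMF.map_comp, avg_map_uniformOfFintype, Finset.sum_range]
  simp

lemma lagrangian_avgPrimal (t : ℕ) (lam : ℝ) :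
    I.lagrangian (I.avgPrimal best t) lam
      = (∑ s ∈ Finset.range (t + 1), I.disp (I.primal best s)
          + lam * ∑ s ∈ Finset.range (t + 1), I.slack best s) / ((t : ℝ) + 1) := by
  simp only [lagrangian, avg_avgPrimal, slack, Finset.sum_sub_distrib, Finset.sum_const,
    Finset.card_range, nsmul_eq_mul]
  push_cast
  field_simp

lemma lagrangian_avgPrimal_le_payoff_add (hB : 0 < I.bound) (hη : 0 < I.rate) {r : ℝ}
    (hr : ∀ i, |I.cost i - I.tol| ≤ r) {lam : ℝ} (hlam : lam ∈ Set.Icc 0 I.bound) (t : ℕ) :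
    I.lagrangian (I.avgPrimal best t) lam ≤ I.payoff best t
      + I.bound * (Real.log 2 / I.rate / (t + 1) + I.rate * r ^ 2) := by
  have hpos : (0 : ℝ) < t + 1 := by positivity
  have hregret := mul_sum_le_sum_sigmoid_mul_add hη (g := I.slack best) (fun s => hr _)
    (q := lam / I.bound) ⟨div_nonneg hlam.1 hB.le, (div_le_one hB).2 hlam.2⟩ (t + 1)
  have hcomparator : I.bound * (lam / I.bound * ∑ s ∈ Finset.range (t + 1), I.slack best s)
      = lam * ∑ s ∈ Finset.range (t + 1), I.slack best s := by
    rw [← mul_assoc, mul_div_cancel₀ _ hB.ne']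
  have hlearner : I.bound * ∑ s ∈ Finset.range (t + 1),
        Real.sigmoid (I.rate * ∑ j ∈ Finset.range s, I.slack best j) * I.slack best s
      = ∑ s ∈ Finset.range (t + 1), I.dual best s * I.slack best s := by
    simp only [Finset.mul_sum, ← mul_assoc, dual_eq_mul_sigmoid]
  have hscaled := mul_le_mul_of_nonneg_left hregret hB.le
  rw [hcomparator, mul_add, hlearner] at hscaled
  push_cast at hscaled
  rw [lagrangian_avgPrimal, payoff, Finset.sum_add_distrib, div_add' _ _ _ hpos.ne']
  gcongr ?_ / _
  rw [show I.bound * (Real.log 2 / I.rate / (t + 1) + I.rate * r ^ 2) * ((t : ℝ) + 1)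
    = I.bound * (Real.log 2 / I.rate + (t + 1) * (I.rate * r ^ 2)) by field_simp]
  linarith

variable {best}

lemma payoff_le_lagrangian_pure (hbest : I.IsBestResponse best) (hB : 0 ≤ I.bound) (t : ℕ)
    (i : ι) : I.payoff best t ≤ I.lagrangian (PMF.pure i) (I.avgDual best t) := by
  have hpos : (0 : ℝ) < t + 1 := by positivity
  rw [lagrangian, avg_pure, avg_pure, payoff, div_le_iff₀ hpos]
  calc _ ≤ ∑ s ∈ Finset.range (t + 1), (I.disp i + I.dual best s * (I.cost i - I.tol)) :=
        Finset.sum_le_sum fun s _ => hbest _ (I.dual_mem_Icc best hB s) i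
    _ = _ := by
        rw [Finset.sum_add_distrib, ← Finset.sum_mul, avgDual]
        simp only [Finset.sum_const, Finset.card_range, nsmul_eq_mul]
        push_cast
        field_simp

lemma gap_le_of_lagrangian_le (hbest : I.IsBestResponse best) (hB : 0 ≤ I.bound) {t : ℕ} {d : ℝ}
    (h : ∀ lam ∈ Set.Icc 0 I.bound,
      I.lagrangian (I.avgPrimal best t) lam ≤ I.payoff best t + d) :
    I.gap best t ≤ d := by
  have hpos : (0 : ℝ) < t + 1 := by positivity
  have hpayoff : I.payoff best t ≤ I.lagrangian (I.avgPrimal best t) (I.avgDual best t) := by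
    rw [lagrangian_avgPrimal, le_div_iff₀ hpos, Finset.mul_sum, ← Finset.sum_add_distrib]
    calc _ = ∑ _s ∈ Finset.range (t + 1), I.payoff best t := by simp [mul_comm]
      _ ≤ _ := Finset.sum_le_sum fun _ _ => by
          simpa only [lagrangian, avg_pure, slack] using
            I.payoff_le_lagrangian_pure hbest hB t _
  refine max_le ?_ ?_
  · linarith [h _ (I.avgDual_mem_Icc best hB t),
      I.payoff_le_lagrangian_pure hbest hB t (best (I.avgDual best t))]
  · linarith [h _ (I.bestDual_mem_Icc hB (I.avgPrimal best t))]

lemma gap_le_acc (hbest : I.IsBestResponse best) (hB : 0 < I.bound) (hν : 0 < I.acc) {r : ℝ}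
    (hr₀ : 0 < r) (hr : ∀ i, |I.cost i - I.tol| ≤ r)
    (hrate : I.rate = I.acc / (2 * r ^ 2 * I.bound)) {t : ℕ}
    (ht : 4 * r ^ 2 * I.bound ^ 2 / I.acc ^ 2 ≤ (t : ℝ) + 1) : I.gap best t ≤ I.acc := by
  have hη : 0 < I.rate := by rw [hrate]; positivity
  refine I.gap_le_of_lagrangian_le hbest hB.le fun lam hlam =>
    (I.lagrangian_avgPrimal_le_payoff_add best hB hη hr hlam t).trans ?_
  have hlog : Real.log 2 ≤ 1 := by linarith [Real.log_two_lt_d9]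
  have hinit : I.bound * (Real.log 2 / I.rate / (t + 1)) ≤ I.acc / 2 := by
    calc _ ≤ I.bound * (1 / I.rate / (4 * r ^ 2 * I.bound ^ 2 / I.acc ^ 2)) := by gcongr
      _ = I.acc / 2 := by rw [hrate]; field_simp; norm_num
  have hdrift : I.bound * (I.rate * r ^ 2) = I.acc / 2 := by
    rw [hrate]
    field_simp
  linarith

lemma exists_stopsAt (hbest : I.IsBestResponse best) (hB : 0 < I.bound) (hν : 0 < I.acc)
    {r : ℝ} (hr₀ : 0 ≤ r) (hr : ∀ i, |I.cost i - I.tol| ≤ r)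
    (hrate : I.rate = I.acc / (2 * r ^ 2 * I.bound)) :
    ∃ t : ℕ, I.StopsAt best t ∧ (t : ℝ) + 1 ≤ 4 * r ^ 2 * I.bound ^ 2 / I.acc ^ 2 + 2 := by
  classical
  set m := ⌈4 * r ^ 2 * I.bound ^ 2 / I.acc ^ 2⌉₊
  have hgap : I.gap best m ≤ I.acc := by
    rcases hr₀.eq_or_lt with h | h
    · have hslack : ∀ i, I.cost i - I.tol = 0 := fun i => abs_nonpos_iff.1 ((hr i).trans h.ge)
      refine (I.gap_le_of_lagrangian_le (d := 0) hbest hB.le fun lam _ => ?_).trans hν.le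
      simp [lagrangian_avgPrimal, payoff, slack, hslack]
    · exact I.gap_le_acc hbest hB hν h hr hrate
        ((Nat.le_ceil _).trans (le_add_of_nonneg_right zero_le_one))
  have hex : ∃ t, I.gap best t ≤ I.acc := ⟨m, hgap⟩
  refine ⟨Nat.find hex, ⟨Nat.find_spec hex, fun s hs => Nat.find_min' hex hs⟩, ?_⟩
  have hfind : (Nat.find hex : ℝ) ≤ m := mod_cast Nat.find_min' hex hgap
  have hceil : (m : ℝ) < 4 * r ^ 2 * I.bound ^ 2 / I.acc ^ 2 + 1 :=
    Nat.ceil_lt_add_one (by positivity)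
  linarith

lemma lagrangian_pure_le_lagrangian (hbest : I.IsBestResponse best) {Q : PMF ι}
    (hdisp : AvgSummable Q I.disp) (hcost : AvgSummable Q I.cost) {lam : ℝ}
    (hlam : lam ∈ Set.Icc 0 I.bound) :
    I.lagrangian (PMF.pure (best lam)) lam ≤ I.lagrangian Q lam := by
  have hslack := hcost.add (avgSummable_const Q (-I.tol))
  calc I.lagrangian (PMF.pure (best lam)) lam
      = avg Q fun _ => I.disp (best lam) + lam * (I.cost (best lam) - I.tol) := by
        rw [avg_const, lagrangian, avg_pure, avg_pure]
    _ ≤ avg Q fun i => I.disp i + lam * (I.cost i + -I.tol) :=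
        avg_mono (avgSummable_const Q _) (hdisp.add (hslack.const_mul lam)) fun i =>
          hbest lam hlam i
    _ = I.lagrangian Q lam := by
        rw [avg_add hdisp (hslack.const_mul lam), avg_const_mul,
          avg_add hcost (avgSummable_const Q _), avg_const, lagrangian, sub_eq_add_neg]

lemma lagrangian_avgPrimal_le_of_gap_le (hbest : I.IsBestResponse best) (hB : 0 ≤ I.bound)
    {t : ℕ} (hgap : I.gap best t ≤ I.acc) {Q : PMF ι} (hdisp : AvgSummable Q I.disp)
    (hcost : AvgSummable Q I.cost) (hQ : avg Q I.cost ≤ I.tol) {lam : ℝ}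
    (hlam : lam ∈ Set.Icc 0 I.bound) :
    I.lagrangian (I.avgPrimal best t) lam ≤ avg Q I.disp + 2 * I.acc := by
  have hmem := I.avgDual_mem_Icc best hB t
  have hprimal := (le_max_left _ _).trans hgap
  have hdual := (le_max_right _ _).trans hgap
  have hsaddle := I.lagrangian_le_lagrangian_bestDual (I.avgPrimal best t) hlam
  have hresponse : I.lagrangian (PMF.pure (best (I.avgDual best t))) (I.avgDual best t)
      ≤ avg Q I.disp :=
    (I.lagrangian_pure_le_lagrangian hbest hdisp hcost hmem).trans <|
      add_le_of_nonpos_right (mul_nonpos_of_nonneg_of_nonpos hmem.1 (sub_nonpos.2 hQ))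
  linarith

lemma avg_cost_avgPrimal_le_of_gap_le (hbest : I.IsBestResponse best) (hB : 0 < I.bound) {t : ℕ}
    (hgap : I.gap best t ≤ I.acc) {m b : ℝ} (hdisp : ∀ i, I.disp i ∈ Set.Icc m (m + I.range))
    (hcost : ∀ i, |I.cost i| ≤ b) {Q : PMF ι} (hQ : avg Q I.cost ≤ I.tol) :
    avg (I.avgPrimal best t) I.cost ≤ I.tol + (I.range + 2 * I.acc) / I.bound := by
  have hsummable (Q : PMF ι) : AvgSummable Q I.disp :=
    avgSummable_of_abs_le Q fun i => abs_le_max_abs_abs (hdisp i).1 (hdisp i).2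
  have hlagrangian := I.lagrangian_avgPrimal_le_of_gap_le hbest hB.le hgap (hsummable Q)
    (avgSummable_of_abs_le Q hcost) hQ (Set.right_mem_Icc.2 hB.le)
  have hupper := avg_mono (hsummable Q) (avgSummable_const Q _) fun i => (hdisp i).2
  have hlower := avg_mono (avgSummable_const _ m) (hsummable (I.avgPrimal best t)) fun i =>
    (hdisp i).1
  rw [avg_const] at hupper hlower
  rw [lagrangian] at hlagrangian
  rw [← sub_le_iff_le_add', le_div_iff₀ hB]
  linarith

lemma avg_disp_avgPrimal_le_of_gap_le (hbest : I.IsBestResponse best) (hB : 0 ≤ I.bound) {t : ℕ}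
    (hgap : I.gap best t ≤ I.acc) {Q : PMF ι} (hdisp : AvgSummable Q I.disp)
    (hcost : AvgSummable Q I.cost) (hQ : avg Q I.cost ≤ I.tol) :
    avg (I.avgPrimal best t) I.disp ≤ avg Q I.disp + 2 * I.acc := by
  simpa only [lagrangian, zero_mul, add_zero] using I.lagrangian_avgPrimal_le_of_gap_le hbest hB
    hgap hdisp hcost hQ (Set.left_mem_Icc.2 hB)

theorem returned_spec (hbest : I.IsBestResponse best) (hB : 0 < I.bound) {t : ℕ}
    (hstops : I.StopsAt best t) {m b b' ε d Δ : ℝ}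
    (hdisp : ∀ i, I.disp i ∈ Set.Icc m (m + I.range)) (hcost : ∀ i, |I.cost i| ≤ b)
    {disp' loss' : ι → ℝ} (hloss : ∀ i, |loss' i| ≤ b') (hdist : ∀ i, |I.disp i - disp' i| ≤ Δ)
    (hupper : ∀ i, I.cost i ≤ loss' i + (I.tol - ε)) (hlower : ∀ i, loss' i ≤ I.cost i + d) :
    (∃ Qhat, I.returned best t = some Qhat ∧
      avg Qhat loss' ≤ I.tol + (I.range + 2 * I.acc) / I.bound + d ∧
      ∀ Q, avg Q loss' ≤ ε → avg Qhat disp' ≤ avg Q disp' + (2 * I.acc + 2 * Δ)) ∨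
    (I.returned best t = none ∧ ¬ ∃ Q, avg Q loss' ≤ ε) := by
  have hgap : I.gap best t ≤ I.acc := hstops.1
  have hdispS (Q : PMF ι) : AvgSummable Q I.disp :=
    avgSummable_of_abs_le Q fun i => abs_le_max_abs_abs (hdisp i).1 (hdisp i).2
  have hcostS (Q : PMF ι) : AvgSummable Q I.cost := avgSummable_of_abs_le Q hcost
  have hlossS (Q : PMF ι) : AvgSummable Q loss' := avgSummable_of_abs_le Q hloss
  have hdisp'S (Q : PMF ι) : AvgSummable Q disp' := by
    simpa using (hdispS Q).add ((avgSummable_of_abs_le Q hdist).const_mul (-1))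
  have hfeasible {Q : PMF ι} (hQ : avg Q loss' ≤ ε) : avg Q I.cost ≤ I.tol := by
    linarith [avg_le_avg_add_const (hcostS Q) (hlossS Q) hupper]
  by_cases hr : avg (I.avgPrimal best t) I.cost ≤ I.tol + (I.range + 2 * I.acc) / I.bound
  · refine Or.inl ⟨I.avgPrimal best t, if_pos hr, ?_, fun Q hQ => ?_⟩
    · linarith [avg_le_avg_add_const (hlossS (I.avgPrimal best t)) (hcostS _) hlower]
    · have hopt := I.avg_disp_avgPrimal_le_of_gap_le hbest hB.le hgap (hdispS Q) (hcostS Q)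
        (hfeasible hQ)
      have hle := avg_le_avg_add_const (hdisp'S (I.avgPrimal best t)) (hdispS _) (c := Δ) fun i =>
        by linarith [(abs_le.1 (hdist i)).1]
      have hge := avg_le_avg_add_const (hdispS Q) (hdisp'S Q) (c := Δ) fun i =>
        by linarith [(abs_le.1 (hdist i)).2]
      linarith
  · exact Or.inr ⟨if_neg hr, fun ⟨Q, hQ⟩ =>
      hr (I.avg_cost_avgPrimal_le_of_gap_le hbest hB hgap hdisp hcost (hfeasible hQ))⟩

end EGInput

/-! ### Bounded differences -/

section BoundedDifferences

open scoped NNReal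

variable {Ω Ω' : Type*} [MeasurableSpace Ω] [MeasurableSpace Ω']

lemma abs_integral_le_of_abs_le {P : Measure Ω} [IsProbabilityMeasure P] {f : Ω → ℝ} {b : ℝ}
    (hf : ∀ x, |f x| ≤ b) : |∫ x, f x ∂P| ≤ b := by
  simpa using norm_integral_le_of_norm_le_const (μ := P) (f := f) (.of_forall hf)

lemma integrable_exp_mul_of_abs_le {P : Measure Ω} [IsFiniteMeasure P] {f : Ω → ℝ} {b : ℝ}
    (hf : AEMeasurable f P) (hb : ∀ x, |f x| ≤ b) (t : ℝ) :
    Integrable (fun x => Real.exp (t * f x)) P :=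
  integrable_exp_mul_of_mem_Icc hf (.of_forall fun x => abs_le.1 (hb x))

lemma hasSubgaussianMGF_of_abs_sub_le {P : Measure Ω} [IsProbabilityMeasure P] {g : Ω → ℝ}
    {c : ℝ≥0} (hg : AEMeasurable g P) {S : Set Ω} (hS : ∀ᵐ x ∂P, x ∈ S)
    (hosc : ∀ x ∈ S, ∀ y ∈ S, |g x - g y| ≤ c) :
    HasSubgaussianMGF (fun x => g x - ∫ y, g y ∂P) ((c / 2) ^ 2) P := by
  obtain ⟨x₀, hx₀⟩ := hS.exists
  have hbdd : BddBelow (g '' S) :=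
    ⟨g x₀ - c, Set.forall_mem_image.2 fun y hy => by linarith [(abs_le.1 (hosc x₀ hx₀ y hy)).2]⟩
  have hmem : ∀ᵐ x ∂P, g x ∈ Set.Icc (sInf (g '' S)) (sInf (g '' S) + c) := by
    filter_upwards [hS] with x hx
    refine ⟨csInf_le hbdd ⟨x, hx, rfl⟩, sub_le_iff_le_add.1 (le_csInf ⟨g x₀, x₀, hx₀, rfl⟩ ?_)⟩
    exact Set.forall_mem_image.2 fun y hy => by linarith [(abs_le.1 (hosc x hx y hy)).2]
  simpa using hasSubgaussianMGF_of_mem_Icc hg hmem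

/-- Sub-Gaussian constants add along the decomposition of `G - E G` into the deviation of `G` from
its conditional mean and that of the conditional mean from `E G`. -/
lemma hasSubgaussianMGF_prod {P : Measure Ω} {Q : Measure Ω'} [IsProbabilityMeasure P]
    [IsProbabilityMeasure Q] {G : Ω × Ω' → ℝ} {b : ℝ} (hG : AEMeasurable G (P.prod Q))
    (hb : ∀ q, |G q| ≤ b) {c₁ c₂ : ℝ≥0}
    (hslice : ∀ᵐ x ∂P, HasSubgaussianMGF (fun y => G (x, y) - ∫ y', G (x, y') ∂Q) c₁ Q)
    (hmean : HasSubgaussianMGF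
      (fun x => ∫ y, G (x, y) ∂Q - ∫ x', ∫ y, G (x', y) ∂Q ∂P) c₂ P) :
    HasSubgaussianMGF (fun q => G q - ∫ q', G q' ∂P.prod Q) (c₁ + c₂) (P.prod Q) := by
  have hint : Integrable G (P.prod Q) := .of_bound hG.aestronglyMeasurable b (.of_forall hb)
  set E := ∫ q', G q' ∂P.prod Q with hE
  have hexp : ∀ t, Integrable (fun q => Real.exp (t * (G q - E))) (P.prod Q) := fun t =>
    integrable_exp_mul_of_abs_le (hG.sub_const E) (fun q => (abs_sub _ _).trans
      (add_le_add (hb q) (abs_integral_le_of_abs_le hb))) t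
  refine ⟨hexp, fun t => ?_⟩
  rw [integral_prod _ hint] at hE
  rw [← hE] at hmean
  rw [mgf, integral_prod _ (hexp t)]
  have hinner : ∀ᵐ x ∂P, ∫ y, Real.exp (t * (G (x, y) - E)) ∂Q
      ≤ Real.exp (c₁ * t ^ 2 / 2) * Real.exp (t * (∫ y, G (x, y) ∂Q - E)) := by
    filter_upwards [hslice] with x hx
    have hsplit : ∀ y, Real.exp (t * (G (x, y) - E))
        = Real.exp (t * (G (x, y) - ∫ y', G (x, y') ∂Q))
          * Real.exp (t * (∫ y', G (x, y') ∂Q - E)) := fun y => by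
      rw [← Real.exp_add]
      congr 1
      ring
    simp_rw [hsplit]
    rw [integral_mul_const]
    exact mul_le_mul_of_nonneg_right (hx.mgf_le t) (Real.exp_pos _).le
  calc _ ≤ ∫ x, Real.exp (c₁ * t ^ 2 / 2) * Real.exp (t * (∫ y, G (x, y) ∂Q - E)) ∂P :=
        integral_mono_ae (hexp t).integral_prod_left
          ((hmean.integrable_exp_mul t).const_mul _) hinner
    _ ≤ Real.exp (c₁ * t ^ 2 / 2) * Real.exp (c₂ * t ^ 2 / 2) := by
        rw [integral_const_mul]
        exact mul_le_mul_of_nonneg_left (hmean.mgf_le t) (Real.exp_pos _).le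
    _ = _ := by
        rw [← Real.exp_add, NNReal.coe_add]
        ring_nf

lemma abs_sub_le_sum_of_bounded_differences {α ι : Type*} [Fintype ι] [DecidableEq ι]
    {f : (ι → α) → ℝ} {c : ι → ℝ≥0} (hf : ∀ s i x, |f (Function.update s i x) - f s| ≤ c i)
    (s t : ι → α) : |f s - f t| ≤ ∑ i, (c i : ℝ) := by
  have hpartial : ∀ S : Finset ι, |f (S.piecewise s t) - f t| ≤ ∑ i ∈ S, (c i : ℝ) := by
    intro S
    induction S using Finset.induction_on with
    | empty => simp
    | insert i S hi ih =>
      rw [Finset.piecewise_insert, Finset.sum_insert hi]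
      exact (abs_sub_le _ (f (S.piecewise s t)) _).trans (add_le_add (hf _ i _) ih)
  simpa using hpartial Finset.univ

lemma hasSubgaussianMGF_of_comp {P : Measure Ω} {Q : Measure Ω'} {e : Ω → Ω'}
    (he : MeasurePreserving e P Q) {f : Ω' → ℝ} (hf : AEMeasurable f Q) {c : ℝ≥0}
    (h : HasSubgaussianMGF (fun x => f (e x) - ∫ x', f (e x') ∂P) c P) :
    HasSubgaussianMGF (fun y => f y - ∫ y', f y' ∂Q) c Q := by
  have hf' : AEMeasurable f (P.map e) := he.map_eq.symm ▸ hf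
  rw [← integral_map he.aemeasurable hf'.aestronglyMeasurable, he.map_eq] at h
  refine h.congr_identDistrib ⟨h.aemeasurable, hf.sub_const _, ?_⟩
  rw [← he.map_eq]
  exact (AEMeasurable.map_map_of_aemeasurable (hf'.sub_const _) he.aemeasurable).symm

lemma measurePreserving_cons {m : ℕ} (P : Fin (m + 1) → Measure Ω)
    [∀ i, IsProbabilityMeasure (P i)] :
    MeasurePreserving (fun q : Ω × (Fin m → Ω) => (Fin.cons q.1 q.2 : Fin (m + 1) → Ω))
      ((P 0).prod (Measure.pi fun i => P i.succ)) (Measure.pi P) := by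
  simpa using! (measurePreserving_piFinSuccAbove P 0).symm

/-- McDiarmid's inequality. The function need only be almost everywhere measurable, but its
differences are bounded everywhere. -/
theorem hasSubgaussianMGF_of_bounded_differences {m : ℕ} (P : Fin m → Measure Ω)
    [∀ i, IsProbabilityMeasure (P i)] {f : (Fin m → Ω) → ℝ} (hf : AEMeasurable f (Measure.pi P))
    {c : Fin m → ℝ≥0} (hd : ∀ s i x, |f (Function.update s i x) - f s| ≤ c i) :
    HasSubgaussianMGF (fun s => f s - ∫ t, f t ∂Measure.pi P) (∑ i, (c i / 2) ^ 2)
      (Measure.pi P) := by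
  induction m with
  | zero =>
    have hconst : ∀ s, f s = f default := fun s => congrArg f (Subsingleton.elim _ _)
    simp [hconst]
  | succ m ih =>
    obtain ⟨s₀⟩ : Nonempty (Fin (m + 1) → Ω) := nonempty_of_isProbabilityMeasure (Measure.pi P)
    set Q := Measure.pi fun i : Fin m => P i.succ
    have hb : ∀ s, |f s| ≤ ∑ i, (c i : ℝ) + |f s₀| := fun s => by
      linarith [abs_sub_abs_le_abs_sub (f s) (f s₀), abs_sub_le_sum_of_bounded_differences hd s s₀]
    have hcons := measurePreserving_cons P
    set G : Ω × (Fin m → Ω) → ℝ := fun q => f (Fin.cons q.1 q.2) with hG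
    have hGm : AEMeasurable G ((P 0).prod Q) :=
      hf.comp_quasiMeasurePreserving hcons.quasiMeasurePreserving
    have hGint : Integrable G ((P 0).prod Q) :=
      .of_bound hGm.aestronglyMeasurable _ (.of_forall fun q => hb _)
    have hslices := hGint.aestronglyMeasurable.prodMk_left
    have hslice : ∀ᵐ x ∂P 0, HasSubgaussianMGF (fun s => G (x, s) - ∫ t, G (x, t) ∂Q)
        (∑ i : Fin m, (c i.succ / 2) ^ 2) Q := by
      filter_upwards [hslices] with x hx
      refine ih (fun i => P i.succ) hx.aemeasurable fun s i y => ?_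
      simpa only [hG, Fin.cons_update] using hd (Fin.cons x s) i.succ y
    have hmean : HasSubgaussianMGF
        (fun x => ∫ s, G (x, s) ∂Q - ∫ x', ∫ s, G (x', s) ∂Q ∂P 0) ((c 0 / 2) ^ 2) (P 0) := by
      refine hasSubgaussianMGF_of_abs_sub_le hGint.integral_prod_left.aemeasurable hslices
        fun x hx y hy => ?_
      rw [← integral_sub (.of_bound hx _ (.of_forall fun _ => hb _))
        (.of_bound hy _ (.of_forall fun _ => hb _))]
      refine abs_integral_le_of_abs_le fun s => ?_
      simpa only [hG, Fin.update_cons_zero] using hd (Fin.cons y s) 0 x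
    have hsum : ∑ i, (c i / 2) ^ 2 = ∑ i : Fin m, (c i.succ / 2) ^ 2 + (c 0 / 2) ^ 2 := by
      rw [Fin.sum_univ_succ, add_comm]
    rw [hsum]
    exact hasSubgaussianMGF_of_comp hcons hf
      (hasSubgaussianMGF_prod hGm (fun _ => hb _) hslice hmean)

end BoundedDifferences

/-! ### Rademacher averages of weighted layers -/

/-- The sign `±1` encoded by a Boolean, so that `Fin n → Bool` is the space of Rademacher signs. -/
def boolSign (t : Bool) : ℝ := if t then 1 else -1

lemma boolSign_not (t : Bool) : boolSign (!t) = -boolSign t := by cases t <;> simp [boolSign]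

lemma abs_boolSign (t : Bool) : |boolSign t| = 1 := by cases t <;> simp [boolSign]

lemma bddAbove_abs_sum_mul {ι κ : Type*} [Fintype ι] {H : κ → ι → ℝ} (hH : ∀ q i, |H q i| ≤ 1)
    (w : ι → ℝ) :
    BddAbove (Set.range fun q => |∑ i, w i * H q i|) := by
  refine ⟨∑ i, |w i|, Set.forall_mem_range.2 fun q => ?_⟩
  refine (Finset.abs_sum_le_sum_abs _ _).trans (Finset.sum_le_sum fun i _ => ?_)
  rw [abs_mul]
  exact mul_le_of_le_one_right (abs_nonneg _) (hH q i)

section Contraction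

variable {ι : Type*} [DecidableEq ι]

/-- The measure preserving involution of the space of signs that flips the sign at `k`. -/
def flipSign (k : ι) : Equiv.Perm (ι → Bool) :=
  Equiv.piCongrRight fun j => if j = k then Equiv.boolNot else Equiv.refl Bool

lemma boolSign_flipSign_self (k : ι) (σ : ι → Bool) :
    boolSign (flipSign k σ k) = -boolSign (σ k) := by
  simp [flipSign, boolSign_not]

lemma flipSign_of_ne {k i : ι} (h : i ≠ k) (σ : ι → Bool) : flipSign k σ i = σ i := by
  simp [flipSign, h]

variable [Fintype ι]

lemma sum_boolSign_apply (i : ι) : ∑ σ : ι → Bool, boolSign (σ i) = 0 := by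
  have h := Equiv.sum_comp (flipSign i) fun σ : ι → Bool => boolSign (σ i)
  simp only [boolSign_flipSign_self, Finset.sum_neg_distrib] at h
  linarith

variable {κ : Type*} {H : κ → ι → ℝ}

lemma sum_iSup_abs_update_neg_one (c : ι → ℝ) (k : ι) :
    ∑ σ : ι → Bool, ⨆ q, |∑ i, boolSign (σ i) * Function.update c k (-1) i * H q i| =
      ∑ σ : ι → Bool, ⨆ q, |∑ i, boolSign (σ i) * Function.update c k 1 i * H q i| := by
  rw [← Equiv.sum_comp (flipSign k)]
  refine Finset.sum_congr rfl fun σ _ => iSup_congr fun q => congrArg _ ?_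
  refine Finset.sum_congr rfl fun i _ => ?_
  rcases eq_or_ne i k with rfl | h
  · simp [boolSign_flipSign_self]
  · simp [flipSign_of_ne h, h]

lemma iSup_abs_sum_mul_le_update (hH : ∀ q i, |H q i| ≤ 1) (w c : ι → ℝ) {k : ι}
    (hk : |c k| ≤ 1) :
    ⨆ q, |∑ i, w i * c i * H q i| ≤
      (1 + c k) / 2 * (⨆ q, |∑ i, w i * Function.update c k 1 i * H q i|) +
        (1 - c k) / 2 * ⨆ q, |∑ i, w i * Function.update c k (-1) i * H q i| := by
  have hpos : 0 ≤ (1 + c k) / 2 := by linarith [(abs_le.1 hk).1]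
  have hneg : 0 ≤ (1 - c k) / 2 := by linarith [(abs_le.1 hk).2]
  have hnonneg (c' : ι → ℝ) : 0 ≤ ⨆ q, |∑ i, w i * c' i * H q i| :=
    Real.iSup_nonneg fun q => abs_nonneg _
  have hle (c' : ι → ℝ) (q : κ) := le_ciSup (bddAbove_abs_sum_mul hH fun i => w i * c' i) q
  refine Real.iSup_le (fun q => ?_)
    (add_nonneg (mul_nonneg hpos (hnonneg _)) (mul_nonneg hneg (hnonneg _)))
  have hsplit : ∑ i, w i * c i * H q i =
      (1 + c k) / 2 * ∑ i, w i * Function.update c k 1 i * H q i +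
        (1 - c k) / 2 * ∑ i, w i * Function.update c k (-1) i * H q i := by
    rw [Finset.mul_sum, Finset.mul_sum, ← Finset.sum_add_distrib]
    refine Finset.sum_congr rfl fun i _ => ?_
    rcases eq_or_ne i k with rfl | h
    · simp only [Function.update_self]
      ring
    · simp only [Function.update_of_ne h]
      ring
  rw [hsplit]
  refine (abs_add_le _ _).trans ?_
  rw [abs_mul, abs_mul, abs_of_nonneg hpos, abs_of_nonneg hneg]
  gcongr
  exacts [hle _ q, hle _ q]

/-- The contraction principle: a Rademacher average is convex in each weight and even in it, hence
largest at the weights `±1`. -/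
lemma sum_iSup_abs_mul_le (hH : ∀ q i, |H q i| ≤ 1) {c : ι → ℝ} (hc : ∀ i, |c i| ≤ 1) :
    ∑ σ : ι → Bool, ⨆ q, |∑ i, boolSign (σ i) * c i * H q i| ≤
      ∑ σ : ι → Bool, ⨆ q, |∑ i, boolSign (σ i) * H q i| := by
  have hstep (c : ι → ℝ) (k : ι) (hk : |c k| ≤ 1) :
      ∑ σ : ι → Bool, ⨆ q, |∑ i, boolSign (σ i) * c i * H q i| ≤
        ∑ σ : ι → Bool, ⨆ q, |∑ i, boolSign (σ i) * Function.update c k 1 i * H q i| := by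
    refine (Finset.sum_le_sum fun σ _ =>
      iSup_abs_sum_mul_le_update hH (fun i => boolSign (σ i)) c hk).trans_eq ?_
    rw [Finset.sum_add_distrib, ← Finset.mul_sum, ← Finset.mul_sum, sum_iSup_abs_update_neg_one]
    ring
  have hpartial (S : Finset ι) : ∑ σ : ι → Bool, ⨆ q, |∑ i, boolSign (σ i) * c i * H q i| ≤
      ∑ σ : ι → Bool, ⨆ q, |∑ i, boolSign (σ i) * S.piecewise (fun _ => 1) c i * H q i| := by
    induction S using Finset.induction_on with
    | empty => simp
    | insert k S hk ih =>
      refine ih.trans ((hstep _ k ?_).trans_eq ?_)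
      · simpa [hk] using hc k
      · rw [Finset.piecewise_insert]
  simpa using hpartial Finset.univ

end Contraction

lemma sum_iSup_abs_le_rademacher {U : Type*} {G : Set (U → ℝ)} (hG : ∀ g ∈ G, ∀ x, |g x| ≤ 1)
    {n : ℕ} (u : Fin n → U) :
    ∑ σ : Fin n → Bool, ⨆ g : G, |∑ i, boolSign (σ i) * (g : U → ℝ) (u i)| ≤
      2 ^ n * (n * rademacher G n) := by
  have habs (σ : Fin n → Bool) (g : G) (u : Fin n → U) :
      |∑ i, boolSign (σ i) * (g : U → ℝ) (u i)| ≤ n := by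
    refine (Finset.abs_sum_le_sum_abs _ _).trans
      ((Finset.sum_le_card_nsmul _ _ 1 fun i _ => ?_).trans (by simp))
    simpa [abs_mul, abs_boolSign] using hG g g.2 (u i)
  have hscale (σ : Fin n → Bool) : ⨆ g : G, |∑ i, boolSign (σ i) * (g : U → ℝ) (u i)| =
      n * ⨆ g : G, |(∑ i, boolSign (σ i) * (g : U → ℝ) (u i)) / n| := by
    rw [Real.mul_iSup_of_nonneg n.cast_nonneg]
    refine iSup_congr fun g => ?_
    rcases n.eq_zero_or_pos with rfl | hn
    · simp
    · rw [abs_div, Nat.abs_cast, mul_div_cancel₀ _ (by positivity)]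
  have hbdd : BddAbove (Set.range fun u : Fin n → U => (∑ σ : Fin n → Bool,
      ⨆ g : G, |(∑ i, boolSign (σ i) * (g : U → ℝ) (u i)) / n|) / 2 ^ n) := by
    refine ⟨1, Set.forall_mem_range.2 fun u => div_le_one_of_le₀ ?_ (by positivity)⟩
    refine (Finset.sum_le_card_nsmul _ _ 1 fun σ _ => Real.iSup_le (fun g => ?_)
      zero_le_one).trans (by simp)
    rw [abs_div, Nat.abs_cast]
    exact div_le_one_of_le₀ (habs σ g u) n.cast_nonneg
  have hle := le_ciSup hbdd u
  change _ ≤ rademacher G n at hle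
  rw [div_le_iff₀ (by positivity)] at hle
  rw [Finset.sum_congr rfl fun σ _ => hscale σ, ← Finset.mul_sum]
  calc _ ≤ n * (rademacher G n * 2 ^ n) := by gcongr
    _ = _ := by ring

section Layer

variable {𝒳 : Type*} (F : Set (𝒳 → ℝ)) (z : ℝ)

/-- The layer at level `z` of the class of threshold classifiers, together with the zero
classifier. The latter makes suprema over the layer dominate the sum of the constant terms. -/
noncomputable def layerClass : Option F → 𝒳 → ℝ
  | none, _ => 0
  | some f, x => thr f x z

variable {F z}

lemma thr_eq_zero_or_one (f : 𝒳 → ℝ) (x : 𝒳) (z : ℝ) : thr f x z = 0 ∨ thr f x z = 1 := by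
  unfold thr
  split_ifs <;> simp

lemma abs_thr_le_one (f : 𝒳 → ℝ) (x : 𝒳) (z : ℝ) : |thr f x z| ≤ 1 := by
  rcases thr_eq_zero_or_one f x z with h | h <;> simp [h]

lemma layerClass_eq_zero_or_one (q : Option F) (x : 𝒳) :
    layerClass F z q x = 0 ∨ layerClass F z q x = 1 := by
  cases q with
  | none => exact .inl rfl
  | some f => exact thr_eq_zero_or_one f x z

lemma sum_iSup_abs_thr_le_rademacher {n : ℕ} (hz : z ∈ Set.Icc (0 : ℝ) 1) (x : Fin n → 𝒳) :
    ∑ σ : Fin n → Bool, ⨆ f : F, |∑ i, boolSign (σ i) * thr (f : 𝒳 → ℝ) (x i) z| ≤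
      2 ^ n * (n * rademacher (thrClass F) n) := by
  have hG : ∀ h ∈ thrClass F, ∀ u, |h u| ≤ 1 := by
    rintro _ ⟨f, -, rfl⟩ u
    exact abs_thr_le_one f _ _
  refine (Finset.sum_le_sum fun σ _ => Real.iSup_le (fun f => ?_)
    (Real.iSup_nonneg fun _ => abs_nonneg _)).trans
    (sum_iSup_abs_le_rademacher hG fun i => (x i, ⟨z, hz⟩))
  exact le_ciSup (f := fun h : thrClass F =>
      |∑ i, boolSign (σ i) * (h : 𝒳 × Set.Icc (0 : ℝ) 1 → ℝ) (x i, ⟨z, hz⟩)|)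
    (bddAbove_abs_sum_mul (fun h : thrClass F => fun i => hG h h.2 _) _) ⟨_, f, f.2, rfl⟩

lemma sum_iSup_layerClass_le_rademacher {n : ℕ} (hz : z ∈ Set.Icc (0 : ℝ) 1) (x : Fin n → 𝒳)
    {c : Fin n → ℝ} (hc : ∀ i, |c i| ≤ 1) :
    ∑ σ : Fin n → Bool, ⨆ q : Option F, ∑ i, boolSign (σ i) * c i * layerClass F z q (x i) ≤
      2 ^ n * (n * rademacher (thrClass F) n) := by
  have hH (f : F) (i : Fin n) : |thr (f : 𝒳 → ℝ) (x i) z| ≤ 1 := abs_thr_le_one _ _ _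
  refine (Finset.sum_le_sum fun σ _ => ciSup_le fun q => ?_).trans
    ((sum_iSup_abs_mul_le hH hc).trans (sum_iSup_abs_thr_le_rademacher hz x))
  cases q with
  | none => simpa [layerClass] using Real.iSup_nonneg fun _ => abs_nonneg _
  | some f =>
    exact (le_abs_self _).trans
      (le_ciSup (bddAbove_abs_sum_mul hH fun i => boolSign (σ i) * c i) f)

end Layer

lemma measurePreserving_comp_perm {Ω : Type*} [MeasurableSpace Ω] (P : Measure Ω) [SigmaFinite P]
    {ι : Type*} [Fintype ι] (π : Equiv.Perm ι) :
    MeasurePreserving (fun s : ι → Ω => s ∘ π) (Measure.pi fun _ => P)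
      (Measure.pi fun _ => P) := by
  convert measurePreserving_piCongrLeft (fun _ : ι => P) π.symm using 1
  funext s i
  simpa using! (Equiv.piCongrLeft_apply_apply (fun _ : ι => Ω) π.symm s (π i)).symm

lemma measurePreserving_append {Ω : Type*} [MeasurableSpace Ω] (P : Measure Ω) [SigmaFinite P]
    (m n : ℕ) :
    MeasurePreserving (fun q : (Fin m → Ω) × (Fin n → Ω) => (Fin.append q.1 q.2 : Fin (m + n) → Ω))
      ((Measure.pi fun _ => P).prod (Measure.pi fun _ => P)) (Measure.pi fun _ => P) := by
  have hsum := measurePreserving_sumPiEquivProdPi_symm (fun _ : Fin m ⊕ Fin n => P)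
  have hfin := measurePreserving_piCongrLeft (fun _ : Fin (m + n) => P) finSumFinEquiv
  convert hfin.comp hsum using 1
  funext q i
  have hj (j : Fin m ⊕ Fin n) := Equiv.piCongrLeft_apply_apply (fun _ : Fin (m + n) => Ω)
    finSumFinEquiv ((MeasurableEquiv.sumPiEquivProdPi fun _ : Fin m ⊕ Fin n => Ω).symm q) j
  refine Fin.addCases (fun j => ?_) (fun j => ?_) i
  · simpa only [Fin.append_left] using! (hj (.inl j)).symm
  · simpa only [Fin.append_right] using! (hj (.inr j)).symm

/-! ### Suprema over a layer -/

/-- The pattern `S` maximizes the absolute value of a suitable linear form among all patterns, so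
that suprema of weighted sums over a class of classifiers detect whether it realizes `S`. -/
lemma card_mul_card_le_abs_sum_ite_iff {ι : Type*} [Fintype ι] [DecidableEq ι] {S : Finset ι}
    (hS : S.Nonempty) (T : Finset ι) :
    (Fintype.card ι * S.card : ℝ) ≤
      |∑ i, (if i ∈ S then (Fintype.card ι : ℝ) else -1) * if i ∈ T then 1 else 0| ↔ T = S := by
  set m := Fintype.card ι
  have hterm (i : ι) : (if i ∈ S then (m : ℝ) else -1) * (if i ∈ T then 1 else 0) =
      m * (if i ∈ T ∩ S then 1 else 0) - (if i ∈ T \ S then 1 else 0) := by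
    by_cases hS : i ∈ S <;> by_cases hT : i ∈ T <;> simp [hS, hT]
  have hsum : ∑ i, (if i ∈ S then (m : ℝ) else -1) * (if i ∈ T then 1 else 0) =
      m * (T ∩ S).card - (T \ S).card := by
    rw [Finset.sum_congr rfl fun i _ => hterm i, Finset.sum_sub_distrib, ← Finset.mul_sum]
    simp only [Finset.sum_boole, Finset.filter_univ_mem]
  have hpos : (1 : ℝ) ≤ S.card := mod_cast hS.card_pos
  have hcard : ((T \ S).card + S.card : ℝ) ≤ m := by
    rw [← Nat.cast_add, ← Finset.card_union_of_disjoint Finset.sdiff_disjoint]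
    exact_mod_cast Finset.card_le_univ _
  have hinter : ((T ∩ S).card : ℝ) ≤ S.card :=
    mod_cast Finset.card_le_card Finset.inter_subset_right
  rw [hsum]
  refine ⟨fun h => ?_, fun h => by simp [h]⟩
  rcases le_abs.1 h with h | h
  · have hsub : T ⊆ S := by
      have : ((T \ S).card : ℝ) ≤ 0 := by nlinarith [(T \ S).card.cast_nonneg (α := ℝ)]
      exact Finset.sdiff_eq_empty_iff_subset.1
        (Finset.card_eq_zero.1 (Nat.le_zero.1 (mod_cast this)))
    refine Finset.eq_of_subset_of_card_le hsub ((Nat.cast_le (α := ℝ)).1 ?_)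
    rw [Finset.inter_eq_left.2 hsub] at h
    nlinarith [(T \ S).card.cast_nonneg (α := ℝ)]
  · nlinarith [(T ∩ S).card.cast_nonneg (α := ℝ)]

section LayerSup

variable {𝒳 : Type*} {F : Set (𝒳 → ℝ)} {z : ℝ} {b c : Unit4 𝒳 → ℝ} {m : ℕ}

lemma measurable_feat [MeasurableSpace 𝒳] : Measurable (Unit4.feat : Unit4 𝒳 → 𝒳) :=
  measurable_fst

/-- Intercepts `b` and slopes `c` for which the functions `b + c h` with `h` a classifier take
values in `[-1,1]`; the uniform law of large numbers is proved for averages of such functions. -/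
structure IsLayerIntegrand [MeasurableSpace 𝒳] (b c : Unit4 𝒳 → ℝ) : Prop where
  measurable_base : Measurable b
  measurable_slope : Measurable c
  abs_base_le : ∀ o, |b o| ≤ 1
  abs_slope_le : ∀ o, |c o| ≤ 1
  abs_add_le : ∀ o, |b o + c o| ≤ 1

/-- The supremum of `∑ wᵢ (b + c h)(oᵢ)` over the classifiers `h` of the layer at level `z`. -/
noncomputable def layerSup (F : Set (𝒳 → ℝ)) (z : ℝ) (b c : Unit4 𝒳 → ℝ) (w : Fin m → ℝ)
    (s : Fin m → Unit4 𝒳) : ℝ :=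
  ⨆ q : Option F, ∑ i, w i * (b (s i) + c (s i) * layerClass F z q (s i).feat)

/-- The samples of features on which some superlevel set `{z ≤ f}` cuts out exactly the
positions `S`. -/
def realizing (F : Set (𝒳 → ℝ)) (z : ℝ) (S : Finset (Fin m)) : Set (Fin m → 𝒳) :=
  {x | ∃ f ∈ F, ∀ i, z ≤ f (x i) ↔ i ∈ S}

lemma thr_eq_ite_mem (f : 𝒳 → ℝ) (x : Fin m → 𝒳) (i : Fin m) :
    thr f (x i) z = if i ∈ ({i | z ≤ f (x i)} : Finset (Fin m)) then 1 else 0 := by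
  simp [thr]

lemma realizing_eq_setOf_le_iSup (hF : F.Nonempty) {S : Finset (Fin m)} (hS : S.Nonempty) :
    realizing F z S = {x | (m * S.card : ℝ) ≤
      ⨆ f : F, |∑ i, (if i ∈ S then (m : ℝ) else -1) * thr (f : 𝒳 → ℝ) (x i) z|} := by
  have : Nonempty F := hF.to_subtype
  ext x
  set val : Finset (Fin m) → ℝ := fun T =>
    |∑ i, (if i ∈ S then (m : ℝ) else -1) * if i ∈ T then 1 else 0|
  set cut : F → Finset (Fin m) := fun f => {i | z ≤ (f : 𝒳 → ℝ) (x i)}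
  have hval (T : Finset (Fin m)) : (m * S.card : ℝ) ≤ val T ↔ T = S := by
    simpa only [Fintype.card_fin] using card_mul_card_le_abs_sum_ite_iff hS T
  have hfin : (Set.range fun f => val (cut f)).Finite :=
    (Set.finite_range val).subset (Set.range_subset_iff.2 fun f => Set.mem_range_self (cut f))
  simp only [thr_eq_ite_mem, Set.mem_ofPred_eq]
  change _ ↔ (m * S.card : ℝ) ≤ ⨆ f, val (cut f)
  constructor
  · rintro ⟨f, hf, hx⟩
    exact ((hval _).2 (by ext i; simp [cut, hx])).trans (le_ciSup hfin.bddAbove ⟨f, hf⟩)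
  · intro h
    obtain ⟨f, hf⟩ := (Set.range_nonempty _).csSup_mem hfin
    rw [iSup, ← hf] at h
    exact ⟨f, f.2, fun i => by simp [← (hval _).1 h, cut]⟩

open Classical in
lemma layerSup_eq_iSup_realizing (w : Fin m → ℝ) (s : Fin m → Unit4 𝒳) :
    layerSup F z b c w s = ⨆ S : Finset (Fin m), ∑ i, w i * (b (s i) + c (s i) *
      if i ∈ (if (fun i => (s i).feat) ∈ realizing F z S then S else ∅) then 1 else 0) := by
  set val : Finset (Fin m) → ℝ := fun S =>
    ∑ i, w i * (b (s i) + c (s i) * if i ∈ S then 1 else 0)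
  set cut : Option F → Finset (Fin m) := fun q =>
    q.elim ∅ fun f => Finset.univ.filter fun i => z ≤ (f : 𝒳 → ℝ) (s i).feat
  have hcut (q : Option F) :
      ∑ i, w i * (b (s i) + c (s i) * layerClass F z q (s i).feat) = val (cut q) := by
    cases q <;> simp [val, cut, layerClass, thr]
  have hbdd : BddAbove (Set.range val) := (Set.finite_range val).bddAbove
  simp only [layerSup, hcut]
  refine le_antisymm (ciSup_le fun q => ?_) (ciSup_le fun S => ?_)
  · refine le_ciSup_of_le (hbdd.mono (Set.range_comp_subset_range _ val)) (cut q) (le_of_eq ?_)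
    rcases q with _ | f
    · change val ∅ = val (if _ then ∅ else ∅)
      rw [ite_self]
    · rw [if_pos ⟨f, f.2, fun i => by simp [cut]⟩]
  · have hle (q : Option F) : val (cut q) ≤ ⨆ q, val (cut q) :=
      le_ciSup (hbdd.mono (Set.range_comp_subset_range cut val)) q
    split_ifs with h
    · obtain ⟨f, hf, hS⟩ := h
      have hcutS : cut (some ⟨f, hf⟩) = S := by
        ext i
        simp [cut, hS]
      exact hcutS ▸ hle (some ⟨f, hf⟩)
    · exact hle none

variable [MeasurableSpace 𝒳] {P : Measure (Unit4 𝒳)}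

namespace IsLayerIntegrand

lemma neg (h : IsLayerIntegrand b c) : IsLayerIntegrand (-b) (-c) where
  measurable_base := h.measurable_base.neg
  measurable_slope := h.measurable_slope.neg
  abs_base_le o := by simpa using h.abs_base_le o
  abs_slope_le o := by simpa using h.abs_slope_le o
  abs_add_le o := by
    rw [Pi.neg_apply, Pi.neg_apply, ← neg_add, abs_neg]
    exact h.abs_add_le o

lemma abs_add_mul_le (h : IsLayerIntegrand b c) (o : Unit4 𝒳) {v : ℝ} (hv : v = 0 ∨ v = 1) :
    |b o + c o * v| ≤ 1 := by
  rcases hv with rfl | rfl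
  · simpa using h.abs_base_le o
  · simpa using h.abs_add_le o

variable {w : Fin m → ℝ}

lemma abs_sum_le (h : IsLayerIntegrand b c) (hw : ∀ i, |w i| ≤ 1) (s : Fin m → Unit4 𝒳)
    (q : Option F) : |∑ i, w i * (b (s i) + c (s i) * layerClass F z q (s i).feat)| ≤ m := by
  refine (Finset.abs_sum_le_sum_abs _ _).trans
    ((Finset.sum_le_card_nsmul _ _ 1 fun i _ => ?_).trans (by simp))
  rw [abs_mul]
  exact mul_le_one₀ (hw i) (abs_nonneg _) (h.abs_add_mul_le _ (layerClass_eq_zero_or_one q _))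

lemma sum_le_layerSup (h : IsLayerIntegrand b c) (hw : ∀ i, |w i| ≤ 1) (s : Fin m → Unit4 𝒳)
    (q : Option F) :
    ∑ i, w i * (b (s i) + c (s i) * layerClass F z q (s i).feat) ≤ layerSup F z b c w s :=
  le_ciSup (f := fun q : Option F =>
    ∑ i, w i * (b (s i) + c (s i) * layerClass F z q (s i).feat))
    ⟨m, Set.forall_mem_range.2 fun q => (le_abs_self _).trans (h.abs_sum_le hw s q)⟩ q

lemma abs_layerSup_le (h : IsLayerIntegrand b c) (hw : ∀ i, |w i| ≤ 1) (s : Fin m → Unit4 𝒳) :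
    |layerSup F z b c w s| ≤ m :=
  abs_le.2 ⟨(abs_le.1 (h.abs_sum_le hw s none)).1.trans (h.sum_le_layerSup hw s none),
    ciSup_le fun q => (abs_le.1 (h.abs_sum_le hw s q)).2⟩

lemma abs_layerSup_update_sub_le (h : IsLayerIntegrand b c) (hw : ∀ i, |w i| ≤ 1)
    (s : Fin m → Unit4 𝒳) (i : Fin m) (x : Unit4 𝒳) :
    |layerSup F z b c w (Function.update s i x) - layerSup F z b c w s| ≤ 2 := by
  have hone (s s' : Fin m → Unit4 𝒳) (hss : ∀ j ≠ i, s j = s' j) :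
      layerSup F z b c w s ≤ layerSup F z b c w s' + 2 := by
    refine ciSup_le fun q => le_trans ?_ (add_le_add_left (h.sum_le_layerSup hw s' q) 2)
    rw [← sub_le_iff_le_add', ← Finset.sum_sub_distrib,
      Finset.sum_eq_single i (fun j _ hj => by rw [hss j hj, sub_self]) (by simp), ← mul_sub]
    have hval (o : Unit4 𝒳) := h.abs_add_mul_le o (layerClass_eq_zero_or_one (z := z) q o.feat)
    calc _ ≤ _ := le_abs_self _
      _ ≤ |(_ : ℝ) - _| := by
        rw [abs_mul]
        exact mul_le_of_le_one_left (abs_nonneg _) (hw i)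
      _ ≤ |_| + |_| := abs_sub _ _
      _ ≤ 1 + 1 := add_le_add (hval _) (hval _)
      _ = 2 := one_add_one_eq_two
  refine abs_sub_le_iff.2 ⟨sub_le_iff_le_add'.2 (hone _ _ fun j hj => ?_),
    sub_le_iff_le_add'.2 (hone _ _ fun j hj => ?_)⟩
  exacts [Function.update_of_ne hj _ _, (Function.update_of_ne hj _ _).symm]

end IsLayerIntegrand

lemma nullMeasurableSet_realizing [IsProbabilityMeasure P] (hF : IsPredictionClass P F)
    (hz : z ∈ Set.Icc (0 : ℝ) 1) {S : Finset (Fin m)} (hS : S.Nonempty) :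
    NullMeasurableSet {s : Fin m → Unit4 𝒳 | (fun i => (s i).feat) ∈ realizing F z S}
      (Measure.pi fun _ => P) := by
  have : IsProbabilityMeasure (P.map (Unit4.feat : Unit4 𝒳 → 𝒳)) :=
    Measure.isProbabilityMeasure_map measurable_feat.aemeasurable
  have hfeat : MeasurePreserving (fun (s : Fin m → Unit4 𝒳) i => (s i).feat)
      (Measure.pi fun _ => P) (Measure.pi fun _ => P.map Unit4.feat) :=
    measurePreserving_pi _ _ fun _ => measurable_feat.measurePreserving P
  refine NullMeasurableSet.preimage ?_ hfeat.quasiMeasurePreserving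
  rw [realizing_eq_setOf_le_iSup hF.nonempty hS]
  exact nullMeasurableSet_le aemeasurable_const (hF.measurable_sup m _ z hz)

lemma IsLayerIntegrand.aemeasurable_layerSup [IsProbabilityMeasure P] (h : IsLayerIntegrand b c)
    (hF : IsPredictionClass P F) (hz : z ∈ Set.Icc (0 : ℝ) 1) (w : Fin m → ℝ) :
    AEMeasurable (layerSup F z b c w) (Measure.pi fun _ => P) := by
  classical
  set val : Finset (Fin m) → (Fin m → Unit4 𝒳) → ℝ := fun S s =>
    ∑ i, w i * (b (s i) + c (s i) * if i ∈ S then 1 else 0)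
  have hval (S : Finset (Fin m)) : Measurable (val S) :=
    Finset.measurable_fun_sum _ fun i _ => ((h.measurable_base.comp (measurable_pi_apply i)).add
      ((h.measurable_slope.comp (measurable_pi_apply i)).mul_const _)).const_mul _
  rw [funext (layerSup_eq_iSup_realizing w)]
  refine .iSup fun S => ?_
  rcases S.eq_empty_or_nonempty with rfl | hS
  · simp only [ite_self]
    exact (hval ∅).aemeasurable
  · have hind := ((hval S).sub (hval ∅)).aemeasurable.indicator₀
      (nullMeasurableSet_realizing hF hz hS)
    refine ((hval ∅).aemeasurable.add hind).congr (.of_forall fun s => ?_)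
    by_cases hs : (fun i => (s i).feat) ∈ realizing F z S <;> simp [hs, val]

end LayerSup

/-! ### Symmetrization -/

section Symmetrization

variable {n : ℕ}

/-- The permutation of a doubled sample that swaps the `i`-th pair when `σ i` is false. -/
def swapPerm (σ : Fin n → Bool) : Equiv.Perm (Fin (n + n)) :=
  finSumFinEquiv.permCongr (Function.Involutive.toPerm
    (Sum.elim (fun i => if σ i then Sum.inl i else Sum.inr i)
      (fun i => if σ i then Sum.inr i else Sum.inl i) : Fin n ⊕ Fin n → Fin n ⊕ Fin n)
    (by rintro (i | i) <;> cases h : σ i <;> simp [h]))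

/-- The weights of the difference of the sums over the two halves of a doubled sample,
with random signs. -/
def ghostWeight (σ : Fin n → Bool) : Fin (n + n) → ℝ :=
  Fin.append (fun i => boolSign (σ i)) (fun i => -boolSign (σ i))

lemma swapPerm_castAdd (σ : Fin n → Bool) (j : Fin n) :
    swapPerm σ (Fin.castAdd n j) = if σ j then Fin.castAdd n j else Fin.natAdd n j := by
  rw [swapPerm, Equiv.permCongr_apply, finSumFinEquiv_symm_apply_castAdd]
  change finSumFinEquiv (if σ j then Sum.inl j else Sum.inr j) = _
  rw [apply_ite finSumFinEquiv, finSumFinEquiv_apply_left, finSumFinEquiv_apply_right]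

lemma swapPerm_natAdd (σ : Fin n → Bool) (j : Fin n) :
    swapPerm σ (Fin.natAdd n j) = if σ j then Fin.natAdd n j else Fin.castAdd n j := by
  rw [swapPerm, Equiv.permCongr_apply, finSumFinEquiv_symm_apply_natAdd]
  change finSumFinEquiv (if σ j then Sum.inr j else Sum.inl j) = _
  rw [apply_ite finSumFinEquiv, finSumFinEquiv_apply_left, finSumFinEquiv_apply_right]

lemma ghostWeight_swapPerm (σ : Fin n → Bool) (i : Fin (n + n)) :
    ghostWeight σ (swapPerm σ i) = ghostWeight (fun _ => true) i := by
  refine Fin.addCases (fun j => ?_) (fun j => ?_) i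
  · cases h : σ j <;> simp [-Fin.natAdd_eq_addNat, swapPerm_castAdd, ghostWeight, boolSign, h]
  · cases h : σ j <;> simp [-Fin.natAdd_eq_addNat, swapPerm_natAdd, ghostWeight, boolSign, h]

lemma abs_ghostWeight_le (σ : Fin n → Bool) (i : Fin (n + n)) : |ghostWeight σ i| ≤ 1 := by
  refine Fin.addCases (fun j => ?_) (fun j => ?_) i <;>
    simp [-Fin.natAdd_eq_addNat, ghostWeight, abs_boolSign]

variable {𝒳 : Type*} {F : Set (𝒳 → ℝ)} {z : ℝ} {b c : Unit4 𝒳 → ℝ}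

lemma layerSup_comp_swapPerm (σ : Fin n → Bool) (s : Fin (n + n) → Unit4 𝒳) :
    layerSup F z b c (ghostWeight fun _ => true) (s ∘ swapPerm σ) =
      layerSup F z b c (ghostWeight σ) s := by
  refine iSup_congr fun q => ?_
  conv_rhs => rw [← Equiv.sum_comp (swapPerm σ)]
  exact Finset.sum_congr rfl fun i _ => by rw [ghostWeight_swapPerm]; rfl

lemma bddAbove_sum_layerClass {c : Fin n → ℝ} (hc : ∀ i, |c i| ≤ 1) (σ : Fin n → Bool)
    (x : Fin n → 𝒳) :
    BddAbove (Set.range fun q : Option F =>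
      ∑ i, boolSign (σ i) * c i * layerClass F z q (x i)) := by
  refine ⟨∑ _i : Fin n, 1, Set.forall_mem_range.2 fun q => Finset.sum_le_sum fun i _ => ?_⟩
  refine (le_abs_self _).trans ?_
  rw [abs_mul, abs_mul, abs_boolSign, one_mul]
  refine mul_le_one₀ (hc i) (abs_nonneg _) ?_
  rcases layerClass_eq_zero_or_one (F := F) (z := z) q (x i) with h | h <;> simp [h]

lemma layerSup_ghostWeight_le (hc : ∀ o, |c o| ≤ 1) (σ : Fin n → Bool)
    (s t : Fin n → Unit4 𝒳) :
    layerSup F z b c (ghostWeight σ) (Fin.append s t) ≤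
      ∑ i, boolSign (σ i) * (b (s i) - b (t i)) +
        ((⨆ q : Option F, ∑ i, boolSign (σ i) * c (s i) * layerClass F z q (s i).feat) +
          ⨆ q : Option F, ∑ i, boolSign (σ i) * -c (t i) * layerClass F z q (t i).feat) := by
  refine ciSup_le fun q => ?_
  have hs := le_ciSup (bddAbove_sum_layerClass (F := F) (z := z) (fun i => hc (s i)) σ
    fun i => (s i).feat) q
  have ht := le_ciSup (bddAbove_sum_layerClass (F := F) (z := z)
    (fun i => (abs_neg _).trans_le (hc (t i))) σ fun i => (t i).feat) q
  refine le_trans (le_of_eq ?_) (add_le_add_right (add_le_add hs ht) _)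
  rw [Fin.sum_univ_add]
  simp only [ghostWeight, Fin.append_left, Fin.append_right, ← Finset.sum_add_distrib]
  exact Finset.sum_congr rfl fun i _ => by ring

lemma sum_layerSup_ghostWeight_le (hz : z ∈ Set.Icc (0 : ℝ) 1) (hc : ∀ o, |c o| ≤ 1)
    (s : Fin (n + n) → Unit4 𝒳) :
    ∑ σ : Fin n → Bool, layerSup F z b c (ghostWeight σ) s ≤
      2 ^ n * (2 * n * rademacher (thrClass F) n) := by
  obtain ⟨⟨s, t⟩, rfl⟩ := (Fin.appendEquiv n n).surjective s
  have hzero : ∑ σ : Fin n → Bool, ∑ i, boolSign (σ i) * (b (s i) - b (t i)) = 0 := by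
    rw [Finset.sum_comm]
    exact Finset.sum_eq_zero fun i _ => by rw [← Finset.sum_mul, sum_boolSign_apply, zero_mul]
  have hs := sum_iSup_layerClass_le_rademacher (F := F) hz (fun i => (s i).feat) fun i => hc (s i)
  have ht := sum_iSup_layerClass_le_rademacher (F := F) hz (fun i => (t i).feat)
    fun i => (abs_neg _).trans_le (hc (t i))
  refine (Finset.sum_le_sum fun σ _ => layerSup_ghostWeight_le hc σ s t).trans ?_
  rw [Finset.sum_add_distrib, hzero, Finset.sum_add_distrib]
  linarith

variable [MeasurableSpace 𝒳] {P : Measure (Unit4 𝒳)} [IsProbabilityMeasure P]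

namespace IsLayerIntegrand

lemma integral_layerSup_ghostWeight_eq (h : IsLayerIntegrand b c) (hF : IsPredictionClass P F)
    (hz : z ∈ Set.Icc (0 : ℝ) 1) (σ : Fin n → Bool) :
    ∫ s, layerSup F z b c (ghostWeight σ) s ∂(Measure.pi fun _ => P) =
      ∫ s, layerSup F z b c (ghostWeight fun _ : Fin n => true) s ∂(Measure.pi fun _ => P) := by
  have hswap := measurePreserving_comp_perm P (swapPerm σ)
  rw [← funext (layerSup_comp_swapPerm σ)]
  conv_rhs => rw [← hswap.map_eq]
  refine (integral_map hswap.aemeasurable ?_).symm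
  rw [hswap.map_eq]
  exact (h.aemeasurable_layerSup hF hz _).aestronglyMeasurable

lemma integral_layerSup_le (h : IsLayerIntegrand b c) (hF : IsPredictionClass P F)
    (hz : z ∈ Set.Icc (0 : ℝ) 1) :
    ∫ s, layerSup F z b c (ghostWeight fun _ : Fin n => true) s ∂(Measure.pi fun _ => P) ≤
      2 * n * rademacher (thrClass F) n := by
  have hint (σ : Fin n → Bool) :
      Integrable (layerSup F z b c (ghostWeight σ)) (Measure.pi fun _ => P) :=
    .of_bound (h.aemeasurable_layerSup hF hz _).aestronglyMeasurable _
      (.of_forall (h.abs_layerSup_le (abs_ghostWeight_le σ)))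
  have hsum : ∑ σ : Fin n → Bool,
      ∫ s, layerSup F z b c (ghostWeight σ) s ∂(Measure.pi fun _ => P) ≤
        2 ^ n * (2 * n * rademacher (thrClass F) n) := by
    rw [← integral_finsetSum _ fun σ _ => hint σ]
    refine (integral_mono (integrable_finsetSum _ fun σ _ => hint σ) (integrable_const _)
      fun s => sum_layerSup_ghostWeight_le hz h.abs_slope_le s).trans ?_
    simp
  simp only [h.integral_layerSup_ghostWeight_eq hF hz, Finset.sum_const, Finset.card_univ,
    Fintype.card_pi, Fintype.card_bool, Finset.prod_const, Fintype.card_fin, nsmul_eq_mul,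
    Nat.cast_pow, Nat.cast_ofNat] at hsum
  exact le_of_mul_le_mul_left hsum (by positivity)

lemma lintegral_exp_layerSup_le (h : IsLayerIntegrand b c) (hF : IsPredictionClass P F)
    (hz : z ∈ Set.Icc (0 : ℝ) 1) {lam : ℝ} (hlam : 0 ≤ lam) :
    ∫⁻ s, ENNReal.ofReal (Real.exp (lam * layerSup F z b c (ghostWeight fun _ : Fin n => true) s))
        ∂(Measure.pi fun _ => P) ≤
      ENNReal.ofReal (Real.exp (lam * (2 * n * rademacher (thrClass F) n) + n * lam ^ 2)) := by
  set G := layerSup F z b c (ghostWeight fun _ : Fin n => true)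
  set E := ∫ s, G s ∂(Measure.pi fun _ => P)
  have hw := abs_ghostWeight_le fun _ : Fin n => true
  have hsub := hasSubgaussianMGF_of_bounded_differences (fun _ => P)
    (h.aemeasurable_layerSup hF hz _) (c := fun _ => 2) fun s i x =>
      h.abs_layerSup_update_sub_le hw s i x
  have hsplit (s) : Real.exp (lam * G s) = Real.exp (lam * E) * Real.exp (lam * (G s - E)) := by
    rw [← Real.exp_add]
    ring_nf
  have hint : Integrable (fun s => Real.exp (lam * G s)) (Measure.pi fun _ => P) := by
    simp only [hsplit]
    exact (hsub.integrable_exp_mul lam).const_mul _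
  rw [← ofReal_integral_eq_lintegral_ofReal hint (.of_forall fun s => (Real.exp_pos _).le)]
  refine ENNReal.ofReal_le_ofReal ?_
  calc ∫ s, Real.exp (lam * G s) ∂(Measure.pi fun _ => P)
      = Real.exp (lam * E) * mgf (fun s => G s - E) (Measure.pi fun _ => P) lam := by
        simp only [hsplit, integral_const_mul, mgf]
    _ ≤ Real.exp (lam * E) * Real.exp (n * lam ^ 2) := by
        gcongr
        refine (hsub.mgf_le lam).trans (le_of_eq (congrArg _ ?_))
        simp
        ring
    _ ≤ _ := by
        rw [← Real.exp_add]
        gcongr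
        exact h.integral_layerSup_le hF hz

end IsLayerIntegrand

end Symmetrization

/-! ### Uniform deviations -/

section GhostSample

variable {Ω : Type*} [MeasurableSpace Ω] {P : Measure Ω} [IsProbabilityMeasure P] {n : ℕ}

lemma integrable_sum_comp_eval {Y : Ω → ℝ} (hY : Integrable Y P) :
    Integrable (fun t : Fin n → Ω => ∑ i, Y (t i)) (Measure.pi fun _ => P) :=
  integrable_finsetSum _ fun i _ =>
    (measurePreserving_eval (fun _ : Fin n => P) i).integrable_comp_of_integrable hY

lemma integral_sum_comp_eval {Y : Ω → ℝ} (hY : Integrable Y P) :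
    ∫ t : Fin n → Ω, ∑ i, Y (t i) ∂(Measure.pi fun _ => P) = n * ∫ o, Y o ∂P := by
  have heval (i : Fin n) := measurePreserving_eval (fun _ : Fin n => P) i
  have hmean (i : Fin n) : ∫ t : Fin n → Ω, Y (t i) ∂(Measure.pi fun _ => P) = ∫ o, Y o ∂P := by
    conv_rhs => rw [← (heval i).map_eq]
    refine (integral_map (heval i).aemeasurable ?_).symm
    rw [(heval i).map_eq]
    exact hY.aestronglyMeasurable
  have hint (i : Fin n) : Integrable (fun t : Fin n → Ω => Y (t i)) (Measure.pi fun _ => P) :=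
    (heval i).integrable_comp_of_integrable hY
  simp [integral_finsetSum _ fun i _ => hint i, hmean]

lemma ofReal_exp_mul_sum_sub_le_lintegral {Y : Ω → ℝ} {C : ℝ} (hY : Measurable Y)
    (hC : ∀ o, |Y o| ≤ C) (lam : ℝ) (s : Fin n → Ω) :
    ENNReal.ofReal (Real.exp (lam * (∑ i, Y (s i) - n * ∫ o, Y o ∂P))) ≤
      ∫⁻ t : Fin n → Ω, ENNReal.ofReal (Real.exp (lam * (∑ i, Y (s i) - ∑ i, Y (t i))))
        ∂(Measure.pi fun _ => P) := by
  set D : (Fin n → Ω) → ℝ := fun t => lam * (∑ i, Y (s i) - ∑ i, Y (t i))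
  have hYint : Integrable Y P := .of_bound hY.aestronglyMeasurable _ (.of_forall hC)
  have hsum := integrable_sum_comp_eval (n := n) hYint
  have hmean : ∫ t, D t ∂(Measure.pi fun _ => P) = lam * (∑ i, Y (s i) - n * ∫ o, Y o ∂P) := by
    rw [integral_const_mul, integral_sub (integrable_const _) hsum, integral_sum_comp_eval hYint]
    simp
  have hsum_le (t : Fin n → Ω) : |∑ i, Y (t i)| ≤ n * C :=
    (Finset.abs_sum_le_sum_abs _ _).trans
      ((Finset.sum_le_card_nsmul _ _ C fun i _ => hC _).trans (by simp))
  have hexp : Integrable (fun t => Real.exp (D t)) (Measure.pi fun _ => P) :=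
    integrable_exp_mul_of_abs_le
      (measurable_const.sub (Finset.measurable_fun_sum _ fun i _ =>
        hY.comp (measurable_pi_apply i))).aemeasurable
      (fun t => (abs_sub _ _).trans (add_le_add (hsum_le s) (hsum_le t))) lam
  rw [← ofReal_integral_eq_lintegral_ofReal hexp (.of_forall fun t => (Real.exp_pos _).le),
    ← hmean]
  exact ENNReal.ofReal_le_ofReal (convexOn_exp.map_integral_le Real.continuous_exp.continuousOn
    isClosed_univ (by simp) (((integrable_const _).sub hsum).const_mul _) hexp)

/-- Chernoff's bound with a ghost sample `t`: the family may be infinite as long as one function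
of the two samples dominates all exponentials. -/
lemma measure_exists_lt_sum_sub_le {𝒴 : Set (Ω → ℝ)} {C : ℝ} (hm : ∀ Y ∈ 𝒴, Measurable Y)
    (hC : ∀ Y ∈ 𝒴, ∀ o, |Y o| ≤ C) {lam : ℝ} (hlam : 0 ≤ lam)
    {Ψ : (Fin n → Ω) × (Fin n → Ω) → ENNReal}
    (hΨ : AEMeasurable Ψ ((Measure.pi fun _ => P).prod (Measure.pi fun _ => P)))
    (hle : ∀ Y ∈ 𝒴, ∀ s t,
      ENNReal.ofReal (Real.exp (lam * (∑ i, Y (s i) - ∑ i, Y (t i)))) ≤ Ψ (s, t)) (a : ℝ) :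
    (Measure.pi fun _ => P) {s : Fin n → Ω | ∃ Y ∈ 𝒴, a < ∑ i, Y (s i) - n * ∫ o, Y o ∂P} ≤
      (∫⁻ q, Ψ q ∂((Measure.pi fun _ => P).prod (Measure.pi fun _ => P))) /
        ENNReal.ofReal (Real.exp (lam * a)) := by
  rw [lintegral_prod _ hΨ]
  refine (measure_mono ?_).trans (meas_ge_le_lintegral_div hΨ.lintegral_prod_right'
    (by simpa using Real.exp_pos _) ENNReal.ofReal_ne_top)
  rintro s ⟨Y, hY, hlt⟩
  calc ENNReal.ofReal (Real.exp (lam * a))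
      ≤ ENNReal.ofReal (Real.exp (lam * (∑ i, Y (s i) - n * ∫ o, Y o ∂P))) := by gcongr
    _ ≤ ∫⁻ t, ENNReal.ofReal (Real.exp (lam * (∑ i, Y (s i) - ∑ i, Y (t i))))
          ∂(Measure.pi fun _ => P) :=
        ofReal_exp_mul_sum_sub_le_lintegral (hm Y hY) (hC Y hY) lam s
    _ ≤ ∫⁻ t, Ψ (s, t) ∂(Measure.pi fun _ => P) := lintegral_mono fun t => hle Y hY s t

end GhostSample

section Deviation

variable {𝒳 : Type*} {n N : ℕ} {b c : ℕ → Unit4 𝒳 → ℝ}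

lemma natCast_div_mem_Icc {j : ℕ} (hj : j ∈ Finset.Icc 1 N) :
    (j : ℝ) / N ∈ Set.Icc (0 : ℝ) 1 :=
  ⟨by positivity, div_le_one_of_le₀ (mod_cast (Finset.mem_Icc.1 hj).2) N.cast_nonneg⟩

/-- The process `N⁻¹ ∑ⱼ (bⱼ + cⱼ h_f(·, j/N))`: all sample means of the algorithm are means of
processes of this form, indexed by the prediction function `f`. -/
noncomputable def layered (N : ℕ) (b c : ℕ → Unit4 𝒳 → ℝ) (f : 𝒳 → ℝ) (o : Unit4 𝒳) : ℝ :=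
  (∑ j ∈ Finset.Icc 1 N, (b j o + c j o * thr f o.feat ((j : ℝ) / N))) / N

variable [MeasurableSpace 𝒳] {P : Measure (Unit4 𝒳)} {F : Set (𝒳 → ℝ)}

lemma measurable_thr {f : 𝒳 → ℝ} (hf : Measurable f) (z : ℝ) : Measurable fun x => thr f x z :=
  .ite (measurableSet_le measurable_const hf) measurable_const measurable_const

lemma measurable_layered (h : ∀ j, IsLayerIntegrand (b j) (c j)) {f : 𝒳 → ℝ}
    (hf : Measurable f) : Measurable (layered N b c f) :=
  (Finset.measurable_fun_sum _ fun j _ => (h j).measurable_base.add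
    ((h j).measurable_slope.mul ((measurable_thr hf _).comp measurable_feat))).div_const _

lemma abs_layered_le (h : ∀ j, IsLayerIntegrand (b j) (c j)) (f : 𝒳 → ℝ) (o : Unit4 𝒳) :
    |layered N b c f o| ≤ 1 := by
  rw [layered, abs_div, Nat.abs_cast]
  refine div_le_one_of_le₀ ?_ N.cast_nonneg
  refine (Finset.abs_sum_le_sum_abs _ _).trans ((Finset.sum_le_card_nsmul _ _ 1 fun j _ =>
    (h j).abs_add_mul_le o (thr_eq_zero_or_one _ _ _)).trans (by simp))

lemma sum_layered_sub_le_sum_layerSup (h : ∀ j, IsLayerIntegrand (b j) (c j)) {f : 𝒳 → ℝ}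
    (hf : f ∈ F) (s t : Fin n → Unit4 𝒳) :
    ∑ i, layered N b c f (s i) - ∑ i, layered N b c f (t i) ≤
      (∑ j ∈ Finset.Icc 1 N, layerSup F ((j : ℝ) / N) (b j) (c j)
        (ghostWeight fun _ : Fin n => true) (Fin.append s t)) / N := by
  simp only [layered, ← Finset.sum_div]
  rw [← sub_div, Finset.sum_comm, Finset.sum_comm (s := Finset.univ), ← Finset.sum_sub_distrib]
  gcongr with j _
  refine le_trans (le_of_eq ?_)
    ((h j).sum_le_layerSup (abs_ghostWeight_le _) (Fin.append s t) (some ⟨f, hf⟩))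
  simp only [Fin.sum_univ_add, ghostWeight, Fin.append_left, Fin.append_right, boolSign, if_true,
    one_mul, neg_mul, layerClass, Finset.sum_neg_distrib, sub_eq_add_neg]

/-- Averages the exponentials of `lam` times the suprema of the layers; convexity of `exp` makes
it dominate the exponentials of `lam` times the whole process. -/
noncomputable def layerExpMean (F : Set (𝒳 → ℝ)) (N : ℕ) (b c : ℕ → Unit4 𝒳 → ℝ) (lam : ℝ)
    (q : (Fin n → Unit4 𝒳) × (Fin n → Unit4 𝒳)) : ENNReal :=
  (N : ENNReal)⁻¹ * ∑ j ∈ Finset.Icc 1 N, ENNReal.ofReal (Real.exp (lam *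
    layerSup F ((j : ℝ) / N) (b j) (c j) (ghostWeight fun _ : Fin n => true)
      (Fin.append q.1 q.2)))

lemma ofReal_exp_mul_layered_sub_le (hN : 0 < N) (h : ∀ j, IsLayerIntegrand (b j) (c j))
    {f : 𝒳 → ℝ} (hf : f ∈ F) {lam : ℝ} (hlam : 0 ≤ lam) (s t : Fin n → Unit4 𝒳) :
    ENNReal.ofReal (Real.exp
        (lam * (∑ i, layered N b c f (s i) - ∑ i, layered N b c f (t i)))) ≤
      layerExpMean F N b c lam (s, t) := by
  have hNpos : (0 : ℝ) < N := mod_cast hN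
  set D : ℕ → ℝ := fun j => lam * layerSup F ((j : ℝ) / N) (b j) (c j)
    (ghostWeight fun _ : Fin n => true) (Fin.append s t)
  have hone : ∑ _j ∈ Finset.Icc 1 N, (N : ℝ)⁻¹ = 1 := by simp [hNpos.ne']
  have hexp := calc
    Real.exp (lam * (∑ i, layered N b c f (s i) - ∑ i, layered N b c f (t i)))
      ≤ Real.exp (∑ j ∈ Finset.Icc 1 N, (N : ℝ)⁻¹ • D j) := by
        gcongr
        refine (mul_le_mul_of_nonneg_left (sum_layered_sub_le_sum_layerSup h hf s t) hlam).trans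
          (le_of_eq ?_)
        simp only [D, smul_eq_mul, ← Finset.mul_sum]
        ring
    _ ≤ ∑ j ∈ Finset.Icc 1 N, (N : ℝ)⁻¹ • Real.exp (D j) :=
        convexOn_exp.map_sum_le (fun _ _ => by positivity) hone fun _ _ => Set.mem_univ _
    _ = (∑ j ∈ Finset.Icc 1 N, Real.exp (D j)) / N := by
        simp only [smul_eq_mul, ← Finset.mul_sum]
        ring
  refine (ENNReal.ofReal_le_ofReal hexp).trans (le_of_eq ?_)
  rw [ENNReal.ofReal_div_of_pos hNpos, div_eq_mul_inv, mul_comm,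
    ENNReal.ofReal_sum_of_nonneg fun _ _ => (Real.exp_pos _).le, ENNReal.ofReal_natCast]
  rfl

variable [IsProbabilityMeasure P]

lemma aemeasurable_exp_layerSup_append (hF : IsPredictionClass P F) {z : ℝ}
    (hz : z ∈ Set.Icc (0 : ℝ) 1) {b c : Unit4 𝒳 → ℝ} (h : IsLayerIntegrand b c) (lam : ℝ) :
    AEMeasurable (fun q : (Fin n → Unit4 𝒳) × (Fin n → Unit4 𝒳) => ENNReal.ofReal (Real.exp
      (lam * layerSup F z b c (ghostWeight fun _ : Fin n => true) (Fin.append q.1 q.2))))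
      ((Measure.pi fun _ => P).prod (Measure.pi fun _ => P)) :=
  ((h.aemeasurable_layerSup hF hz _).const_mul lam).exp.ennreal_ofReal.comp_quasiMeasurePreserving
    (measurePreserving_append P n n).quasiMeasurePreserving

lemma lintegral_layerExpMean_le (hF : IsPredictionClass P F) (hN : 0 < N)
    (h : ∀ j, IsLayerIntegrand (b j) (c j)) {lam : ℝ} (hlam : 0 ≤ lam) :
    ∫⁻ q : (Fin n → Unit4 𝒳) × (Fin n → Unit4 𝒳), layerExpMean F N b c lam q
        ∂((Measure.pi fun _ => P).prod (Measure.pi fun _ => P)) ≤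
      ENNReal.ofReal (Real.exp (lam * (2 * n * rademacher (thrClass F) n) + n * lam ^ 2)) := by
  have hN' : (N : ENNReal) ≠ 0 := mod_cast hN.ne'
  simp only [layerExpMean]
  rw [lintegral_const_mul' _ _ (ENNReal.inv_ne_top.2 hN'), lintegral_finsetSum' _ fun j hj =>
    aemeasurable_exp_layerSup_append hF (natCast_div_mem_Icc hj) (h j) lam, mul_comm,
    ← div_eq_mul_inv]
  refine ENNReal.div_le_of_le_mul ((Finset.sum_le_card_nsmul _ _ (ENNReal.ofReal (Real.exp
    (lam * (2 * n * rademacher (thrClass F) n) + n * lam ^ 2))) fun j hj => ?_).trans_eq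
    (by rw [Nat.card_Icc, Nat.add_sub_cancel, nsmul_eq_mul, mul_comm]))
  have happend := measurePreserving_append P n n
  have hg := ((h j).aemeasurable_layerSup hF (natCast_div_mem_Icc hj)
    (ghostWeight fun _ : Fin n => true)).const_mul lam |>.exp.ennreal_ofReal
  refine le_trans (le_of_eq ?_)
    ((h j).lintegral_exp_layerSup_le hF (natCast_div_mem_Icc hj) hlam)
  rw [← happend.map_eq] at hg ⊢
  exact (lintegral_map' hg happend.aemeasurable).symm

theorem measure_exists_layered_deviation_le (hF : IsPredictionClass P F) (hn : 0 < n)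
    (hN : 0 < N) (h : ∀ j, IsLayerIntegrand (b j) (c j)) {L : ℝ} (hL : 0 ≤ L) :
    (Measure.pi fun _ : Fin n => P) {s | ∃ f ∈ F,
        2 * rademacher (thrClass F) n + 2 * √(L / n) <
          (∑ i, layered N b c f (s i)) / n - ∫ o, layered N b c f o ∂P} ≤
      ENNReal.ofReal (Real.exp (-L)) := by
  have hnpos : (0 : ℝ) < n := mod_cast hn
  set R := rademacher (thrClass F) n
  set lam := √(L / n) with hlam
  have hlamsq : n * lam ^ 2 = L := by
    rw [hlam, Real.sq_sqrt (by positivity), mul_div_cancel₀ _ hnpos.ne']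
  have hchernoff := measure_exists_lt_sum_sub_le (P := P) (𝒴 := layered N b c '' F)
    (Ψ := layerExpMean F N b c lam) (n := n) (lam := lam)
    (Set.forall_mem_image.2 fun f hf => measurable_layered h (hF.measurable f hf))
    (Set.forall_mem_image.2 fun f _ => abs_layered_le h f) (Real.sqrt_nonneg _)
    ((Finset.aemeasurable_fun_sum _ fun j hj =>
      aemeasurable_exp_layerSup_append hF (natCast_div_mem_Icc hj) (h j) lam).const_mul _)
    (Set.forall_mem_image.2 fun f hf =>
      ofReal_exp_mul_layered_sub_le hN h hf (Real.sqrt_nonneg _)) (n * (2 * R + 2 * lam))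
  refine (measure_mono ?_).trans (hchernoff.trans ((ENNReal.div_le_div_right
    (lintegral_layerExpMean_le hF hN h (Real.sqrt_nonneg _)) _).trans_eq ?_))
  · rintro s ⟨f, hf, hlt⟩
    refine ⟨_, ⟨f, hf, rfl⟩, ?_⟩
    rwa [lt_sub_iff_add_lt, lt_div_iff₀ hnpos, add_mul, mul_comm, mul_comm (∫ _, _ ∂P),
      ← lt_sub_iff_add_lt] at hlt
  · rw [← ENNReal.ofReal_div_of_pos (Real.exp_pos _), ← Real.exp_sub]
    congr 2
    linear_combination (-1 : ℝ) * hlamsq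

end Deviation

/-! ### Identification -/

section Identification

variable {𝒳 : Type*}

/-- The weight `1{A ∈ S} g(μ(X))` that replaces the indicator of a conditioning event. -/
noncomputable def popWeight (μ : 𝒳 → ℝ) (e : GroupEvent) (o : Unit4 𝒳) : ℝ :=
  obsWeight e (o.feat, o.attr, μ o.feat)

lemma popWeight_eq_indicator (μ : 𝒳 → ℝ) (e : GroupEvent) :
    popWeight μ e = e.attrSet.indicator fun o : Unit4 𝒳 => e.label.weight (μ o.feat) := by
  funext o
  simp only [popWeight, obsWeight, GroupEvent.attrSet, Set.indicator_apply, Set.mem_ofPred_eq]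

lemma GroupEvent.toSet_eq (e : GroupEvent) :
    (e.toSet : Set (Unit4 𝒳)) = Unit4.out ⁻¹' e.label.outcomes ∩ e.attrSet := by
  ext o
  exact and_comm

lemma LabelCond.measurableSet_outcomes (c : LabelCond) : MeasurableSet c.outcomes := by
  cases c
  exacts [.univ, measurableSet_singleton _, measurableSet_singleton _]

lemma LabelCond.measurable_weight (c : LabelCond) : Measurable c.weight := by
  cases c
  exacts [measurable_const, measurable_id, measurable_const.sub measurable_id]

lemma LabelCond.weight_mem (c : LabelCond) {m : ℝ} (hm : m ∈ Set.Icc (0 : ℝ) 1) :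
    c.weight m ∈ Set.Icc (0 : ℝ) 1 := by
  cases c
  exacts [⟨zero_le_one, le_rfl⟩, hm, ⟨sub_nonneg.2 hm.2, sub_le_self _ hm.1⟩]

lemma popWeight_mem {μ : 𝒳 → ℝ} (hμ : ∀ x, μ x ∈ Set.Icc (0 : ℝ) 1) (e : GroupEvent)
    (o : Unit4 𝒳) : popWeight μ e o ∈ Set.Icc (0 : ℝ) 1 := by
  unfold popWeight obsWeight
  split_ifs
  exacts [e.label.weight_mem (hμ _), ⟨le_rfl, zero_le_one⟩]

variable [MeasurableSpace 𝒳]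

/-- `μ` is a `[0,1]`-valued version of the outcome regression `μ(x) = E[Y* | X = x]`; nothing is
said about the decision. -/
structure IsOutcomeRegression (P : Measure (Unit4 𝒳)) (μ : 𝒳 → ℝ) : Prop where
  out_mem : ∀ᵐ o ∂P, o.out ∈ Set.Icc (0 : ℝ) 1
  measurable_reg : Measurable μ
  reg_mem : ∀ x, μ x ∈ Set.Icc (0 : ℝ) 1
  reg_eq : (fun o : Unit4 𝒳 => μ o.feat) =ᵐ[P] P[Unit4.out | sigmaFeat 𝒳]

lemma SelectiveLabels.isOutcomeRegression {P : Measure (Unit4 𝒳)} {μ : 𝒳 → ℝ}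
    (h : SelectiveLabels P μ) : IsOutcomeRegression P μ :=
  ⟨h.out_mem, h.measurable_reg, h.reg_mem, h.reg_eq⟩

/-- The assumption under which the probability of `e` is identified: if `e` restricts the outcome,
then the outcome is binary and independent of the attribute given the features. -/
def GroupEvent.IsIdentified (P : Measure (Unit4 𝒳)) (e : GroupEvent) : Prop :=
  e.label ≠ .free →
    (∀ᵐ o ∂P, o.out = 0 ∨ o.out = 1) ∧ CondIndepGivenFeat P Unit4.out Unit4.attr

lemma measurable_attr : Measurable (Unit4.attr : Unit4 𝒳 → Fin 2) :=
  measurable_fst.comp measurable_snd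

lemma measurable_out : Measurable (Unit4.out : Unit4 𝒳 → ℝ) :=
  measurable_snd.comp (measurable_snd.comp measurable_snd)

lemma sigmaFeat_le : sigmaFeat 𝒳 ≤ (inferInstance : MeasurableSpace (Unit4 𝒳)) :=
  measurable_feat.comap_le

lemma GroupEvent.measurableSet_attrSet (e : GroupEvent) :
    MeasurableSet (e.attrSet : Set (Unit4 𝒳)) :=
  measurable_attr (MeasurableSet.of_discrete (s := {a : Fin 2 | a ∈ e.attrs}))

lemma GroupEvent.measurableSet_toSet (e : GroupEvent) :
    MeasurableSet (e.toSet : Set (Unit4 𝒳)) :=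
  e.toSet_eq ▸ (measurable_out e.label.measurableSet_outcomes).inter e.measurableSet_attrSet

lemma measurable_popWeight {μ : 𝒳 → ℝ} (hμ : Measurable μ) (e : GroupEvent) :
    Measurable (popWeight μ e) := by
  rw [popWeight_eq_indicator]
  exact (e.label.measurable_weight.comp (hμ.comp measurable_feat)).indicator
    e.measurableSet_attrSet

lemma integral_cond_eq {Ω : Type*} [MeasurableSpace Ω] (P : Measure Ω) (s : Set Ω) (g : Ω → ℝ) :
    ∫ o, g o ∂(P[|s]) = (P.real s)⁻¹ * ∫ o in s, g o ∂P := by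
  rw [ProbabilityTheory.cond, integral_smul_measure, ENNReal.toReal_inv, smul_eq_mul,
    measureReal_def]

variable {P : Measure (Unit4 𝒳)} [IsProbabilityMeasure P] {μ φ : 𝒳 → ℝ} {bd : ℝ}

lemma integral_mul_condExp_feat (hφ : Measurable φ) (hb : ∀ x, |φ x| ≤ bd) {Z : Unit4 𝒳 → ℝ}
    (hZ : Integrable Z P) :
    ∫ o, φ o.feat * (P[Z | sigmaFeat 𝒳]) o ∂P = ∫ o, φ o.feat * Z o ∂P := by
  have hpull := integral_congr_ae (condExp_stronglyMeasurable_mul_of_bound (μ := P) sigmaFeat_le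
    (hφ.comp (comap_measurable Unit4.feat)).stronglyMeasurable hZ bd
    (.of_forall fun o => hb o.feat))
  rw [integral_condExp sigmaFeat_le] at hpull
  exact hpull.symm

lemma setIntegral_feat_eq_integral_mul_condProb (hφ : Measurable φ) (hb : ∀ x, |φ x| ≤ bd)
    {s : Set (Unit4 𝒳)} (hs : MeasurableSet s) :
    ∫ o in s, φ o.feat ∂P = ∫ o, φ o.feat * (P⟦s | sigmaFeat 𝒳⟧) o ∂P := by
  rw [integral_mul_condExp_feat hφ hb ((integrable_const 1).indicator hs), ← integral_indicator hs]
  refine integral_congr_ae (.of_forall fun o => ?_)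
  by_cases ho : o ∈ s <;> simp [ho]

lemma IsOutcomeRegression.condProb_outcomes (hμ : IsOutcomeRegression P μ) (c : LabelCond)
    (hbin : c ≠ .free → ∀ᵐ o ∂P, o.out = 0 ∨ o.out = 1) :
    P⟦Unit4.out ⁻¹' c.outcomes | sigmaFeat 𝒳⟧ =ᵐ[P] fun o => c.weight (μ o.feat) := by
  cases c with
  | free =>
    have hone : (Unit4.out ⁻¹' LabelCond.free.outcomes).indicator (fun _ : Unit4 𝒳 => (1 : ℝ))
        = fun _ => 1 := by simp [LabelCond.outcomes]
    rw [hone, condExp_const sigmaFeat_le]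
    rfl
  | pos =>
    have hout : (Unit4.out ⁻¹' LabelCond.pos.outcomes).indicator (fun _ : Unit4 𝒳 => (1 : ℝ))
        =ᵐ[P] Unit4.out := by
      filter_upwards [hbin (by simp)] with o ho
      rcases ho with ho | ho <;> simp [LabelCond.outcomes, ho]
    exact (condExp_congr_ae hout).trans hμ.reg_eq.symm
  | neg =>
    have hout : (Unit4.out ⁻¹' LabelCond.neg.outcomes).indicator (fun _ : Unit4 𝒳 => (1 : ℝ))
        =ᵐ[P] (fun _ => (1 : ℝ)) - Unit4.out := by
      filter_upwards [hbin (by simp)] with o ho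
      rcases ho with ho | ho <;> simp [LabelCond.outcomes, ho]
    refine (condExp_congr_ae hout).trans ((condExp_sub (integrable_const _)
      (.of_mem_Icc 0 1 measurable_out.aemeasurable hμ.out_mem) _).trans ?_)
    rw [condExp_const sigmaFeat_le]
    filter_upwards [hμ.reg_eq] with o ho
    simp [LabelCond.weight, ← ho]

lemma IsOutcomeRegression.condProb_toSet (hμ : IsOutcomeRegression P μ) {e : GroupEvent}
    (he : e.IsIdentified P) :
    P⟦e.toSet | sigmaFeat 𝒳⟧ =ᵐ[P]
      fun o => e.label.weight (μ o.feat) * (P⟦e.attrSet | sigmaFeat 𝒳⟧) o := by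
  by_cases hfree : e.label = .free
  · have hset : (e.toSet : Set (Unit4 𝒳)) = e.attrSet := by
      simp [e.toSet_eq, hfree, LabelCond.outcomes]
    simp [hset, hfree, LabelCond.weight]
  · obtain ⟨hbin, hindep⟩ := he hfree
    rw [e.toSet_eq]
    refine (hindep e.label.outcomes {a | a ∈ e.attrs} e.label.measurableSet_outcomes
      .of_discrete).trans ?_
    filter_upwards [hμ.condProb_outcomes e.label fun _ => hbin] with o ho
    rw [Pi.mul_apply, ho]
    rfl

lemma IsOutcomeRegression.setIntegral_toSet (hμ : IsOutcomeRegression P μ) {e : GroupEvent}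
    (he : e.IsIdentified P) (hφ : Measurable φ) (hb : ∀ x, |φ x| ≤ bd) :
    ∫ o in e.toSet, φ o.feat ∂P =
      ∫ o in e.attrSet, φ o.feat * e.label.weight (μ o.feat) ∂P := by
  have hb' (x : 𝒳) : |φ x * e.label.weight (μ x)| ≤ bd := by
    obtain ⟨h0, h1⟩ := e.label.weight_mem (hμ.reg_mem x)
    rw [abs_mul, abs_of_nonneg h0]
    exact (mul_le_of_le_one_right (abs_nonneg _) h1).trans (hb x)
  rw [setIntegral_feat_eq_integral_mul_condProb hφ hb e.measurableSet_toSet,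
    setIntegral_feat_eq_integral_mul_condProb (φ := fun x => φ x * e.label.weight (μ x))
      (hφ.mul (e.label.measurable_weight.comp hμ.measurable_reg)) hb' e.measurableSet_attrSet]
  refine integral_congr_ae ?_
  filter_upwards [hμ.condProb_toSet he] with o ho
  rw [ho, mul_assoc]

lemma IsOutcomeRegression.integral_popWeight_mul (hμ : IsOutcomeRegression P μ) {e : GroupEvent}
    (he : e.IsIdentified P) (hφ : Measurable φ) (hb : ∀ x, |φ x| ≤ bd) :
    ∫ o, popWeight μ e o * φ o.feat ∂P = ∫ o in e.toSet, φ o.feat ∂P := by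
  rw [hμ.setIntegral_toSet he hφ hb, ← integral_indicator e.measurableSet_attrSet,
    popWeight_eq_indicator]
  refine integral_congr_ae (.of_forall fun o => ?_)
  by_cases ho : o ∈ e.attrSet <;> simp [ho, mul_comm]

lemma IsOutcomeRegression.integral_popWeight (hμ : IsOutcomeRegression P μ) {e : GroupEvent}
    (he : e.IsIdentified P) : ∫ o, popWeight μ e o ∂P = P.real e.toSet := by
  simpa using hμ.integral_popWeight_mul he (φ := fun _ => 1) measurable_const (bd := 1) (by simp)

theorem IsOutcomeRegression.identification (hμ : IsOutcomeRegression P μ) {e : GroupEvent}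
    (he : e.IsIdentified P) (hpos : P e.toSet ≠ 0) (hφ : Measurable φ) (hb : ∀ x, |φ x| ≤ bd) :
    0 < ∫ o, e.label.weight (μ o.feat) ∂(P[|e.attrSet]) ∧
      ∫ o, φ o.feat ∂(P[|e.toSet]) =
        (∫ o, φ o.feat * e.label.weight (μ o.feat) ∂(P[|e.attrSet])) /
          ∫ o, e.label.weight (μ o.feat) ∂(P[|e.attrSet]) := by
  have hpos' : 0 < P.real e.toSet := ENNReal.toReal_pos hpos (measure_ne_top _ _)
  have hApos : 0 < P.real (e.attrSet : Set (Unit4 𝒳)) :=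
    hpos'.trans_le (measureReal_mono fun o ho => ho.1)
  have hweight : ∫ o in e.attrSet, e.label.weight (μ o.feat) ∂P = P.real e.toSet := by
    simpa using (hμ.setIntegral_toSet he (φ := fun _ => 1) measurable_const (bd := 1)
      (by simp)).symm
  rw [integral_cond_eq, integral_cond_eq, integral_cond_eq, hweight,
    hμ.setIntegral_toSet he hφ hb]
  refine ⟨by positivity, ?_⟩
  field_simp

end Identification

/-! ### Losses -/

namespace IsLoss

variable {l : ℝ → ℝ → ℝ}

lemma lipschitzWith (hl : IsLoss l) :
    LipschitzWith 2 fun q : Set.Icc (0 : ℝ) 1 × Set.Icc (0 : ℝ) 1 => l q.1 q.2 := by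
  refine LipschitzWith.of_dist_le_mul fun q r => ?_
  calc |l q.1 q.2 - l r.1 r.2| ≤ dist q.1 r.1 + dist q.2 r.2 :=
        hl.lipschitz _ q.1.2 _ q.2.2 _ r.1.2 _ r.2.2
    _ ≤ dist q r + dist q r := add_le_add (le_max_left _ _) (le_max_right _ _)
    _ = 2 * dist q r := (two_mul _).symm

lemma continuousOn (hl : IsLoss l) {u : ℝ} (hu : u ∈ Set.Icc (0 : ℝ) 1) :
    ContinuousOn (fun y => l y u) (Set.Icc 0 1) :=
  (LipschitzOnWith.of_dist_le_mul (K := 1) fun y hy y' hy' => by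
    simpa [Real.dist_eq] using hl.lipschitz y hy u hu y' hy' u hu).continuousOn

variable {Ω : Type*} [MeasurableSpace Ω] {Y U : Ω → ℝ}

lemma measurable_comp (hl : IsLoss l) (hY : Measurable Y) (hU : Measurable U)
    (hYm : ∀ o, Y o ∈ Set.Icc (0 : ℝ) 1) (hUm : ∀ o, U o ∈ Set.Icc (0 : ℝ) 1) :
    Measurable fun o => l (Y o) (U o) :=
  hl.lipschitzWith.continuous.measurable.comp
    ((hY.subtype_mk (h := hYm)).prodMk (hU.subtype_mk (h := hUm)))

variable {P : Measure Ω}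

lemma aemeasurable_comp (hl : IsLoss l) (hY : AEMeasurable Y P) (hU : Measurable U)
    (hYm : ∀ᵐ o ∂P, Y o ∈ Set.Icc (0 : ℝ) 1) (hUm : ∀ o, U o ∈ Set.Icc (0 : ℝ) 1) :
    AEMeasurable (fun o => l (Y o) (U o)) P := by
  refine (hl.lipschitzWith.continuous.measurable.comp_aemeasurable
    (((continuous_projIcc (h := zero_le_one (α := ℝ))).measurable.comp_aemeasurable hY).prodMk
      (hU.subtype_mk (h := hUm)).aemeasurable)).congr ?_
  filter_upwards [hYm] with o ho
  simp only [Function.comp_apply, Set.projIcc_of_mem _ ho]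

variable [IsProbabilityMeasure P]

lemma integrable_comp (hl : IsLoss l) (hY : AEMeasurable Y P) (hU : Measurable U)
    (hYm : ∀ᵐ o ∂P, Y o ∈ Set.Icc (0 : ℝ) 1) (hUm : ∀ o, U o ∈ Set.Icc (0 : ℝ) 1) :
    Integrable (fun o => l (Y o) (U o)) P :=
  .of_mem_Icc 0 1 (hl.aemeasurable_comp hY hU hYm hUm) (hYm.mono fun o ho => hl.mem _ ho _ (hUm o))

lemma abs_integral_comp_le (hl : IsLoss l) (hYm : ∀ᵐ o ∂P, Y o ∈ Set.Icc (0 : ℝ) 1)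
    (hUm : ∀ o, U o ∈ Set.Icc (0 : ℝ) 1) : |∫ o, l (Y o) (U o) ∂P| ≤ 1 := by
  have hbound : ∀ᵐ o ∂P, ‖l (Y o) (U o)‖ ≤ 1 := hYm.mono fun o ho => by
    obtain ⟨h0, h1⟩ := hl.mem _ ho _ (hUm o)
    rwa [Real.norm_eq_abs, abs_of_nonneg h0]
  simpa using norm_integral_le_of_norm_le_const hbound

lemma map_integral_le (hl : IsLoss l) {u : ℝ} (hu : u ∈ Set.Icc (0 : ℝ) 1)
    (hconv : ConvexOn ℝ (Set.Icc (0 : ℝ) 1) fun y => l y u) (hY : AEMeasurable Y P)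
    (hYm : ∀ᵐ o ∂P, Y o ∈ Set.Icc (0 : ℝ) 1) :
    l (∫ o, Y o ∂P) u ≤ ∫ o, l (Y o) u ∂P :=
  hconv.map_integral_le (hl.continuousOn hu) isClosed_Icc hYm (.of_mem_Icc 0 1 hY hYm)
    (hl.integrable_comp hY measurable_const hYm fun _ => hu)

end IsLoss

section Jensen

variable {𝒳 : Type*} [MeasurableSpace 𝒳] {P : Measure (Unit4 𝒳)} [IsProbabilityMeasure P]
  {l : ℝ → ℝ → ℝ} {μ f : 𝒳 → ℝ}

lemma integrable_lossReg (hl : IsLoss l) (hμ : IsOutcomeRegression P μ) (hf : Measurable f)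
    (hfm : ∀ x, f x ∈ Set.Icc (0 : ℝ) 1) : Integrable (fun o => l (μ o.feat) (f o.feat)) P :=
  hl.integrable_comp (hμ.measurable_reg.comp measurable_feat).aemeasurable
    (hf.comp measurable_feat) (.of_forall fun o => hμ.reg_mem o.feat) fun o => hfm o.feat

lemma ae_condDistrib_out_mem (h : ∀ᵐ o ∂P, o.out ∈ Set.Icc (0 : ℝ) 1) :
    ∀ᵐ o ∂P, ∀ᵐ y ∂(condDistrib Unit4.out Unit4.feat P o.feat), y ∈ Set.Icc (0 : ℝ) 1 := by
  refine ae_of_ae_map (p := fun x => ∀ᵐ y ∂(condDistrib Unit4.out Unit4.feat P x),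
    y ∈ Set.Icc (0 : ℝ) 1) measurable_feat.aemeasurable
    (Measure.ae_ae_of_ae_compProd (p := fun q => q.2 ∈ Set.Icc (0 : ℝ) 1) ?_)
  rw [compProd_map_condDistrib measurable_out.aemeasurable]
  exact (ae_map_iff (measurable_feat.prodMk measurable_out).aemeasurable
    (measurable_snd measurableSet_Icc)).2 h

/-- Jensen's inequality under the conditional distribution of the outcome given the features. -/
theorem lossReg_le_loss (hl : IsLoss l) (hμ : IsOutcomeRegression P μ)
    (hconv : ∀ u ∈ Set.Icc (0 : ℝ) 1, ConvexOn ℝ (Set.Icc (0 : ℝ) 1) fun y => l y u)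
    (hf : Measurable f) (hfm : ∀ x, f x ∈ Set.Icc (0 : ℝ) 1) :
    lossReg P μ l f ≤ loss P l f := by
  set κ := condDistrib Unit4.out Unit4.feat P
  have hjoint : AEStronglyMeasurable (fun q : 𝒳 × ℝ => l q.2 (f q.1))
      (P.map fun o => (o.feat, o.out)) :=
    (hl.aemeasurable_comp measurable_snd.aemeasurable (hf.comp measurable_fst)
      ((ae_map_iff (measurable_feat.prodMk measurable_out).aemeasurable
        (measurable_snd measurableSet_Icc)).2 hμ.out_mem) fun q => hfm q.1).aestronglyMeasurable
  have hloss := condExp_prod_ae_eq_integral_condDistrib₀ (f := fun q : 𝒳 × ℝ => l q.2 (f q.1))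
    measurable_feat measurable_out.aemeasurable hjoint
    (hl.integrable_comp measurable_out.aemeasurable (hf.comp measurable_feat) hμ.out_mem
      fun o => hfm o.feat)
  have hmean := condExp_ae_eq_integral_condDistrib' (μ := P) measurable_feat
    (.of_mem_Icc 0 1 measurable_out.aemeasurable hμ.out_mem : Integrable Unit4.out P)
  rw [loss, ← integral_condExp sigmaFeat_le]
  refine integral_mono_ae (integrable_lossReg hl hμ hf hfm) integrable_condExp ?_
  filter_upwards [hloss, hmean, hμ.reg_eq, ae_condDistrib_out_mem hμ.out_mem] with o h₁ h₂ h₃ hmem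
  calc l (μ o.feat) (f o.feat) = l (∫ y, y ∂κ o.feat) (f o.feat) := by rw [h₃, h₂]
    _ ≤ ∫ y, l y (f o.feat) ∂κ o.feat :=
      hl.map_integral_le (hfm _) (hconv _ (hfm _)) aemeasurable_id hmem
    _ = _ := h₁.symm

end Jensen

/-! ### Discretization -/

section Rounding

variable {N : ℕ} {T : Finset ℝ} {y : ℝ}

lemma roundOut_mem_inter (hT : IsHalfCover N T) (hy : y ∈ Set.Icc (0 : ℝ) 1) :
    roundOut N T y ∈ {t : ℝ | t ∈ T ∧ |y - t| ≤ 1 / (2 * (N : ℝ))} := by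
  obtain ⟨t, ht, h⟩ := hT.2 y hy
  exact Set.Nonempty.csInf_mem ⟨t, ht, h⟩ (T.finite_toSet.subset fun t ht => ht.1)

lemma roundOut_mem (hT : IsHalfCover N T) (hy : y ∈ Set.Icc (0 : ℝ) 1) :
    roundOut N T y ∈ Set.Icc (0 : ℝ) 1 :=
  hT.1 _ (roundOut_mem_inter hT hy).1

lemma abs_roundOut_sub_le (hT : IsHalfCover N T) (hy : y ∈ Set.Icc (0 : ℝ) 1) :
    |roundOut N T y - y| ≤ 1 / (2 * (N : ℝ)) :=
  abs_sub_comm y _ ▸ (roundOut_mem_inter hT hy).2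

/-- The value `2`, larger than every point of the cover, marks points that are too far from `y`. -/
lemma roundOut_eq_iInf (hT : IsHalfCover N T) (hy : y ∈ Set.Icc (0 : ℝ) 1) :
    roundOut N T y = ⨅ t : T, if |y - t| ≤ 1 / (2 * (N : ℝ)) then (t : ℝ) else 2 := by
  obtain ⟨hmem, hdist⟩ := roundOut_mem_inter hT hy
  have : Nonempty T := ⟨⟨_, hmem⟩⟩
  refine le_antisymm (le_ciInf fun t => ?_) ?_
  · split_ifs with h
    · exact csInf_le (T.finite_toSet.subset fun t ht => ht.1).bddBelow ⟨t.2, h⟩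
    · linarith [(roundOut_mem hT hy).2]
  · exact (ciInf_le (Set.finite_range _).bddBelow ⟨_, hmem⟩).trans_eq (if_pos hdist)

lemma measurable_roundOut_comp (hT : IsHalfCover N T) {Ω : Type*} [MeasurableSpace Ω] {Y : Ω → ℝ}
    (hY : Measurable Y) (hYm : ∀ o, Y o ∈ Set.Icc (0 : ℝ) 1) :
    Measurable fun o => roundOut N T (Y o) := by
  simp only [fun o => roundOut_eq_iInf hT (hYm o)]
  exact .iInf fun t => .ite (measurableSet_le (by fun_prop) measurable_const)
    measurable_const measurable_const

lemma abs_natCast_floor_div_sub_le (hN : 0 < N) {u : ℝ} (hu : 0 ≤ u) :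
    |(⌊(N : ℝ) * u⌋₊ : ℝ) / N - u| ≤ 1 / N := by
  have hNpos : (0 : ℝ) < N := mod_cast hN
  have hfloor := Nat.floor_le (mul_nonneg hNpos.le hu)
  have hlt := Nat.lt_floor_add_one ((N : ℝ) * u)
  rw [abs_le, neg_le_sub_iff_le_add, sub_le_iff_le_add, ← add_div, le_div_iff₀' hNpos,
    div_le_iff₀' hNpos, mul_add, mul_one_div_cancel hNpos.ne']
  constructor <;> linarith

lemma natFloor_mul_le {u : ℝ} (hu : u ≤ 1) : ⌊(N : ℝ) * u⌋₊ ≤ N :=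
  Nat.floor_le_of_le (mul_le_of_le_one_right (Nat.cast_nonneg N) hu)

end Rounding

section Grid

variable {𝒳 : Type*} {N : ℕ} {f : 𝒳 → ℝ} {x : 𝒳}

lemma thr_natCast_div (hN : 0 < N) (hx : 0 ≤ f x) (j : ℕ) :
    thr f x ((j : ℝ) / N) = if j ≤ ⌊(N : ℝ) * f x⌋₊ then 1 else 0 := by
  have hNpos : (0 : ℝ) < N := mod_cast hN
  unfold thr
  congr 1
  rw [Nat.le_floor_iff (mul_nonneg hNpos.le hx), div_le_iff₀ hNpos, mul_comm]

lemma sum_Icc_sub_mul_ite (a : ℕ → ℝ) {J : ℕ} (hJ : J ≤ N) :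
    ∑ j ∈ Finset.Icc 1 N, (a j - a (j - 1)) * (if j ≤ J then 1 else 0) = a J - a 0 := by
  have htel (K : ℕ) : ∑ j ∈ Finset.Icc 1 K, (a j - a (j - 1)) = a K - a 0 := by
    induction K with
    | zero => simp
    | succ K ih => rw [Finset.sum_Icc_succ_top (by omega), ih]; simp
  have hfilter : (Finset.Icc 1 N).filter (· ≤ J) = Finset.Icc 1 J := by
    ext j
    simp only [Finset.mem_filter, Finset.mem_Icc]
    omega
  simp only [mul_ite, mul_one, mul_zero]
  rw [← Finset.sum_filter, hfilter, htel]

lemma gridThr_eq (hN : 0 < N) (hx : f x ∈ Set.Icc (0 : ℝ) 1) :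
    gridThr N f x = (⌊(N : ℝ) * f x⌋₊ : ℝ) / N := by
  rw [gridThr, ← sub_zero (⌊(N : ℝ) * f x⌋₊ : ℝ), ← Nat.cast_zero,
    ← sum_Icc_sub_mul_ite (fun j => (j : ℝ)) (natFloor_mul_le hx.2)]
  congr 1
  refine Finset.sum_congr rfl fun j hj => ?_
  rw [thr_natCast_div hN hx.1, Nat.cast_sub (Finset.mem_Icc.1 hj).1]
  simp

lemma gridThr_mem (hN : 0 < N) (hx : f x ∈ Set.Icc (0 : ℝ) 1) :
    gridThr N f x ∈ Set.Icc (0 : ℝ) 1 := by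
  rw [gridThr_eq hN hx]
  exact ⟨by positivity, div_le_one_of_le₀ (mod_cast natFloor_mul_le hx.2) (by positivity)⟩

lemma abs_gridThr_sub_le (hN : 0 < N) (hx : f x ∈ Set.Icc (0 : ℝ) 1) :
    |gridThr N f x - f x| ≤ 1 / N :=
  gridThr_eq hN hx ▸ abs_natCast_floor_div_sub_le hN hx.1

end Grid

section MidpointLoss

variable {𝒳 : Type*} {N : ℕ} {T : Finset ℝ} {l : ℝ → ℝ → ℝ}

/-- The midpoint of the `j`-th cell `[j/N, (j+1)/N]` of the grid, cut off at `1` because the last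
cell (`j = N`) is degenerate. -/
noncomputable def midpt (N j : ℕ) : ℝ := min ((j : ℝ) / N + 1 / (2 * N)) 1

lemma midpt_mem (N j : ℕ) : midpt N j ∈ Set.Icc (0 : ℝ) 1 :=
  ⟨le_min (by positivity) zero_le_one, min_le_right _ _⟩

lemma midpt_zero (hN : 0 < N) : midpt N 0 = 1 / (2 * (N : ℝ)) := by
  have hNone : (1 : ℝ) ≤ N := mod_cast hN
  rw [midpt, Nat.cast_zero, zero_div, zero_add, min_eq_left]
  rw [div_le_one (by positivity)]
  linarith

lemma midpt_self (hN : 0 < N) : midpt N N = 1 := by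
  have hNpos : (0 : ℝ) < N := mod_cast hN
  rw [midpt, div_self hNpos.ne', min_eq_right (le_add_of_nonneg_right (by positivity))]

lemma midpt_sub_one (hN : 0 < N) {j : ℕ} (hj : j ∈ Finset.Icc 1 N) :
    midpt N (j - 1) = (j : ℝ) / N - 1 / (2 * N) := by
  obtain ⟨hj1, hjN⟩ := Finset.mem_Icc.1 hj
  have hNpos : (0 : ℝ) < N := mod_cast hN
  have hjN' : (j : ℝ) / N ≤ 1 := div_le_one_of_le₀ (mod_cast hjN) hNpos.le
  have heq : ((j - 1 : ℕ) : ℝ) / N + 1 / (2 * N) = (j : ℝ) / N - 1 / (2 * N) := by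
    rw [Nat.cast_sub hj1]
    field_simp
    push_cast
    ring
  rw [midpt, heq, min_eq_left ((sub_le_self _ (by positivity)).trans hjN')]

lemma abs_midpt_natFloor_sub_le (hN : 0 < N) {u : ℝ} (hu : u ∈ Set.Icc (0 : ℝ) 1) :
    |midpt N ⌊(N : ℝ) * u⌋₊ - u| ≤ 1 / (2 * N) := by
  have hNpos : (0 : ℝ) < N := mod_cast hN
  have hfloor : (⌊(N : ℝ) * u⌋₊ : ℝ) / N ≤ u := by
    rw [div_le_iff₀' hNpos]
    exact Nat.floor_le (mul_nonneg hNpos.le hu.1)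
  have hlt : u ≤ (⌊(N : ℝ) * u⌋₊ : ℝ) / N + (1 / (2 * N) + 1 / (2 * N)) := by
    have hhalf : (1 : ℝ) / (2 * N) + 1 / (2 * N) = 1 / N := by field_simp; norm_num
    rw [hhalf, ← add_div, le_div_iff₀' hNpos]
    exact (Nat.lt_floor_add_one _).le
  have : (0 : ℝ) ≤ 1 / (2 * N) := by positivity
  rw [abs_le, neg_le_sub_iff_le_add, sub_le_iff_le_add, ← sub_le_iff_le_add]
  exact ⟨le_min (by linarith) (by linarith [hu.2]), (min_le_left _ _).trans (by linarith)⟩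

/-- The cost of the classifiers at level `j/N`: the increments of the loss between consecutive
midpoints, relative to the width `1/N` of the cells. -/
noncomputable def lossIncr (l : ℝ → ℝ → ℝ) (N : ℕ) (y : ℝ) (j : ℕ) : ℝ :=
  N * (l y (midpt N j) - l y (midpt N (j - 1)))

lemma costFun_eq_lossIncr (hN : 0 < N) (y : ℝ) {j : ℕ} (hj : j ∈ Finset.Icc 1 N) :
    costFun l N y ((j : ℝ) / N) = lossIncr l N y j := by
  rw [costFun, lossIncr, midpt_sub_one hN hj, midpt]

lemma abs_midpt_sub_midpt_le (N j : ℕ) : |midpt N j - midpt N (j - 1)| ≤ 1 / N := by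
  refine (abs_min_sub_min_le_max _ _ _ _).trans (max_le ?_ (by simp))
  rw [add_sub_add_right_eq_sub, ← sub_div, abs_div, Nat.abs_cast]
  gcongr
  rcases j with _ | j <;> simp

lemma IsLoss.abs_lossIncr_le (hl : IsLoss l) (hN : 0 < N) {y : ℝ} (hy : y ∈ Set.Icc (0 : ℝ) 1)
    (j : ℕ) : |lossIncr l N y j| ≤ 1 := by
  have hNpos : (0 : ℝ) < N := mod_cast hN
  have hlip := hl.lipschitz y hy _ (midpt_mem N j) y hy _ (midpt_mem N (j - 1))
  rw [sub_self, abs_zero, zero_add] at hlip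
  rw [lossIncr, abs_mul, Nat.abs_cast, ← mul_one_div_cancel hNpos.ne']
  exact mul_le_mul_of_nonneg_left (hlip.trans (abs_midpt_sub_midpt_le N j)) hNpos.le

/-- Summing the costs of the thresholds below `f x` telescopes. -/
lemma sum_lossIncr_mul_thr (hN : 0 < N) (y : ℝ) {f : 𝒳 → ℝ} {x : 𝒳}
    (hx : f x ∈ Set.Icc (0 : ℝ) 1) :
    (∑ j ∈ Finset.Icc 1 N, lossIncr l N y j * thr f x ((j : ℝ) / N)) / N =
      l y (midpt N ⌊(N : ℝ) * f x⌋₊) - l y (midpt N 0) := by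
  have hNpos : (0 : ℝ) < N := mod_cast hN
  rw [← sum_Icc_sub_mul_ite (fun j => l y (midpt N j)) (natFloor_mul_le hx.2),
    div_eq_iff hNpos.ne', Finset.sum_mul]
  refine Finset.sum_congr rfl fun j _ => ?_
  rw [lossIncr, thr_natCast_div hN hx.1]
  ring

lemma sum_lossIncr (hN : 0 < N) (y : ℝ) :
    (∑ j ∈ Finset.Icc 1 N, lossIncr l N y j) / N = l y 1 - l y (midpt N 0) := by
  have hNpos : (0 : ℝ) < N := mod_cast hN
  have htel := sum_Icc_sub_mul_ite (fun j => l y (midpt N j)) le_rfl (N := N)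
  rw [midpt_self hN] at htel
  rw [← htel, div_eq_iff hNpos.ne', Finset.sum_mul]
  refine Finset.sum_congr rfl fun j hj => ?_
  rw [lossIncr, if_pos (Finset.mem_Icc.1 hj).2]
  ring

/-- The loss after rounding: the outcome to the cover, the prediction to the midpoint of its
cell. -/
noncomputable def roundLoss (l : ℝ → ℝ → ℝ) (N : ℕ) (T : Finset ℝ) (y u : ℝ) : ℝ :=
  l (roundOut N T y) (midpt N ⌊(N : ℝ) * u⌋₊)

lemma IsLoss.abs_roundLoss_sub_le (hl : IsLoss l) (hN : 0 < N) (hT : IsHalfCover N T) {y u : ℝ}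
    (hy : y ∈ Set.Icc (0 : ℝ) 1) (hu : u ∈ Set.Icc (0 : ℝ) 1) :
    |roundLoss l N T y u - l y u| ≤ 1 / N := by
  have hhalf : (1 : ℝ) / N = 1 / (2 * N) + 1 / (2 * N) := by field_simp; norm_num
  rw [hhalf]
  exact (hl.lipschitz _ (roundOut_mem hT hy) _ (midpt_mem N _) _ hy _ hu).trans
    (add_le_add (abs_roundOut_sub_le hT hy) (abs_midpt_natFloor_sub_le hN hu))

end MidpointLoss

/-! ### The loss process and the weight processes -/

section EmpiricalCost

variable {𝒳 : Type*} {n N : ℕ} {T : Finset ℝ} {l : ℝ → ℝ → ℝ} {μ f : 𝒳 → ℝ}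

lemma empConst_oracleData (hN : 0 < N) (s : Fin n → Unit4 𝒳) :
    empConst l N T (oracleData μ s) =
      (∑ i, l (roundOut N T (μ (s i).feat)) (midpt N 0)) / n := by
  simp only [empConst, oracleData, midpt_zero hN]

lemma empCost_oracleData (hN : 0 < N) (hf : ∀ x, f x ∈ Set.Icc (0 : ℝ) 1)
    (s : Fin n → Unit4 𝒳) :
    empCost l N T (oracleData μ s) f = (∑ i, (roundLoss l N T (μ (s i).feat) (f (s i).feat) -
      l (roundOut N T (μ (s i).feat)) (midpt N 0))) / n := by
  rw [empCost]
  congr 1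
  refine Finset.sum_congr rfl fun i _ => ?_
  rw [roundLoss, ← sum_lossIncr_mul_thr hN _ (hf _)]
  congr 1
  exact Finset.sum_congr rfl fun j hj => by rw [costFun_eq_lossIncr hN _ hj]; rfl

lemma empCost_add_empConst (hN : 0 < N) (hf : ∀ x, f x ∈ Set.Icc (0 : ℝ) 1)
    (s : Fin n → Unit4 𝒳) :
    empCost l N T (oracleData μ s) f + empConst l N T (oracleData μ s) =
      (∑ i, roundLoss l N T (μ (s i).feat) (f (s i).feat)) / n := by
  rw [empCost_oracleData hN hf, empConst_oracleData hN, ← add_div, ← Finset.sum_add_distrib]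
  simp only [sub_add_cancel]

lemma IsLoss.roundLoss_mem (hl : IsLoss l) (hT : IsHalfCover N T) {y : ℝ}
    (hy : y ∈ Set.Icc (0 : ℝ) 1) (u : ℝ) : roundLoss l N T y u ∈ Set.Icc (0 : ℝ) 1 :=
  hl.mem _ (roundOut_mem hT hy) _ (midpt_mem N _)

lemma abs_empCost_le (hl : IsLoss l) (hN : 0 < N) (hT : IsHalfCover N T)
    (hμ : ∀ x, μ x ∈ Set.Icc (0 : ℝ) 1) (hf : ∀ x, f x ∈ Set.Icc (0 : ℝ) 1)
    (s : Fin n → Unit4 𝒳) : |empCost l N T (oracleData μ s) f| ≤ 1 := by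
  rw [empCost_oracleData hN hf, abs_div, Nat.abs_cast]
  refine div_le_one_of_le₀ ?_ n.cast_nonneg
  refine (Finset.abs_sum_le_sum_abs _ _).trans
    ((Finset.sum_le_card_nsmul _ _ 1 fun i _ => ?_).trans (by simp))
  obtain ⟨hround0, hround1⟩ := hl.roundLoss_mem hT (hμ (s i).feat) (f (s i).feat)
  obtain ⟨hmid0, hmid1⟩ := hl.mem _ (roundOut_mem hT (hμ (s i).feat)) _ (midpt_mem N 0)
  exact abs_le.2 ⟨by linarith, by linarith⟩

lemma empConst_mem (hl : IsLoss l) (hN : 0 < N) (hT : IsHalfCover N T)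
    (hμ : ∀ x, μ x ∈ Set.Icc (0 : ℝ) 1) (s : Fin n → Unit4 𝒳) :
    empConst l N T (oracleData μ s) ∈ Set.Icc (0 : ℝ) 1 := by
  have hmem (i : Fin n) := hl.mem _ (roundOut_mem hT (hμ (s i).feat)) _ (midpt_mem N 0)
  rw [empConst_oracleData hN]
  exact ⟨div_nonneg (Finset.sum_nonneg fun i _ => (hmem i).1) n.cast_nonneg,
    div_le_one_of_le₀ ((Finset.sum_le_card_nsmul _ _ 1 fun i _ => (hmem i).2).trans (by simp))
      n.cast_nonneg⟩

end EmpiricalCost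

section LossProcess

variable {𝒳 : Type*} {N : ℕ} {T : Finset ℝ} {l : ℝ → ℝ → ℝ} {μ : 𝒳 → ℝ}

/-- The slopes of the loss process. -/
noncomputable def lossSlope (l : ℝ → ℝ → ℝ) (N : ℕ) (T : Finset ℝ) (μ : 𝒳 → ℝ) (j : ℕ)
    (o : Unit4 𝒳) : ℝ :=
  lossIncr l N (roundOut N T (μ o.feat)) j

/-- The intercepts of the loss process. Subtracting half the slope centers the layers, which keeps
their values in `[-1,1]`. -/
noncomputable def lossBase (l : ℝ → ℝ → ℝ) (N : ℕ) (T : Finset ℝ) (μ : 𝒳 → ℝ) (j : ℕ)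
    (o : Unit4 𝒳) : ℝ :=
  (l (roundOut N T (μ o.feat)) (midpt N 0) + l (roundOut N T (μ o.feat)) 1 - 1) / 2 -
    lossSlope l N T μ j o / 2

lemma layered_const (hN : 0 < N) (w : Unit4 𝒳 → ℝ) (f : 𝒳 → ℝ) (o : Unit4 𝒳) :
    layered N (fun _ => w) (fun _ => 0) f o = w o := by
  have hNpos : (0 : ℝ) < N := mod_cast hN
  simp [layered, mul_div_cancel_left₀ _ hNpos.ne']

lemma layered_zero_base (w : Unit4 𝒳 → ℝ) (f : 𝒳 → ℝ) (o : Unit4 𝒳) :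
    layered N (fun _ => 0) (fun _ => w) f o = w o * gridThr N f o.feat := by
  simp only [layered, gridThr, Pi.zero_apply, zero_add, ← Finset.mul_sum, mul_div_assoc]

lemma layered_loss (hN : 0 < N) {f : 𝒳 → ℝ} (o : Unit4 𝒳) (hf : f o.feat ∈ Set.Icc (0 : ℝ) 1) :
    layered N (lossBase l N T μ) (lossSlope l N T μ) f o =
      roundLoss l N T (μ o.feat) (f o.feat) - 1 / 2 := by
  have hNpos : (0 : ℝ) < N := mod_cast hN
  have hthr := sum_lossIncr_mul_thr (l := l) hN (roundOut N T (μ o.feat)) hf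
  have hsum := sum_lossIncr (l := l) hN (roundOut N T (μ o.feat))
  simp only [layered, lossBase, lossSlope, Finset.sum_add_distrib, Finset.sum_sub_distrib, add_div,
    sub_div, Finset.sum_const, Nat.card_Icc, nsmul_eq_mul, Nat.add_sub_cancel,
    mul_div_cancel_left₀ _ hNpos.ne', ← Finset.sum_div, div_right_comm _ (2 : ℝ) (N : ℝ), hthr,
    hsum, roundLoss]
  ring

variable [MeasurableSpace 𝒳]

lemma measurable_loss_roundOut (hl : IsLoss l) (hT : IsHalfCover N T) (hμm : Measurable μ)
    (hμ : ∀ x, μ x ∈ Set.Icc (0 : ℝ) 1) {U : Unit4 𝒳 → ℝ} (hU : Measurable U)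
    (hUm : ∀ o, U o ∈ Set.Icc (0 : ℝ) 1) :
    Measurable fun o : Unit4 𝒳 => l (roundOut N T (μ o.feat)) (U o) :=
  hl.measurable_comp (measurable_roundOut_comp hT (hμm.comp measurable_feat) fun o => hμ o.feat) hU
    (fun _ => roundOut_mem hT (hμ _)) hUm

lemma isLayerIntegrand_loss (hl : IsLoss l) (hN : 0 < N) (hT : IsHalfCover N T)
    (hμm : Measurable μ) (hμ : ∀ x, μ x ∈ Set.Icc (0 : ℝ) 1) (j : ℕ) :
    IsLayerIntegrand (lossBase l N T μ j) (lossSlope l N T μ j) := by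
  have hmeas (u : ℝ) (hu : u ∈ Set.Icc (0 : ℝ) 1) :=
    measurable_loss_roundOut hl hT hμm hμ measurable_const fun _ => hu
  have hslope : Measurable (lossSlope l N T μ j) :=
    ((hmeas _ (midpt_mem N j)).sub (hmeas _ (midpt_mem N (j - 1)))).const_mul _
  have hle (o : Unit4 𝒳) : |lossSlope l N T μ j o| ≤ 1 :=
    hl.abs_lossIncr_le hN (roundOut_mem hT (hμ _)) j
  have hone : (1 : ℝ) ∈ Set.Icc (0 : ℝ) 1 := Set.right_mem_Icc.2 zero_le_one
  have hmem (o : Unit4 𝒳) := hl.mem _ (roundOut_mem hT (hμ o.feat)) _ (midpt_mem N 0)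
  have hmem' (o : Unit4 𝒳) := hl.mem _ (roundOut_mem hT (hμ o.feat)) _ hone
  refine ⟨((((hmeas _ (midpt_mem N 0)).add (hmeas _ hone)).sub_const 1).div_const 2).sub
    (hslope.div_const 2), hslope, fun o => ?_, hle, fun o => ?_⟩ <;>
  · obtain ⟨hlow, hup⟩ := abs_le.1 (hle o)
    rw [lossBase, abs_le]
    constructor <;> linarith [(hmem o).1, (hmem o).2, (hmem' o).1, (hmem' o).2]

variable {P : Measure (Unit4 𝒳)} [IsProbabilityMeasure P] {f : 𝒳 → ℝ}

lemma integrable_roundLoss (hl : IsLoss l) (hT : IsHalfCover N T) (hμm : Measurable μ)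
    (hμ : ∀ x, μ x ∈ Set.Icc (0 : ℝ) 1) (hf : Measurable f) :
    Integrable (fun o => roundLoss l N T (μ o.feat) (f o.feat)) P := by
  have hU : Measurable fun o : Unit4 𝒳 => midpt N ⌊N * f o.feat⌋₊ :=
    (measurable_from_top (f := midpt N)).comp ((hf.comp measurable_feat).const_mul _).nat_floor
  exact .of_mem_Icc 0 1
    (measurable_loss_roundOut hl hT hμm hμ hU fun _ => midpt_mem N _).aemeasurable
    (.of_forall fun _ => hl.roundLoss_mem hT (hμ _) _)

lemma abs_integral_roundLoss_sub_le (hl : IsLoss l) (hN : 0 < N) (hT : IsHalfCover N T)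
    (hμ : IsOutcomeRegression P μ) (hfm : Measurable f) (hf : ∀ x, f x ∈ Set.Icc (0 : ℝ) 1) :
    |∫ o, roundLoss l N T (μ o.feat) (f o.feat) ∂P - lossReg P μ l f| ≤ 1 / N := by
  rw [lossReg, ← integral_sub (integrable_roundLoss hl hT hμ.measurable_reg hμ.reg_mem hfm)
    (integrable_lossReg hl hμ hfm hf)]
  exact abs_integral_le_of_abs_le fun o => hl.abs_roundLoss_sub_le hN hT (hμ.reg_mem _) (hf _)

end LossProcess

section WeightProcesses

variable {𝒳 : Type*} [MeasurableSpace 𝒳] {N : ℕ} {μ f : 𝒳 → ℝ} {w : Unit4 𝒳 → ℝ}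

lemma isLayerIntegrand_zero_left (hw : Measurable w) (hmem : ∀ o, w o ∈ Set.Icc (0 : ℝ) 1) :
    IsLayerIntegrand 0 w := by
  have hle (o : Unit4 𝒳) : |w o| ≤ 1 := abs_le.2 ⟨by linarith [(hmem o).1], (hmem o).2⟩
  exact ⟨measurable_zero, hw, by simp, hle, by simpa using hle⟩

lemma isLayerIntegrand_zero_right (hw : Measurable w) (hmem : ∀ o, w o ∈ Set.Icc (0 : ℝ) 1) :
    IsLayerIntegrand w 0 := by
  have hle (o : Unit4 𝒳) : |w o| ≤ 1 := abs_le.2 ⟨by linarith [(hmem o).1], (hmem o).2⟩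
  exact ⟨hw, measurable_zero, hle, by simp, by simpa using hle⟩

lemma measurable_gridThr (hf : Measurable f) : Measurable (gridThr N f) :=
  (Finset.measurable_fun_sum _ fun _ _ => measurable_thr hf _).div_const _

variable {P : Measure (Unit4 𝒳)} [IsProbabilityMeasure P]

lemma integrable_popWeight_mul (hμ : IsOutcomeRegression P μ) (e : GroupEvent) (hfm : Measurable f)
    (hf : ∀ x, f x ∈ Set.Icc (0 : ℝ) 1) : Integrable (fun o => popWeight μ e o * f o.feat) P :=
  .of_mem_Icc 0 1 ((measurable_popWeight hμ.measurable_reg e).mul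
    (hfm.comp measurable_feat)).aemeasurable (.of_forall fun o =>
      have hw := popWeight_mem hμ.reg_mem e o
      ⟨mul_nonneg hw.1 (hf _).1, mul_le_one₀ hw.2 (hf _).1 (hf _).2⟩)

lemma abs_integral_popWeight_mul_gridThr_sub_le (hN : 0 < N) (hμ : IsOutcomeRegression P μ)
    (e : GroupEvent) (hfm : Measurable f) (hf : ∀ x, f x ∈ Set.Icc (0 : ℝ) 1) :
    |∫ o, popWeight μ e o * gridThr N f o.feat ∂P - ∫ o, popWeight μ e o * f o.feat ∂P| ≤
      1 / N := by
  rw [← integral_sub (integrable_popWeight_mul hμ e (measurable_gridThr hfm)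
    fun x => gridThr_mem hN (hf x)) (integrable_popWeight_mul hμ e hfm hf)]
  refine abs_integral_le_of_abs_le fun o => ?_
  obtain ⟨hw0, hw1⟩ := popWeight_mem hμ.reg_mem e o
  rw [← mul_sub, abs_mul, abs_of_nonneg hw0]
  exact (mul_le_of_le_one_left (abs_nonneg _) hw1).trans (abs_gridThr_sub_le hN (hf _))

end WeightProcesses

/-! ### Samples on which all processes are close to their expectations -/

section GoodSample

variable {𝒳 : Type*} {n N : ℕ} {b c : ℕ → Unit4 𝒳 → ℝ}

lemma layered_neg (f : 𝒳 → ℝ) (o : Unit4 𝒳) :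
    layered N (fun j => -b j) (fun j => -c j) f o = -layered N b c f o := by
  simp only [layered, Pi.neg_apply, neg_mul, ← neg_add, Finset.sum_neg_distrib, neg_div]

variable [MeasurableSpace 𝒳] {P : Measure (Unit4 𝒳)} [IsProbabilityMeasure P] {μ : 𝒳 → ℝ}
  {l : ℝ → ℝ → ℝ} {F : Set (𝒳 → ℝ)} {T : Finset ℝ} {R p : ℝ}

/-- The radius within which, over a class of Rademacher complexity at most `R`, the means of `n`
draws exceed the expectations, except with probability at most `p`. -/
noncomputable def deviationRadius (R : ℝ) (n : ℕ) (p : ℝ) : ℝ :=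
  2 * R + 2 * √(-Real.log p / n)

lemma measure_exists_deviationRadius_lt_sub_le (hF : IsPredictionClass P F) (hn : 0 < n)
    (hN : 0 < N) (h : ∀ j, IsLayerIntegrand (b j) (c j)) (hR : rademacher (thrClass F) n ≤ R)
    (hp0 : 0 < p) (hp1 : p ≤ 1) :
    (Measure.pi fun _ : Fin n => P) {s | ∃ f ∈ F, deviationRadius R n p <
        (∑ i, layered N b c f (s i)) / n - ∫ o, layered N b c f o ∂P} ≤ ENNReal.ofReal p := by
  have hdev := measure_exists_layered_deviation_le hF hn hN h (L := -Real.log p)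
    (neg_nonneg.2 (Real.log_nonpos hp0.le hp1))
  rw [neg_neg, Real.exp_log hp0] at hdev
  refine (measure_mono ?_).trans hdev
  rintro s ⟨f, hf, hlt⟩
  exact ⟨f, hf, lt_of_le_of_lt (by rw [deviationRadius]; gcongr) hlt⟩

lemma measure_exists_deviationRadius_lt_sub_le' (hF : IsPredictionClass P F) (hn : 0 < n)
    (hN : 0 < N) (h : ∀ j, IsLayerIntegrand (b j) (c j)) (hR : rademacher (thrClass F) n ≤ R)
    (hp0 : 0 < p) (hp1 : p ≤ 1) :
    (Measure.pi fun _ : Fin n => P) {s | ∃ f ∈ F, deviationRadius R n p <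
        ∫ o, layered N b c f o ∂P - (∑ i, layered N b c f (s i)) / n} ≤ ENNReal.ofReal p := by
  have hneg := measure_exists_deviationRadius_lt_sub_le hF hn hN (fun j => (h j).neg) hR hp0 hp1
  simpa only [layered_neg, Finset.sum_neg_distrib, integral_neg, neg_div, sub_neg_eq_add,
    neg_add_eq_sub] using hneg

lemma measure_exists_deviationRadius_lt_abs_sub_le (hF : IsPredictionClass P F) (hn : 0 < n)
    (hN : 0 < N) (h : ∀ j, IsLayerIntegrand (b j) (c j)) (hR : rademacher (thrClass F) n ≤ R)
    (hp0 : 0 < p) (hp1 : p ≤ 1) :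
    (Measure.pi fun _ : Fin n => P) {s | ∃ f ∈ F, deviationRadius R n p <
        |(∑ i, layered N b c f (s i)) / n - ∫ o, layered N b c f o ∂P|} ≤
      ENNReal.ofReal p + ENNReal.ofReal p := by
  refine le_trans (measure_mono ?_) ((measure_union_le _ _).trans (add_le_add
    (measure_exists_deviationRadius_lt_sub_le hF hn hN h hR hp0 hp1)
    (measure_exists_deviationRadius_lt_sub_le' hF hn hN h hR hp0 hp1)))
  rintro s ⟨f, hf, hlt⟩
  rcases lt_abs.1 hlt with hpos | hneg
  · exact Or.inl ⟨f, hf, hpos⟩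
  · exact Or.inr ⟨f, hf, by rwa [neg_sub] at hneg⟩

lemma sum_layered_loss_div_sub_integral (hl : IsLoss l) (hn : 0 < n) (hN : 0 < N)
    (hT : IsHalfCover N T) (hμm : Measurable μ) (hμ : ∀ x, μ x ∈ Set.Icc (0 : ℝ) 1) {f : 𝒳 → ℝ}
    (hfm : Measurable f) (hf : ∀ x, f x ∈ Set.Icc (0 : ℝ) 1) (s : Fin n → Unit4 𝒳) :
    (∑ i, layered N (lossBase l N T μ) (lossSlope l N T μ) f (s i)) / n -
        ∫ o, layered N (lossBase l N T μ) (lossSlope l N T μ) f o ∂P =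
      (∑ i, roundLoss l N T (μ (s i).feat) (f (s i).feat)) / n -
        ∫ o, roundLoss l N T (μ o.feat) (f o.feat) ∂P := by
  have hnpos : (n : ℝ) ≠ 0 := mod_cast hn.ne'
  simp only [layered_loss hN _ (hf _)]
  rw [integral_sub (integrable_roundLoss hl hT hμm hμ hfm) (integrable_const _), integral_const,
    probReal_univ, one_smul, Finset.sum_sub_distrib, sub_div, Finset.sum_const, Finset.card_univ,
    Fintype.card_fin, nsmul_eq_mul, mul_div_cancel_left₀ _ hnpos]
  ring

/-- All sample means used by the algorithm are uniformly close to their expectations: within `r₁`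
where the loss is overestimated, and within `r₂` otherwise. -/
structure GoodSample (P : Measure (Unit4 𝒳)) (μ : 𝒳 → ℝ) (l : ℝ → ℝ → ℝ) (F : Set (𝒳 → ℝ))
    (ev : Fin 2 → GroupEvent) (N : ℕ) (T : Finset ℝ) (r₁ r₂ : ℝ) (s : Fin n → Unit4 𝒳) :
    Prop where
  loss_upper : ∀ f ∈ F, (∑ i, roundLoss l N T (μ (s i).feat) (f (s i).feat)) / n -
    ∫ o, roundLoss l N T (μ o.feat) (f o.feat) ∂P ≤ r₁
  loss_lower : ∀ f ∈ F, ∫ o, roundLoss l N T (μ o.feat) (f o.feat) ∂P -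
    (∑ i, roundLoss l N T (μ (s i).feat) (f (s i).feat)) / n ≤ r₂
  num : ∀ a, ∀ f ∈ F, |(∑ i, popWeight μ (ev a) (s i) * gridThr N f (s i).feat) / n -
    ∫ o, popWeight μ (ev a) o * gridThr N f o.feat ∂P| ≤ r₂
  den : ∀ a, |(∑ i, popWeight μ (ev a) (s i)) / n - ∫ o, popWeight μ (ev a) o ∂P| ≤ r₂

lemma measure_exists_roundLoss_deviation_le (hl : IsLoss l) (hF : IsPredictionClass P F)
    (hn : 0 < n) (hN : 0 < N) (hT : IsHalfCover N T) (hμm : Measurable μ)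
    (hμ : ∀ x, μ x ∈ Set.Icc (0 : ℝ) 1) (hR : rademacher (thrClass F) n ≤ R)
    (hp0 : 0 < p) (hp1 : p ≤ 1) :
    (Measure.pi fun _ : Fin n => P) {s | ∃ f ∈ F, deviationRadius R n p <
        (∑ i, roundLoss l N T (μ (s i).feat) (f (s i).feat)) / n -
          ∫ o, roundLoss l N T (μ o.feat) (f o.feat) ∂P} ≤ ENNReal.ofReal p := by
  refine (measure_mono ?_).trans (measure_exists_deviationRadius_lt_sub_le hF hn hN
    (isLayerIntegrand_loss hl hN hT hμm hμ) hR hp0 hp1)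
  rintro s ⟨f, hf, hlt⟩
  exact ⟨f, hf, by rwa [sum_layered_loss_div_sub_integral hl hn hN hT hμm hμ (hF.measurable f hf)
    (hF.mem f hf)]⟩

lemma measure_exists_roundLoss_deviation_le' (hl : IsLoss l) (hF : IsPredictionClass P F)
    (hn : 0 < n) (hN : 0 < N) (hT : IsHalfCover N T) (hμm : Measurable μ)
    (hμ : ∀ x, μ x ∈ Set.Icc (0 : ℝ) 1) (hR : rademacher (thrClass F) n ≤ R)
    (hp0 : 0 < p) (hp1 : p ≤ 1) :
    (Measure.pi fun _ : Fin n => P) {s | ∃ f ∈ F, deviationRadius R n p <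
        ∫ o, roundLoss l N T (μ o.feat) (f o.feat) ∂P -
          (∑ i, roundLoss l N T (μ (s i).feat) (f (s i).feat)) / n} ≤ ENNReal.ofReal p := by
  refine (measure_mono ?_).trans (measure_exists_deviationRadius_lt_sub_le' hF hn hN
    (isLayerIntegrand_loss hl hN hT hμm hμ) hR hp0 hp1)
  rintro s ⟨f, hf, hlt⟩
  refine ⟨f, hf, ?_⟩
  rwa [← neg_sub, sum_layered_loss_div_sub_integral hl hn hN hT hμm hμ (hF.measurable f hf)
    (hF.mem f hf), neg_sub]

lemma measure_exists_weight_mul_gridThr_deviation_le (hF : IsPredictionClass P F) (hn : 0 < n)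
    (hN : 0 < N) {w : Unit4 𝒳 → ℝ} (hw : Measurable w) (hmem : ∀ o, w o ∈ Set.Icc (0 : ℝ) 1)
    (hR : rademacher (thrClass F) n ≤ R) (hp0 : 0 < p) (hp1 : p ≤ 1) :
    (Measure.pi fun _ : Fin n => P) {s | ∃ f ∈ F, deviationRadius R n p <
        |(∑ i, w (s i) * gridThr N f (s i).feat) / n - ∫ o, w o * gridThr N f o.feat ∂P|} ≤
      ENNReal.ofReal p + ENNReal.ofReal p := by
  have hdev := measure_exists_deviationRadius_lt_abs_sub_le hF hn hN
    (fun _ => isLayerIntegrand_zero_left hw hmem) hR hp0 hp1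
  simpa only [layered_zero_base] using hdev

lemma measure_weight_deviation_le (hF : IsPredictionClass P F) (hn : 0 < n)
    (hN : 0 < N) {w : Unit4 𝒳 → ℝ} (hw : Measurable w) (hmem : ∀ o, w o ∈ Set.Icc (0 : ℝ) 1)
    (hR : rademacher (thrClass F) n ≤ R) (hp0 : 0 < p) (hp1 : p ≤ 1) :
    (Measure.pi fun _ : Fin n => P)
        {s | deviationRadius R n p < |(∑ i, w (s i)) / n - ∫ o, w o ∂P|} ≤
      ENNReal.ofReal p + ENNReal.ofReal p := by
  obtain ⟨f, hf⟩ := hF.nonempty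
  refine (measure_mono ?_).trans (measure_exists_deviationRadius_lt_abs_sub_le hF hn hN
    (fun _ => isLayerIntegrand_zero_right hw hmem) hR hp0 hp1)
  intro s hs
  simp only [Set.mem_ofPred_eq] at hs
  exact ⟨f, hf, by simpa only [layered_const hN] using hs⟩

theorem measure_not_goodSample_le (hl : IsLoss l) (hF : IsPredictionClass P F)
    (ev : Fin 2 → GroupEvent) (hn : 0 < n) (hN : 0 < N) (hT : IsHalfCover N T)
    (hμm : Measurable μ) (hμ : ∀ x, μ x ∈ Set.Icc (0 : ℝ) 1)
    (hR : rademacher (thrClass F) n ≤ R) {δ : ℝ} (hδ0 : 0 < δ) (hδ1 : δ ≤ 1) :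
    (Measure.pi fun _ : Fin n => P) {s | ¬ GoodSample P μ l F ev N T
      (deviationRadius R n (δ / 8)) (deviationRadius R n (δ / 16)) s} ≤ ENNReal.ofReal δ := by
  have hp8 : 0 < δ / 8 := by positivity
  have hp16 : 0 < δ / 16 := by positivity
  have hp16' : δ / 16 ≤ 1 := by linarith
  have hupper := measure_exists_roundLoss_deviation_le hl hF hn hN hT hμm hμ hR hp8 (by linarith)
  have hlower := measure_exists_roundLoss_deviation_le' hl hF hn hN hT hμm hμ hR hp16 hp16'
  have hnum (a : Fin 2) := measure_exists_weight_mul_gridThr_deviation_le hF hn hN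
    (measurable_popWeight hμm (ev a)) (popWeight_mem hμ (ev a)) hR hp16 hp16'
  have hden (a : Fin 2) := measure_weight_deviation_le hF hn hN
    (measurable_popWeight hμm (ev a)) (popWeight_mem hμ (ev a)) hR hp16 hp16'
  refine (measure_mono ?_).trans ((measure_union_le _ _).trans ((add_le_add
    ((measure_union_le _ _).trans (add_le_add hupper hlower))
    ((measure_iUnion_fintype_le _ _).trans (Finset.sum_le_sum fun a _ =>
      (measure_union_le _ _).trans (add_le_add (hnum a) (hden a))))).trans ?_))
  · intro s hs
    by_contra hno
    simp only [Set.mem_union, Set.mem_iUnion, Set.mem_ofPred_eq, not_or, not_exists, not_and,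
      not_lt] at hno
    exact hs ⟨hno.1.1, hno.1.2, fun a => (hno.2 a).1, fun a => (hno.2 a).2⟩
  · rw [Fin.sum_univ_two, ← ENNReal.ofReal_add hp16.le hp16.le, ← ENNReal.ofReal_add hp8.le hp16.le,
      ← ENNReal.ofReal_add (by positivity) (by positivity),
      ← ENNReal.ofReal_add (by positivity) (by positivity),
      ← ENNReal.ofReal_add (by positivity) (by positivity)]
    exact ENNReal.ofReal_le_ofReal (by linarith)

end GoodSample

/-! ### Guarantees on good samples -/

section Ratio

lemma abs_div_sub_div_le {x y u v d₁ d₂ p : ℝ} (hx : 0 ≤ x) (hxy : x ≤ y) (hp : 0 < p)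
    (hpv : p ≤ v) (hnum : |x - u| ≤ d₁) (hden : |y - v| ≤ d₂) :
    |x / y - u / v| ≤ (d₁ + d₂) / p := by
  have hv : 0 < v := hp.trans_le hpv
  have hy : 0 ≤ y := hx.trans hxy
  have hratio0 : 0 ≤ x / y := div_nonneg hx hy
  have hratio1 : x / y ≤ 1 := div_le_one_of_le₀ hxy hy
  have hmul : x / y * y = x := div_mul_cancel_of_imp fun h => le_antisymm (hxy.trans h.le) hx
  have hsplit : x / y - u / v = ((x - u) - x / y * (y - v)) / v := by
    rw [mul_sub, hmul]
    field_simp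
    ring
  have hsum : |(x - u) - x / y * (y - v)| ≤ d₁ + d₂ := by
    refine (abs_sub _ _).trans (add_le_add hnum ?_)
    rw [abs_mul, abs_of_nonneg hratio0]
    exact (mul_le_of_le_one_left (abs_nonneg _) hratio1).trans hden
  rw [hsplit, abs_div, abs_of_pos hv]
  exact div_le_div₀ ((abs_nonneg _).trans hsum) hsum hp hpv

lemma mul_mem_Icc_min_zero {m : ℝ} (hm : m ∈ Set.Icc (0 : ℝ) 1) (b : ℝ) :
    b * m ∈ Set.Icc (min b 0) (min b 0 + |b|) := by
  rcases le_total 0 b with hb | hb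
  · rw [min_eq_right hb, abs_of_nonneg hb, zero_add]
    exact ⟨mul_nonneg hb hm.1, mul_le_of_le_one_right hb hm.2⟩
  · rw [min_eq_left hb, abs_of_nonpos hb, add_neg_cancel]
    exact ⟨le_mul_of_le_one_right hb hm.2, mul_nonpos_of_nonpos_of_nonneg hb hm.1⟩

end Ratio

section EmpiricalDisparity

variable {𝒳 : Type*} {n N : ℕ} {μ f : 𝒳 → ℝ}

/-- The normalized group averages of which the empirical disparity is a combination. -/
noncomputable def groupMean (e : GroupEvent) (N : ℕ) (μ : 𝒳 → ℝ) (s : Fin n → Unit4 𝒳)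
    (f : 𝒳 → ℝ) : ℝ :=
  (∑ i, popWeight μ e (s i) * gridThr N f (s i).feat) / ∑ i, popWeight μ e (s i)

lemma empDisparity_eq (β : Fin 2 → ℝ) (ev : Fin 2 → GroupEvent) (s : Fin n → Unit4 𝒳) :
    empDisparity β ev N (oracleData μ s) f =
      β 0 * groupMean (ev 0) N μ s f + β 1 * groupMean (ev 1) N μ s f :=
  Fin.sum_univ_two _

lemma sum_popWeight_mul_gridThr_nonneg (hN : 0 < N) (hμ : ∀ x, μ x ∈ Set.Icc (0 : ℝ) 1)
    (e : GroupEvent) (s : Fin n → Unit4 𝒳) (hf : ∀ x, f x ∈ Set.Icc (0 : ℝ) 1) :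
    0 ≤ ∑ i, popWeight μ e (s i) * gridThr N f (s i).feat :=
  Finset.sum_nonneg fun _ _ => mul_nonneg (popWeight_mem hμ e _).1 (gridThr_mem hN (hf _)).1

lemma sum_popWeight_mul_gridThr_le (hN : 0 < N) (hμ : ∀ x, μ x ∈ Set.Icc (0 : ℝ) 1)
    (e : GroupEvent) (s : Fin n → Unit4 𝒳) (hf : ∀ x, f x ∈ Set.Icc (0 : ℝ) 1) :
    ∑ i, popWeight μ e (s i) * gridThr N f (s i).feat ≤ ∑ i, popWeight μ e (s i) :=
  Finset.sum_le_sum fun _ _ =>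
    mul_le_of_le_one_right (popWeight_mem hμ e _).1 (gridThr_mem hN (hf _)).2

lemma groupMean_mem (hN : 0 < N) (hμ : ∀ x, μ x ∈ Set.Icc (0 : ℝ) 1) (e : GroupEvent)
    (s : Fin n → Unit4 𝒳) (hf : ∀ x, f x ∈ Set.Icc (0 : ℝ) 1) :
    groupMean e N μ s f ∈ Set.Icc (0 : ℝ) 1 := by
  have hnonneg := sum_popWeight_mul_gridThr_nonneg hN hμ e s hf
  have hle := sum_popWeight_mul_gridThr_le hN hμ e s hf
  exact ⟨div_nonneg hnonneg (hnonneg.trans hle), div_le_one_of_le₀ hle (hnonneg.trans hle)⟩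

lemma empDisparity_mem (hN : 0 < N) (hμ : ∀ x, μ x ∈ Set.Icc (0 : ℝ) 1) (β : Fin 2 → ℝ)
    (ev : Fin 2 → GroupEvent) (s : Fin n → Unit4 𝒳) (hf : ∀ x, f x ∈ Set.Icc (0 : ℝ) 1) :
    empDisparity β ev N (oracleData μ s) f ∈
      Set.Icc (min (β 0) 0 + min (β 1) 0) (min (β 0) 0 + min (β 1) 0 + (|β 0| + |β 1|)) := by
  obtain ⟨hlow₀, hup₀⟩ := mul_mem_Icc_min_zero (groupMean_mem hN hμ (ev 0) s hf) (β 0)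
  obtain ⟨hlow₁, hup₁⟩ := mul_mem_Icc_min_zero (groupMean_mem hN hμ (ev 1) s hf) (β 1)
  rw [empDisparity_eq]
  constructor <;> linarith

end EmpiricalDisparity

section Termination

variable {𝒳 : Type*} {n N : ℕ} {T : Finset ℝ} {μ : 𝒳 → ℝ} {l : ℝ → ℝ → ℝ} {F : Set (𝒳 → ℝ)}
  {β : Fin 2 → ℝ} {ev : Fin 2 → GroupEvent} {φ ε C' C'' B ν : ℝ} {s : Fin n → Unit4 𝒳}

/-- The slack by which the algorithm relaxes the constraint `ε - ĉ₀` on the empirical cost. -/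
noncomputable def toleranceMargin (C' C'' φ : ℝ) (n : ℕ) : ℝ :=
  C' * (n : ℝ) ^ (-φ) + C'' * (n : ℝ) ^ (-(1 / 2) : ℝ)

lemma egInput_tol :
    (egInput F β ev l N T φ ε C' C'' B ν (oracleData μ s)).tol =
      ε - empConst l N T (oracleData μ s) + toleranceMargin C' C'' φ n :=
  add_assoc _ _ _

lemma abs_empCost_sub_tol_le (hl : IsLoss l) (hN : 0 < N) (hT : IsHalfCover N T)
    (hμ : ∀ x, μ x ∈ Set.Icc (0 : ℝ) 1) {f : 𝒳 → ℝ} (hf : ∀ x, f x ∈ Set.Icc (0 : ℝ) 1)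
    (hε : 0 ≤ ε) (hmargin : 0 ≤ toleranceMargin C' C'' φ n) :
    |empCost l N T (oracleData μ s) f -
        (egInput F β ev l N T φ ε C' C'' B ν (oracleData μ s)).tol| ≤
      2 + ε + toleranceMargin C' C'' φ n := by
  obtain ⟨hlow, hup⟩ := abs_le.1 (abs_empCost_le hl hN hT hμ hf s)
  obtain ⟨hconst0, hconst1⟩ := empConst_mem hl hN hT hμ s
  rw [egInput_tol, abs_le]
  constructor <;> linarith

theorem egInput_exists_stopsAt (hl : IsLoss l) (hμ : ∀ x, μ x ∈ Set.Icc (0 : ℝ) 1)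
    (hF : F.Nonempty) (hFm : ∀ f ∈ F, ∀ x, f x ∈ Set.Icc (0 : ℝ) 1) (hN : 0 < N)
    (hT : IsHalfCover N T) (hε : 0 ≤ ε) (hmargin : 0 ≤ toleranceMargin C' C'' φ n) (hB : 0 < B)
    (hν : 0 < ν) {best : ℝ → F}
    (hbest : (egInput F β ev l N T φ ε C' C'' B ν (oracleData μ s)).IsBestResponse best) :
    ∃ t : ℕ, (egInput F β ev l N T φ ε C' C'' B ν (oracleData μ s)).StopsAt best t ∧
      (t : ℝ) + 1 ≤ 4 * (2 + ε + toleranceMargin C' C'' φ n) ^ 2 * B ^ 2 / ν ^ 2 + 2 := by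
  set I := egInput F β ev l N T φ ε C' C'' B ν (oracleData μ s)
  have : Nonempty F := hF.to_subtype
  have hle (f : F) : |I.cost f - I.tol| ≤ 2 + ε + toleranceMargin C' C'' φ n :=
    abs_empCost_sub_tol_le hl hN hT hμ (hFm f f.2) hε hmargin
  have hbdd : BddAbove (Set.range fun f : F => |I.cost f - I.tol|) :=
    ⟨_, Set.forall_mem_range.2 hle⟩
  obtain ⟨t, hstops, ht⟩ := I.exists_stopsAt hbest hB hν
    (Real.iSup_nonneg fun f => abs_nonneg _) (le_ciSup hbdd) rfl
  have hsup : ⨆ f : F, |I.cost f - I.tol| ≤ 2 + ε + toleranceMargin C' C'' φ n := ciSup_le hle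
  have hsup0 : 0 ≤ ⨆ f : F, |I.cost f - I.tol| := Real.iSup_nonneg fun f => abs_nonneg _
  refine ⟨t, hstops, ht.trans ?_⟩
  change 4 * (⨆ f : F, |I.cost f - I.tol|) ^ 2 * B ^ 2 / ν ^ 2 + 2 ≤ _
  gcongr

end Termination

section Guarantee

variable {𝒳 : Type*} [MeasurableSpace 𝒳] {P : Measure (Unit4 𝒳)} [IsProbabilityMeasure P]
  {n N : ℕ} {T : Finset ℝ} {μ f : 𝒳 → ℝ} {l : ℝ → ℝ → ℝ} {F : Set (𝒳 → ℝ)} {β : Fin 2 → ℝ}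
  {ev : Fin 2 → GroupEvent} {r₁ r₂ p : ℝ} {s : Fin n → Unit4 𝒳}

lemma IsOutcomeRegression.integral_cond_toSet (hμ : IsOutcomeRegression P μ) {e : GroupEvent}
    (he : e.IsIdentified P) {b : ℝ} (hfm : Measurable f) (hf : ∀ x, |f x| ≤ b) :
    ∫ o, f o.feat ∂(P[|e.toSet]) =
      (∫ o, popWeight μ e o * f o.feat ∂P) / ∫ o, popWeight μ e o ∂P := by
  rw [integral_cond_eq, hμ.integral_popWeight_mul he hfm hf, hμ.integral_popWeight he,
    div_eq_inv_mul]

lemma GoodSample.abs_groupMean_sub_le (hs : GoodSample P μ l F ev N T r₁ r₂ s)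
    (hμ : IsOutcomeRegression P μ) (hF : IsPredictionClass P F) (hn : 0 < n) (hN : 0 < N)
    {a : Fin 2} (ha : (ev a).IsIdentified P) (hp : 0 < p) (hpa : p ≤ P.real (ev a).toSet)
    (hf : f ∈ F) :
    |groupMean (ev a) N μ s f - ∫ o, f o.feat ∂(P[|(ev a).toSet])| ≤ (2 * r₂ + 1 / N) / p := by
  have hnpos : (0 : ℝ) < n := mod_cast hn
  have hf01 := hF.mem f hf
  have hfm := hF.measurable f hf
  have hnonneg := sum_popWeight_mul_gridThr_nonneg hN hμ.reg_mem (ev a) s hf01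
  have hle := sum_popWeight_mul_gridThr_le hN hμ.reg_mem (ev a) s hf01
  have hnum := (abs_sub_le _ _ _).trans (add_le_add (hs.num a f hf)
    (abs_integral_popWeight_mul_gridThr_sub_le hN hμ (ev a) hfm hf01))
  rw [hμ.integral_cond_toSet ha hfm fun x => abs_le.2 ⟨by linarith [(hf01 x).1], (hf01 x).2⟩,
    groupMean, ← div_div_div_cancel_right₀ hnpos.ne', two_mul, add_right_comm]
  exact abs_div_sub_div_le (div_nonneg hnonneg hnpos.le) (div_le_div_of_nonneg_right hle hnpos.le)
    hp (hpa.trans_eq (hμ.integral_popWeight ha).symm) hnum (hs.den a)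

lemma GoodSample.abs_empDisparity_sub_le (hs : GoodSample P μ l F ev N T r₁ r₂ s)
    (hμ : IsOutcomeRegression P μ) (hF : IsPredictionClass P F) (hn : 0 < n) (hN : 0 < N)
    (hev : ∀ a, (ev a).IsIdentified P) (hp : 0 < p)
    (hpos : ∀ a, β a ≠ 0 → p ≤ P.real (ev a).toSet) (hf : f ∈ F) :
    |empDisparity β ev N (oracleData μ s) f - disparity P β ev f| ≤
      (|β 0| + |β 1|) * ((2 * r₂ + 1 / N) / p) := by
  have hterm (a : Fin 2) :
      |β a * groupMean (ev a) N μ s f - β a * ∫ o, f o.feat ∂(P[|(ev a).toSet])| ≤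
        |β a| * ((2 * r₂ + 1 / N) / p) := by
    rw [← mul_sub, abs_mul]
    by_cases hβ : β a = 0
    · simp [hβ]
    · exact mul_le_mul_of_nonneg_left
        (hs.abs_groupMean_sub_le hμ hF hn hN (hev a) hp (hpos a hβ) hf) (abs_nonneg _)
  rw [empDisparity_eq, disparity, Fin.sum_univ_two, add_sub_add_comm, add_mul]
  exact (abs_add_le _ _).trans (add_le_add (hterm 0) (hterm 1))

lemma GoodSample.empCost_le (hs : GoodSample P μ l F ev N T r₁ r₂ s) (hl : IsLoss l)
    (hμ : IsOutcomeRegression P μ) (hF : IsPredictionClass P F) (hN : 0 < N)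
    (hT : IsHalfCover N T) (hf : f ∈ F) :
    empCost l N T (oracleData μ s) f ≤
      lossReg P μ l f + (r₁ + 1 / N - empConst l N T (oracleData μ s)) := by
  linarith [empCost_add_empConst (l := l) (T := T) (μ := μ) hN (hF.mem f hf) s, hs.loss_upper f hf,
    (abs_le.1 (abs_integral_roundLoss_sub_le hl hN hT hμ (hF.measurable f hf) (hF.mem f hf))).2]

lemma GoodSample.lossReg_le (hs : GoodSample P μ l F ev N T r₁ r₂ s) (hl : IsLoss l)
    (hμ : IsOutcomeRegression P μ) (hF : IsPredictionClass P F) (hN : 0 < N)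
    (hT : IsHalfCover N T) (hf : f ∈ F) :
    lossReg P μ l f ≤ empCost l N T (oracleData μ s) f +
      (empConst l N T (oracleData μ s) + (r₂ + 1 / N)) := by
  linarith [empCost_add_empConst (l := l) (T := T) (μ := μ) hN (hF.mem f hf) s, hs.loss_lower f hf,
    (abs_le.1 (abs_integral_roundLoss_sub_le hl hN hT hμ (hF.measurable f hf) (hF.mem f hf))).1]

lemma abs_lossReg_le (hl : IsLoss l) (hμ : IsOutcomeRegression P μ)
    (hf : ∀ x, f x ∈ Set.Icc (0 : ℝ) 1) : |lossReg P μ l f| ≤ 1 :=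
  hl.abs_integral_comp_le (.of_forall fun _ => hμ.reg_mem _) fun _ => hf _

theorem GoodSample.guarantee (hs : GoodSample P μ l F ev N T r₁ r₂ s) (hl : IsLoss l)
    (hμ : IsOutcomeRegression P μ) (hF : IsPredictionClass P F) (hn : 0 < n) (hN : 0 < N)
    (hT : IsHalfCover N T) (hev : ∀ a, (ev a).IsIdentified P) (hp : 0 < p)
    (hpos : ∀ a, β a ≠ 0 → p ≤ P.real (ev a).toSet) {φ ε C' C'' B ν : ℝ} (hB : 0 < B)
    (hr₁ : r₁ + 1 / N ≤ toleranceMargin C' C'' φ n) {best : ℝ → F} {t : ℕ}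
    (hbest : (egInput F β ev l N T φ ε C' C'' B ν (oracleData μ s)).IsBestResponse best)
    (hstops : (egInput F β ev l N T φ ε C' C'' B ν (oracleData μ s)).StopsAt best t) :
    (∃ Qhat : PMF F,
      (egInput F β ev l N T φ ε C' C'' B ν (oracleData μ s)).returned best t = some Qhat ∧
      avg Qhat (fun f => lossReg P μ l f) ≤ ε + (toleranceMargin C' C'' φ n +
        (|β 0| + |β 1| + 2 * ν) / B + (r₂ + 1 / N)) ∧
      ∀ Q : PMF F, avg Q (fun f => lossReg P μ l f) ≤ ε →
        avg Qhat (fun f => disparity P β ev f) ≤ avg Q (fun f => disparity P β ev f) +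
          (2 * ν + 2 * ((|β 0| + |β 1|) * ((2 * r₂ + 1 / N) / p)))) ∨
    ((egInput F β ev l N T φ ε C' C'' B ν (oracleData μ s)).returned best t = none ∧
      ¬ ∃ Q : PMF F, avg Q (fun f => lossReg P μ l f) ≤ ε) := by
  set I := egInput F β ev l N T φ ε C' C'' B ν (oracleData μ s)
  have htol : I.tol = ε - empConst l N T (oracleData μ s) + toleranceMargin C' C'' φ n :=
    egInput_tol
  have hupper (f : F) : I.cost f ≤ lossReg P μ l f + (I.tol - ε) :=
    (hs.empCost_le hl hμ hF hN hT f.2).trans (by linarith)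
  refine (I.returned_spec hbest hB hstops
    (fun f => empDisparity_mem hN hμ.reg_mem β ev s (hF.mem f f.2))
    (fun f => abs_empCost_le hl hN hT hμ.reg_mem (hF.mem f f.2) s)
    (fun f => abs_lossReg_le hl hμ (hF.mem f f.2))
    (fun f => hs.abs_empDisparity_sub_le hμ hF hn hN hev hp hpos f.2) hupper
    (fun f => hs.lossReg_le hl hμ hF hN hT f.2)).imp_left ?_
  rintro ⟨Qhat, hret, hloss, hdisp⟩
  refine ⟨Qhat, hret, hloss.trans (le_of_eq ?_), hdisp⟩
  rw [htol]
  change ε - _ + _ + (|β 0| + |β 1| + 2 * ν) / B + _ = _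
  ring

end Guarantee

/-! ### The tolerance margin -/

section Rates

variable {φ C C' C'' M cN CN δ : ℝ} {n N : ℕ}

lemma neg_log_div_eq {c : ℝ} (hδ : δ ≠ 0) (hc : c ≠ 0) :
    -Real.log (δ / c) = Real.log c + Real.log (1 / δ) := by
  rw [Real.log_div hδ hc, one_div, Real.log_inv]
  ring

lemma log_sixteen_le : Real.log 16 ≤ 3 := by
  rw [show (16 : ℝ) = 2 ^ 4 by norm_num, Real.log_pow]
  push_cast
  linarith [Real.log_two_lt_d9]

lemma log_eight_le : Real.log 8 ≤ 3 :=
  (Real.log_le_log (by norm_num) (by norm_num)).trans log_sixteen_le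

lemma one_le_one_add_log_one_div (hδ0 : 0 < δ) (hδ1 : δ ≤ 1) : 1 ≤ 1 + Real.log (1 / δ) := by
  linarith [Real.log_nonneg ((one_le_div hδ0).2 hδ1)]

lemma rpow_neg_half_le (hφ : φ ≤ 1 / 2) (hn : 0 < n) :
    (n : ℝ) ^ (-(1 / 2) : ℝ) ≤ (n : ℝ) ^ (-φ) :=
  Real.rpow_le_rpow_of_exponent_le (by exact_mod_cast hn) (by linarith)

lemma rpow_neg_le_one (hφ : 0 ≤ φ) (hn : 0 < n) : (n : ℝ) ^ (-φ) ≤ 1 :=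
  Real.rpow_le_one_of_one_le_of_nonpos (by exact_mod_cast hn) (by linarith)

lemma sqrt_div_natCast (L : ℝ) : √(L / n) = √L * (n : ℝ) ^ (-(1 / 2) : ℝ) := by
  rw [Real.sqrt_div' _ (Nat.cast_nonneg n), Real.rpow_neg (Nat.cast_nonneg n),
    ← Real.sqrt_eq_rpow, div_eq_mul_inv]

lemma one_div_le_of_mul_rpow_le (hcN : 0 < cN) (hn : 0 < n) (h : cN * (n : ℝ) ^ φ ≤ N) :
    1 / (N : ℝ) ≤ 1 / cN * (n : ℝ) ^ (-φ) := by
  rw [Real.rpow_neg n.cast_nonneg, ← one_div, one_div_mul_one_div]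
  exact one_div_le_one_div_of_le (by positivity) h

lemma eventually_one_div_le {κ : ℝ} (hφ : 0 ≤ φ) (hcN : 0 < cN) (hκ : 0 < κ) :
    ∀ᶠ n : ℕ in Filter.atTop, ∀ N : ℕ, 0 < N → cN * (n : ℝ) ^ φ ≤ N →
      1 / (N : ℝ) ≤ (1 + κ * √(Real.log N)) * (n : ℝ) ^ (-φ) := by
  rcases hφ.eq_or_lt with rfl | hφ
  · refine .of_forall fun n N hN _ => ?_
    have hN1 : 1 / (N : ℝ) ≤ 1 := (div_le_one (by positivity)).2 (by exact_mod_cast hN)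
    rw [neg_zero, Real.rpow_zero, mul_one]
    exact hN1.trans (le_add_of_nonneg_right (by positivity))
  · have htend : Filter.Tendsto (fun n : ℕ => cN * (n : ℝ) ^ φ) Filter.atTop Filter.atTop :=
      ((tendsto_rpow_atTop hφ).comp tendsto_natCast_atTop_atTop).const_mul_atTop hcN
    filter_upwards [htend.eventually_ge_atTop (Real.exp ((1 / cN / κ) ^ 2)),
      Filter.eventually_gt_atTop 0] with n hlarge hn N hN hNlo
    have hlog : (1 / cN / κ) ^ 2 ≤ Real.log N :=
      (Real.le_log_iff_exp_le (by positivity)).2 (hlarge.trans hNlo)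
    have hsqrt : 1 / cN ≤ κ * √(Real.log N) :=
      (div_le_iff₀' hκ).1 (Real.le_sqrt_of_sq_le hlog)
    refine (one_div_le_of_mul_rpow_le hcN hn hNlo).trans ?_
    gcongr
    linarith

lemma eventually_deviationRadius_add_le_toleranceMargin (hφ0 : 0 ≤ φ) (hφ : φ ≤ 1 / 2)
    (hcN : 0 < cN) :
    ∀ᶠ n : ℕ in Filter.atTop, ∀ (N : ℕ) (δ C' C'' : ℝ), 0 < N → cN * (n : ℝ) ^ φ ≤ N →
      0 < δ → δ ≤ 1 → 2 * C + 2 + √(2 * Real.log (8 * N / δ)) ≤ C' →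
      √(-Real.log (δ / 8) / 2) ≤ C'' →
      deviationRadius (C * (n : ℝ) ^ (-φ)) n (δ / 8) + 1 / N ≤ toleranceMargin C' C'' φ n := by
  filter_upwards [eventually_one_div_le hφ0 hcN (κ := 1 / 20) (by norm_num),
    Filter.eventually_gt_atTop 0] with n hdisc hn N δ C' C'' hN hNlo hδ0 hδ1 hC' hC''
  have hN1 : (1 : ℝ) ≤ N := by exact_mod_cast hN
  have hL : -Real.log (δ / 8) = Real.log (8 / δ) := by rw [← Real.log_inv, inv_div]
  rw [deviationRadius, toleranceMargin, sqrt_div_natCast]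
  rw [hL] at hC'' ⊢
  set a := (n : ℝ) ^ (-φ)
  set h := (n : ℝ) ^ (-(1 / 2) : ℝ)
  set q := √(Real.log (8 * N / δ))
  set r := √(Real.log (8 / δ))
  have hrq : r ≤ q := Real.sqrt_le_sqrt (Real.log_le_log (by positivity) (by gcongr; linarith))
  have hNq : √(Real.log N) ≤ q := by
    refine Real.sqrt_le_sqrt (Real.log_le_log (by positivity) ?_)
    rw [le_div_iff₀ hδ0]
    nlinarith
  have hC'q : 2 * C + 2 + 1.414 * q ≤ C' := by
    refine le_trans ?_ hC'
    rw [Real.sqrt_mul zero_le_two]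
    gcongr
    exact Real.le_sqrt_of_sq_le (by norm_num)
  have hC''r : 0.7 * r ≤ C'' := by
    refine le_trans ?_ hC''
    rw [div_eq_mul_one_div, Real.sqrt_mul' _ (by norm_num), mul_comm]
    gcongr
    exact Real.le_sqrt_of_sq_le (by norm_num)
  have hrh : r * h ≤ q * a := by gcongr; exact rpow_neg_half_le hφ hn
  have ha0 : 0 ≤ a := by positivity
  have hqa : 0 ≤ q * a := by positivity
  have hN' : 1 / (N : ℝ) ≤ (1 + 1 / 20 * q) * a := (hdisc N hN hNlo).trans (by gcongr)
  have hC'a := mul_le_mul_of_nonneg_right hC'q ha0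
  have hC''h := mul_le_mul_of_nonneg_right hC''r (show 0 ≤ h by positivity)
  linarith

lemma toleranceMargin_le {x y s w : ℝ} (hC : 0 ≤ C) (hM : 0 ≤ M)
    (hC' : C' ≤ M * (2 * C + 2 + x)) (hC'' : C'' ≤ M * y) (hw : (n : ℝ) ^ (-φ) ≤ w)
    (hx : x * (n : ℝ) ^ (-φ) ≤ s * w) (hy : y * (n : ℝ) ^ (-(1 / 2) : ℝ) ≤ 2 * w) :
    toleranceMargin C' C'' φ n ≤ M * (2 * C + 4 + s) * w := by
  set a := (n : ℝ) ^ (-φ)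
  set h := (n : ℝ) ^ (-(1 / 2) : ℝ)
  calc C' * a + C'' * h ≤ M * (2 * C + 2 + x) * a + M * y * h := by gcongr
    _ = M * ((2 * C + 2) * a + x * a + y * h) := by ring
    _ ≤ M * ((2 * C + 2) * w + s * w + 2 * w) := by gcongr
    _ = M * (2 * C + 4 + s) * w := by ring

lemma pos_of_le_mul_rpow (hN : 0 < N) (hNhi : N ≤ CN * (n : ℝ) ^ φ) : 0 < CN :=
  pos_of_mul_pos_left ((Nat.cast_pos.2 hN).trans_le hNhi) (by positivity)

lemma log_eight_mul_div_eq (hN : 0 < N) (hδ : 0 < δ) :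
    Real.log (8 * N / δ) = Real.log 8 + Real.log N + Real.log (1 / δ) := by
  rw [div_eq_mul_one_div, Real.log_mul (by positivity) (by positivity),
    Real.log_mul (by norm_num) (by positivity)]

lemma log_le_add_log (hφ : φ ≤ 1) (hn : 0 < n) (hN : 0 < N) (hNhi : N ≤ CN * (n : ℝ) ^ φ) :
    Real.log N ≤ CN + Real.log n := by
  have hCN := pos_of_le_mul_rpow hN hNhi
  calc Real.log N ≤ Real.log (CN * (n : ℝ) ^ φ) := Real.log_le_log (by positivity) hNhi
    _ = Real.log CN + φ * Real.log n := by
      rw [Real.log_mul hCN.ne' (by positivity), Real.log_rpow (by positivity)]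
    _ ≤ CN + Real.log n := add_le_add (Real.log_le_self hCN.le)
      (mul_le_of_le_one_left (Real.log_natCast_nonneg n) hφ)

lemma log_mul_rpow_neg_sq_le (hφ : 0 ≤ φ) (hn : 0 < n) (hN : 0 < N)
    (hNhi : N ≤ CN * (n : ℝ) ^ φ) : Real.log N * ((n : ℝ) ^ (-φ)) ^ 2 ≤ CN := by
  have hcancel : (n : ℝ) ^ φ * (n : ℝ) ^ (-φ) = 1 := by
    rw [← Real.rpow_add (by positivity), add_neg_cancel, Real.rpow_zero]
  calc Real.log N * ((n : ℝ) ^ (-φ)) ^ 2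
      ≤ CN * (n : ℝ) ^ φ * ((n : ℝ) ^ (-φ)) ^ 2 := by
        gcongr
        exact (Real.log_le_self N.cast_nonneg).trans hNhi
    _ = CN * (n : ℝ) ^ (-φ) * ((n : ℝ) ^ φ * (n : ℝ) ^ (-φ)) := by ring
    _ ≤ CN := by
        rw [hcancel, mul_one]
        exact mul_le_of_le_one_right (pos_of_le_mul_rpow hN hNhi).le (rpow_neg_le_one hφ hn)

lemma sqrt_neg_log_div_eight_le (hδ0 : 0 < δ) (hδ1 : δ ≤ 1) :
    √(-Real.log (δ / 8) / 2) ≤ 2 * √(1 + Real.log (1 / δ)) := by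
  have hΛ := one_le_one_add_log_one_div hδ0 hδ1
  refine Real.sqrt_le_iff.2 ⟨by positivity, ?_⟩
  rw [mul_pow, Real.sq_sqrt (by positivity), neg_log_div_eq hδ0.ne' (by norm_num)]
  linarith [log_eight_le]

/-- The factor that bounds the tolerance margin, both relative to `√(1 + ln(1/δ))` and relative
to `(1 + ln n + ln(1/δ)) n^{-φ}`. -/
noncomputable def marginConst (C M CN : ℝ) : ℝ := M * (2 * C + 4 + √(2 * (3 + CN)))

lemma toleranceMargin_le_sqrt (hφ0 : 0 ≤ φ) (hφ : φ ≤ 1 / 2) (hC : 0 ≤ C) (hM : 0 ≤ M) (hn : 0 < n)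
    (hN : 0 < N) (hNhi : N ≤ CN * (n : ℝ) ^ φ) (hδ0 : 0 < δ) (hδ1 : δ ≤ 1)
    (hC' : C' ≤ M * (2 * C + 2 + √(2 * Real.log (8 * N / δ))))
    (hC'' : C'' ≤ M * √(-Real.log (δ / 8) / 2)) :
    toleranceMargin C' C'' φ n ≤ marginConst C M CN * √(1 + Real.log (1 / δ)) := by
  have hΛ := one_le_one_add_log_one_div hδ0 hδ1
  have ha1 := rpow_neg_le_one hφ0 hn
  have hCN := pos_of_le_mul_rpow hN hNhi
  refine toleranceMargin_le hC hM hC' hC'' (ha1.trans (Real.one_le_sqrt.2 hΛ)) ?_ <|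
    (mul_le_of_le_one_right (by positivity) ((rpow_neg_half_le hφ hn).trans ha1)).trans
      (sqrt_neg_log_div_eight_le hδ0 hδ1)
  rw [← Real.sqrt_mul (by positivity)]
  refine Real.le_sqrt_of_sq_le ?_
  have hlog0 : 0 ≤ Real.log (8 * N / δ) := by
    rw [log_eight_mul_div_eq hN hδ0]
    linarith [Real.log_nonneg (show (1 : ℝ) ≤ 8 by norm_num), Real.log_natCast_nonneg N]
  rw [mul_pow, Real.sq_sqrt (by positivity), log_eight_mul_div_eq hN hδ0]
  have hlogN := log_mul_rpow_neg_sq_le hφ0 hn hN hNhi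
  have hrest : (Real.log 8 + Real.log (1 / δ)) * ((n : ℝ) ^ (-φ)) ^ 2 ≤ 3 + Real.log (1 / δ) := by
    refine (mul_le_of_le_one_right ?_ (pow_le_one₀ (by positivity) ha1)).trans
      (add_le_add_left log_eight_le _)
    linarith [Real.log_nonneg (show (1 : ℝ) ≤ 8 by norm_num)]
  nlinarith

lemma toleranceMargin_le_polylog (hφ : φ ≤ 1 / 2) (hC : 0 ≤ C) (hM : 0 ≤ M) (hn : 0 < n)
    (hN : 0 < N) (hNhi : N ≤ CN * (n : ℝ) ^ φ) (hδ0 : 0 < δ) (hδ1 : δ ≤ 1)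
    (hC' : C' ≤ M * (2 * C + 2 + √(2 * Real.log (8 * N / δ))))
    (hC'' : C'' ≤ M * √(-Real.log (δ / 8) / 2)) :
    toleranceMargin C' C'' φ n ≤ polylog (marginConst C M CN) 1 n δ * (n : ℝ) ^ (-φ) := by
  have hΛ := one_le_one_add_log_one_div hδ0 hδ1
  have hlogn := Real.log_natCast_nonneg n
  have hCN := pos_of_le_mul_rpow hN hNhi
  rw [polylog, pow_one, mul_assoc]
  set W := 1 + Real.log n + Real.log (1 / δ)
  have hW : 1 ≤ W := by linarith
  refine toleranceMargin_le hC hM hC' hC'' (le_mul_of_one_le_left (by positivity) hW) ?_ ?_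
  · rw [← mul_assoc]
    gcongr
    refine Real.sqrt_le_iff.2 ⟨by positivity, ?_⟩
    rw [mul_pow, Real.sq_sqrt (by positivity), log_eight_mul_div_eq hN hδ0]
    have hlogN := log_le_add_log (by linarith) hn hN hNhi
    calc 2 * (Real.log 8 + Real.log N + Real.log (1 / δ)) ≤ 2 * (3 + CN) * W := by
          nlinarith [log_eight_le]
      _ ≤ 2 * (3 + CN) * W ^ 2 := by
          gcongr
          exact le_self_pow₀ hW two_ne_zero
  · rw [← mul_assoc]
    have hsqrt : √(1 + Real.log (1 / δ)) ≤ W :=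
      Real.sqrt_le_iff.2 ⟨by positivity, by nlinarith⟩
    exact mul_le_mul ((sqrt_neg_log_div_eight_le hδ0 hδ1).trans (by gcongr))
      (rpow_neg_half_le hφ hn) (by positivity) (by positivity)

/-! ### Rates of the guarantees -/

lemma deviationRadius_le_polylog (hφ : φ ≤ 1 / 2) (hC : 0 ≤ C) (hn : 0 < n) (hδ0 : 0 < δ)
    (hδ1 : δ ≤ 1) :
    deviationRadius (C * (n : ℝ) ^ (-φ)) n (δ / 16)
      ≤ polylog (2 * C + 4) 1 n δ * (n : ℝ) ^ (-φ) := by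
  have hΛ := one_le_one_add_log_one_div hδ0 hδ1
  have hlogn := Real.log_natCast_nonneg n
  rw [deviationRadius, polylog, pow_one, neg_log_div_eq hδ0.ne' (by norm_num), sqrt_div_natCast]
  set W := 1 + Real.log n + Real.log (1 / δ)
  have hW : 1 ≤ W := by linarith
  have hsqrt : √(Real.log 16 + Real.log (1 / δ)) ≤ 2 * W :=
    Real.sqrt_le_iff.2 ⟨by positivity, by nlinarith [log_sixteen_le]⟩
  have hhalf := rpow_neg_half_le hφ hn
  calc 2 * (C * (n : ℝ) ^ (-φ))
        + 2 * (√(Real.log 16 + Real.log (1 / δ)) * (n : ℝ) ^ (-(1 / 2) : ℝ))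
      ≤ 2 * (C * (W * (n : ℝ) ^ (-φ))) + 2 * (2 * W * (n : ℝ) ^ (-φ)) := by
        gcongr
        exact le_mul_of_one_le_left (by positivity) hW
    _ = (2 * C + 4) * W * (n : ℝ) ^ (-φ) := by ring

lemma le_polylog_mul {K x : ℝ} (hK : 0 ≤ K) (hx : 0 ≤ x) (hδ0 : 0 < δ) (hδ1 : δ ≤ 1) :
    K * x ≤ polylog K 1 n δ * x := by
  rw [polylog, pow_one]
  gcongr
  exact le_mul_of_one_le_right hK
    (by linarith [one_le_one_add_log_one_div hδ0 hδ1, Real.log_natCast_nonneg n])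

lemma polylog_nonneg {K : ℝ} (hK : 0 ≤ K) (hδ0 : 0 < δ) (hδ1 : δ ≤ 1) : 0 ≤ polylog K 1 n δ := by
  have hlogn := Real.log_natCast_nonneg n
  have hΛ := one_le_one_add_log_one_div hδ0 hδ1
  exact mul_nonneg hK (pow_nonneg (by linarith) 1)

lemma polylog_mono {K K' : ℝ} (h : K ≤ K') (hδ0 : 0 < δ) (hδ1 : δ ≤ 1) :
    polylog K 1 n δ ≤ polylog K' 1 n δ := by
  rw [polylog, polylog, pow_one]
  gcongr
  linarith [one_le_one_add_log_one_div hδ0 hδ1, Real.log_natCast_nonneg n]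

/-- The factor `K` in the bound `K (1 + ln(1/δ)) n^(4 φ)` on the number of iterations, when the
tolerance margin is at most `S √(1 + ln(1/δ))`. -/
noncomputable def iterationConst (S ε cν cB : ℝ) : ℝ :=
  4 * (2 + ε + S) ^ 2 * (cB / cν) ^ 2 + 2

lemma iterations_le {S ε cν cB τ : ℝ} (hφ : 0 ≤ φ) (hn : 0 < n) (hδ0 : 0 < δ) (hδ1 : δ ≤ 1)
    (hε : 0 ≤ ε) (hτ0 : 0 ≤ τ) (hτ : τ ≤ S * √(1 + Real.log (1 / δ))) :
    4 * (2 + ε + τ) ^ 2 * (cB * (n : ℝ) ^ φ) ^ 2 / (cν * (n : ℝ) ^ (-φ)) ^ 2 + 2 ≤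
      iterationConst S ε cν cB * (1 + Real.log (1 / δ)) * (n : ℝ) ^ (4 * φ) := by
  have hΛ := one_le_one_add_log_one_div hδ0 hδ1
  set Λ := 1 + Real.log (1 / δ)
  have hrange : (2 + ε + τ) ^ 2 ≤ (2 + ε + S) ^ 2 * Λ := by
    calc (2 + ε + τ) ^ 2 ≤ ((2 + ε + S) * √Λ) ^ 2 := by
          gcongr
          nlinarith [Real.one_le_sqrt.2 hΛ]
      _ = (2 + ε + S) ^ 2 * Λ := by rw [mul_pow, Real.sq_sqrt (by positivity)]
  have hpow : (n : ℝ) ^ (4 * φ) = ((n : ℝ) ^ φ) ^ 4 := by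
    rw [← Real.rpow_mul_natCast n.cast_nonneg, mul_comm]
    norm_num
  have hone : 1 ≤ ((n : ℝ) ^ φ) ^ 4 :=
    one_le_pow₀ (Real.one_le_rpow (by exact_mod_cast hn) hφ)
  calc 4 * (2 + ε + τ) ^ 2 * (cB * (n : ℝ) ^ φ) ^ 2 / (cν * (n : ℝ) ^ (-φ)) ^ 2 + 2
      = 4 * (2 + ε + τ) ^ 2 * (cB / cν) ^ 2 * ((n : ℝ) ^ φ) ^ 4 + 2 := by
        rw [Real.rpow_neg n.cast_nonneg]
        field_simp
    _ ≤ 4 * ((2 + ε + S) ^ 2 * Λ) * (cB / cν) ^ 2 * ((n : ℝ) ^ φ) ^ 4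
          + 2 * (Λ * ((n : ℝ) ^ φ) ^ 4) := by
        gcongr
        linarith [one_le_mul_of_one_le_of_one_le hΛ hone]
    _ = iterationConst S ε cν cB * Λ * (n : ℝ) ^ (4 * φ) := by
        rw [iterationConst, hpow]
        ring

/-- The factor `K` in the bound `K (1 + ln n + ln(1/δ)) n^{-φ}` on the excess loss; `b` bounds the
disparities, and `S` and `R` are the factors of the tolerance margin and the deviation radius. -/
noncomputable def lossConst (S R b cν cB cN : ℝ) : ℝ :=
  S + (b + 2 * cν) / cB + (R + 1 / cN)

lemma excess_loss_le {S R b cν cB τ r : ℝ} (hφ : 0 ≤ φ) (hn : 0 < n) (hδ0 : 0 < δ)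
    (hδ1 : δ ≤ 1) (hb : 0 ≤ b) (hcν : 0 ≤ cν) (hcB : 0 ≤ cB) (hcN : 0 < cN)
    (hNlo : cN * (n : ℝ) ^ φ ≤ N) (hτ : τ ≤ polylog S 1 n δ * (n : ℝ) ^ (-φ))
    (hr : r ≤ polylog R 1 n δ * (n : ℝ) ^ (-φ)) :
    τ + (b + 2 * (cν * (n : ℝ) ^ (-φ))) / (cB * (n : ℝ) ^ φ) + (r + 1 / N) ≤
      polylog (lossConst S R b cν cB cN) 1 n δ * (n : ℝ) ^ (-φ) := by
  have hdual : (b + 2 * (cν * (n : ℝ) ^ (-φ))) / (cB * (n : ℝ) ^ φ)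
      ≤ (b + 2 * cν) / cB * (n : ℝ) ^ (-φ) := by
    rw [Real.rpow_neg n.cast_nonneg φ, ← div_div, div_eq_mul_inv _ ((n : ℝ) ^ φ),
      ← Real.rpow_neg n.cast_nonneg]
    gcongr
    exact mul_le_of_le_one_right hcν (rpow_neg_le_one hφ hn)
  have hN := (one_div_le_of_mul_rpow_le hcN hn hNlo).trans
    (le_polylog_mul (n := n) (by positivity) (by positivity) hδ0 hδ1)
  have hdual' := hdual.trans (le_polylog_mul (n := n) (by positivity) (by positivity) hδ0 hδ1)
  simp only [polylog, lossConst, pow_one, add_mul] at hτ hr hN hdual' ⊢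
  linarith

/-- The factor `K` in the bound `K (1 + ln n + ln(1/δ)) n^{-φ}` on the excess disparity; `b` bounds
the disparities and `R` is the factor of the deviation radius. -/
noncomputable def disparityConst (R b p cν cN : ℝ) : ℝ :=
  2 * cν + 2 * (b * ((2 * R + 1 / cN) / p))

lemma excess_disparity_le {R b p cν r : ℝ} (hn : 0 < n) (hδ0 : 0 < δ) (hδ1 : δ ≤ 1)
    (hb : 0 ≤ b) (hp : 0 < p) (hcν : 0 ≤ cν) (hcN : 0 < cN) (hNlo : cN * (n : ℝ) ^ φ ≤ N)
    (hr : r ≤ polylog R 1 n δ * (n : ℝ) ^ (-φ)) :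
    2 * (cν * (n : ℝ) ^ (-φ)) + 2 * (b * ((2 * r + 1 / N) / p)) ≤
      polylog (disparityConst R b p cν cN) 1 n δ * (n : ℝ) ^ (-φ) := by
  have hN := (one_div_le_of_mul_rpow_le hcN hn hNlo).trans
    (le_polylog_mul (n := n) (by positivity) (by positivity) hδ0 hδ1)
  have hν := le_polylog_mul (n := n) hcν (by positivity : 0 ≤ (n : ℝ) ^ (-φ)) hδ0 hδ1
  calc _ ≤ 2 * (polylog cν 1 n δ * (n : ℝ) ^ (-φ)) + 2 * (b * ((2 * (polylog R 1 n δ *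
          (n : ℝ) ^ (-φ)) + polylog (1 / cN) 1 n δ * (n : ℝ) ^ (-φ)) / p)) := by gcongr
    _ = _ := by
        simp only [polylog, disparityConst, pow_one]
        ring

lemma rpow_neg_le_groupCount {𝒳 : Type*} (hφ : 0 ≤ φ) (hn : 0 < n) (e : GroupEvent)
    (s : Fin n → Unit4 𝒳) : (n : ℝ) ^ (-φ) ≤ (max (groupCount e s : ℝ) 1) ^ (-φ) := by
  refine Real.rpow_le_rpow_of_nonpos (by positivity) (max_le ?_ ?_) (by linarith)
  · exact_mod_cast (Finset.card_le_univ _).trans_eq (Fintype.card_fin n)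
  · exact_mod_cast hn

lemma mul_rpow_neg_le_groupCount_add {𝒳 : Type*} {K : ℝ} (hK : 0 ≤ K) (hφ : 0 ≤ φ) (hn : 0 < n)
    (ev : Fin 2 → GroupEvent) (s : Fin n → Unit4 𝒳) :
    K * (n : ℝ) ^ (-φ) ≤ K * (max (groupCount (ev 0) s : ℝ) 1) ^ (-φ) +
      K * (max (groupCount (ev 1) s : ℝ) 1) ^ (-φ) :=
  (mul_le_mul_of_nonneg_left (rpow_neg_le_groupCount hφ hn (ev 0) s) hK).trans
    (le_add_of_nonneg_right (by positivity))

end Rates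

section Algorithm

variable {𝒳 : Type*} {μ : 𝒳 → ℝ} {l : ℝ → ℝ → ℝ} {F : Set (𝒳 → ℝ)} {β : Fin 2 → ℝ}
  {ev : Fin 2 → GroupEvent} {n N : ℕ} {T : Finset ℝ} {s : Fin n → Unit4 𝒳}
  {C C' C'' M CN K φ ε δ p cν cB cN : ℝ}

theorem egInput_exists_stopsAt_le_rate (hl : IsLoss l) (hμ : ∀ x, μ x ∈ Set.Icc (0 : ℝ) 1)
    (hF : F.Nonempty) (hFm : ∀ f ∈ F, ∀ x, f x ∈ Set.Icc (0 : ℝ) 1) (hφ0 : 0 ≤ φ)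
    (hφ : φ ≤ 1 / 2) (hC : 0 ≤ C) (hM : 0 ≤ M) (hε : 0 ≤ ε) (hcν : 0 < cν) (hcB : 0 < cB)
    (hn : 0 < n) (hN : 0 < N) (hNhi : N ≤ CN * (n : ℝ) ^ φ) (hT : IsHalfCover N T)
    (hδ0 : 0 < δ) (hδ1 : δ ≤ 1)
    (hC'0 : 0 ≤ C') (hC' : C' ≤ M * (2 * C + 2 + √(2 * Real.log (8 * N / δ))))
    (hC''0 : 0 ≤ C'') (hC'' : C'' ≤ M * √(-Real.log (δ / 8) / 2))
    (hK : iterationConst (marginConst C M CN) ε cν cB ≤ K) {I : EGInput F}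
    (hI : I = egInput F β ev l N T φ ε C' C'' (cB * (n : ℝ) ^ φ) (cν * (n : ℝ) ^ (-φ))
      (oracleData μ s)) {best : ℝ → F} (hbest : I.IsBestResponse best) :
    ∃ t : ℕ, I.StopsAt best t ∧
      (t : ℝ) + 1 ≤ K * (1 + Real.log (1 / δ)) * (n : ℝ) ^ (4 * φ) := by
  subst hI
  have hmargin : 0 ≤ toleranceMargin C' C'' φ n := add_nonneg (by positivity) (by positivity)
  obtain ⟨t, hstops, ht⟩ := egInput_exists_stopsAt hl hμ hF hFm hN hT hε
    hmargin (by positivity) (by positivity) hbest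
  refine ⟨t, hstops, (ht.trans (iterations_le hφ0 hn hδ0 hδ1 hε hmargin
    (toleranceMargin_le_sqrt hφ0 hφ hC hM hn hN hNhi hδ0 hδ1 hC' hC''))).trans ?_⟩
  have hΛ := one_le_one_add_log_one_div hδ0 hδ1
  gcongr

variable [MeasurableSpace 𝒳] {P : Measure (Unit4 𝒳)} [IsProbabilityMeasure P]

lemma avg_lossReg_le_avg_loss (hl : IsLoss l) (hμ : IsOutcomeRegression P μ)
    (hF : IsPredictionClass P F)
    (hconv : ∀ u ∈ Set.Icc (0 : ℝ) 1, ConvexOn ℝ (Set.Icc (0 : ℝ) 1) fun y => l y u) (Q : PMF F) :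
    avg Q (fun f => lossReg P μ l f) ≤ avg Q (fun f => loss P l f) :=
  avg_mono (avgSummable_of_abs_le Q fun f => abs_lossReg_le hl hμ (hF.mem f f.2))
    (avgSummable_of_abs_le Q fun f =>
      hl.abs_integral_comp_le hμ.out_mem fun o => hF.mem f f.2 o.feat)
    fun f => lossReg_le_loss hl hμ hconv (hF.measurable f f.2) (hF.mem f f.2)

theorem GoodSample.guarantee_rate
    (hs : GoodSample P μ l F ev N T (deviationRadius (C * (n : ℝ) ^ (-φ)) n (δ / 8))
      (deviationRadius (C * (n : ℝ) ^ (-φ)) n (δ / 16)) s)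
    (hl : IsLoss l) (hμ : IsOutcomeRegression P μ) (hF : IsPredictionClass P F)
    (hφ0 : 0 ≤ φ) (hφ : φ ≤ 1 / 2) (hC : 0 ≤ C) (hM : 0 ≤ M) (hp : 0 < p) (hcν : 0 ≤ cν)
    (hcB : 0 < cB) (hcN : 0 < cN) (hn : 0 < n) (hN : 0 < N) (hNlo : cN * (n : ℝ) ^ φ ≤ N)
    (hNhi : N ≤ CN * (n : ℝ) ^ φ) (hT : IsHalfCover N T) (hδ0 : 0 < δ) (hδ1 : δ ≤ 1)
    (hev : ∀ a, (ev a).IsIdentified P) (hpos : ∀ a, β a ≠ 0 → p ≤ P.real (ev a).toSet)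
    (hC' : C' ≤ M * (2 * C + 2 + √(2 * Real.log (8 * N / δ))))
    (hC'' : C'' ≤ M * √(-Real.log (δ / 8) / 2))
    (hdev : deviationRadius (C * (n : ℝ) ^ (-φ)) n (δ / 8) + 1 / N ≤ toleranceMargin C' C'' φ n)
    (hK₁ : lossConst (marginConst C M CN) (2 * C + 4) (|β 0| + |β 1|) cν cB cN ≤ K)
    (hK₂ : disparityConst (2 * C + 4) (|β 0| + |β 1|) p cν cN ≤ K) {I : EGInput F}
    (hI : I = egInput F β ev l N T φ ε C' C'' (cB * (n : ℝ) ^ φ) (cν * (n : ℝ) ^ (-φ))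
      (oracleData μ s)) {best : ℝ → F} {t : ℕ} (hbest : I.IsBestResponse best)
    (hstops : I.StopsAt best t) :
    (∃ Qhat : PMF F, I.returned best t = some Qhat ∧
      avg Qhat (fun f => lossReg P μ l f) ≤ ε + polylog K 1 n δ * (n : ℝ) ^ (-φ) ∧
      ∀ Q : PMF F, avg Q (fun f => lossReg P μ l f) ≤ ε →
        avg Qhat (fun f => disparity P β ev f) ≤ avg Q (fun f => disparity P β ev f)
          + polylog K 1 n δ * (max (groupCount (ev 0) s : ℝ) 1) ^ (-φ)
          + polylog K 1 n δ * (max (groupCount (ev 1) s : ℝ) 1) ^ (-φ)) ∨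
    (I.returned best t = none ∧ ¬ ∃ Q : PMF F, avg Q (fun f => lossReg P μ l f) ≤ ε) := by
  subst hI
  have hb : 0 ≤ |β 0| + |β 1| := by positivity
  have hradius := deviationRadius_le_polylog hφ hC hn hδ0 hδ1
  have hloss := (excess_loss_le hφ0 hn hδ0 hδ1 hb hcν hcB.le hcN hNlo
    (toleranceMargin_le_polylog hφ hC hM hn hN hNhi hδ0 hδ1 hC' hC'') hradius).trans
    (mul_le_mul_of_nonneg_right (polylog_mono hK₁ hδ0 hδ1) (by positivity))
  have hK : 0 ≤ K := le_trans (by unfold disparityConst; positivity) hK₂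
  have hdisp := ((excess_disparity_le hn hδ0 hδ1 hb hp hcν hcN hNlo hradius).trans
    (mul_le_mul_of_nonneg_right (polylog_mono hK₂ hδ0 hδ1) (by positivity))).trans
    (mul_rpow_neg_le_groupCount_add (polylog_nonneg hK hδ0 hδ1) hφ0 hn ev s)
  refine (hs.guarantee hl hμ hF hn hN hT hev hp hpos (by positivity) hdev hbest hstops).imp_left ?_
  rintro ⟨Qhat, hret, hQloss, hQdisp⟩
  refine ⟨Qhat, hret, hQloss.trans (add_le_add_right hloss ε), fun Q hQ => ?_⟩
  linarith [hQdisp Q hQ]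

end Algorithm

theorem theorem2_general {𝒳 : Type*} [MeasurableSpace 𝒳]
    (β : Fin 2 → ℝ) (φ C M ε p cν cB cN CN : ℝ)
    (hφ0 : 0 ≤ φ) (hφ : φ ≤ 1 / 2) (hC : 0 ≤ C) (hM : 0 ≤ M) (hε : 0 ≤ ε) (hp : 0 < p)
    (hcν : 0 < cν) (hcB : 0 < cB) (hcN : 0 < cN) :
    ∃ (K : ℝ) (k n₀ : ℕ),
      ∀ (P : Measure (Unit4 𝒳)) [IsProbabilityMeasure P] (μ : 𝒳 → ℝ) (l : ℝ → ℝ → ℝ)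
        (F : Set (𝒳 → ℝ)) (ev : Fin 2 → GroupEvent),
        IsOutcomeRegression P μ → IsLoss l → IsPredictionClass P F →
        (∀ m : ℕ, 1 ≤ m → rademacher (thrClass F) m ≤ C * (m : ℝ) ^ (-φ)) →
        (∀ a, (ev a).IsIdentified P) →
        (∀ a, β a ≠ 0 → p ≤ P.real (ev a).toSet) →
        (∀ a, P (ev a).toSet ≠ 0 → ∀ f ∈ F,
          0 < ∫ o, (ev a).label.weight (μ o.feat) ∂(P[|(ev a).attrSet]) ∧
          ∫ o, f o.feat ∂(P[|(ev a).toSet]) =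
            (∫ o, f o.feat * (ev a).label.weight (μ o.feat) ∂(P[|(ev a).attrSet])) /
              ∫ o, (ev a).label.weight (μ o.feat) ∂(P[|(ev a).attrSet])) ∧
        ((∀ u ∈ Set.Icc (0 : ℝ) 1, ConvexOn ℝ (Set.Icc (0 : ℝ) 1) fun y => l y u) →
          ∀ Q : PMF F, avg Q (fun f => lossReg P μ l f) ≤ avg Q (fun f => loss P l f)) ∧
        ∀ (n N : ℕ) (T : Finset ℝ) (δ C' C'' : ℝ),
          1 ≤ n → 1 ≤ N → cN * (n : ℝ) ^ φ ≤ N → N ≤ CN * (n : ℝ) ^ φ → IsHalfCover N T →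
          0 < δ → δ < 1 →
          2 * C + 2 + √(2 * Real.log (8 * N / δ)) ≤ C' →
          C' ≤ M * (2 * C + 2 + √(2 * Real.log (8 * N / δ))) →
          √(-Real.log (δ / 8) / 2) ≤ C'' →
          C'' ≤ M * √(-Real.log (δ / 8) / 2) →
          ∀ I : (Fin n → Unit4 𝒳) → EGInput F,
          (∀ s, I s = egInput F β ev l N T φ ε C' C'' (cB * (n : ℝ) ^ φ) (cν * (n : ℝ) ^ (-φ))
            (oracleData μ s)) →
          (∀ (s : Fin n → Unit4 𝒳) (best : ℝ → F), (I s).IsBestResponse best →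
            ∃ t : ℕ, (I s).StopsAt best t ∧
              (t : ℝ) + 1 ≤ K * (1 + Real.log (1 / δ)) * (n : ℝ) ^ (4 * φ)) ∧
          (n₀ ≤ n →
            (Measure.pi fun _ : Fin n => P)
              {s | ¬ ∀ (best : ℝ → F) (t : ℕ),
                (I s).IsBestResponse best → (I s).StopsAt best t →
                (∃ Qhat : PMF F, (I s).returned best t = some Qhat ∧
                  avg Qhat (fun f => lossReg P μ l f) ≤ ε + polylog K k n δ * (n : ℝ) ^ (-φ) ∧
                  ∀ Q : PMF F, avg Q (fun f => lossReg P μ l f) ≤ ε →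
                    avg Qhat (fun f => disparity P β ev f) ≤
                      avg Q (fun f => disparity P β ev f)
                        + polylog K k n δ * (max (groupCount (ev 0) s : ℝ) 1) ^ (-φ)
                        + polylog K k n δ * (max (groupCount (ev 1) s : ℝ) 1) ^ (-φ)) ∨
                ((I s).returned best t = none ∧
                  ¬ ∃ Q : PMF F, avg Q (fun f => lossReg P μ l f) ≤ ε)}
              ≤ ENNReal.ofReal δ) := by
  obtain ⟨n₀, hn₀⟩ := Filter.eventually_atTop.1
    (eventually_deviationRadius_add_le_toleranceMargin (C := C) hφ0 hφ hcN)
  refine ⟨max (iterationConst (marginConst C M CN) ε cν cB)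
    (max (lossConst (marginConst C M CN) (2 * C + 4) (|β 0| + |β 1|) cν cB cN)
      (disparityConst (2 * C + 4) (|β 0| + |β 1|) p cν cN)), 1, n₀, ?_⟩
  intro P _ μ l F ev hμ hl hF hrad hev hpos
  refine ⟨fun a ha f hf => hμ.identification (hev a) ha (hF.measurable f hf) fun x =>
    abs_le.2 ⟨by linarith [(hF.mem f hf x).1], (hF.mem f hf x).2⟩,
    avg_lossReg_le_avg_loss hl hμ hF, ?_⟩
  intro n N T δ C' C'' hn hN hNlo hNhi hT hδ0 hδ1 hC'lo hC'hi hC''lo hC''hi I hI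
  refine ⟨fun s best hbest => egInput_exists_stopsAt_le_rate hl hμ.reg_mem hF.nonempty hF.mem
    hφ0 hφ hC hM hε hcν hcB hn hN hNhi hT hδ0 hδ1.le (le_trans (by positivity) hC'lo) hC'hi
    (le_trans (by positivity) hC''lo) hC''hi (le_max_left _ _) (hI s) hbest, fun hnn => ?_⟩
  refine (measure_mono fun s => mt fun hgood best t hbest hstops => ?_).trans
    (measure_not_goodSample_le hl hF ev hn hN hT hμ.measurable_reg hμ.reg_mem (hrad n hn) hδ0
      hδ1.le)
  exact hgood.guarantee_rate hl hμ hF hφ0 hφ hC hM hp hcν.le hcB hcN hn hN hNlo hNhi hT hδ0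
    hδ1.le hev hpos hC'hi hC''hi (hn₀ n hnn N δ C' C'' hN hNlo hδ0 hδ1.le hC'lo hC''lo)
    (le_max_of_le_right (le_max_left _ _)) (le_max_of_le_right (le_max_right _ _)) (hI s)
    hbest hstops

theorem theorem2 {𝒳 : Type*} [MeasurableSpace 𝒳]
    (β : Fin 2 → ℝ) (φ C M ε p cν cB cN CN : ℝ)
    (hφ0 : 0 ≤ φ) (hφ : φ ≤ 1 / 2) (hC : 0 < C) (hM : 1 ≤ M) (hε : 0 ≤ ε) (hp : 0 < p)
    (hcν : 0 < cν) (hcB : 0 < cB) (hcN : 0 < cN) :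
    -- constants that depend only on the numbers above
    ∃ (K : ℝ) (k n₀ : ℕ),
      ∀ (P : Measure (Unit4 𝒳)) [IsProbabilityMeasure P] (μ : 𝒳 → ℝ) (l : ℝ → ℝ → ℝ)
        (F : Set (𝒳 → ℝ)) (ev : Fin 2 → GroupEvent),
        SelectiveLabels P μ → IsLoss l → IsPredictionClass P F →
        -- complexity of the class of threshold classifiers
        (∀ m : ℕ, 1 ≤ m → rademacher (thrClass F) m ≤ C * (m : ℝ) ^ (-φ)) →
        -- events that involve `Y*`: the outcome is binary and `Y* ⊥ A | X`
        ((∃ a, (ev a).label ≠ LabelCond.free) →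
          (∀ᵐ o ∂P, o.out = 0 ∨ o.out = 1) ∧ CondIndepGivenFeat P Unit4.out Unit4.attr) →
        -- the relevant conditioning events have positive probability
        (∀ a, β a ≠ 0 → p ≤ P.real (ev a).toSet) →
        -- identification of the disparities
        (∀ a, P (ev a).toSet ≠ 0 → ∀ f ∈ F,
          0 < ∫ o, (ev a).label.weight (μ o.feat) ∂(P[|(ev a).attrSet]) ∧
          ∫ o, f o.feat ∂(P[|(ev a).toSet]) =
            (∫ o, f o.feat * (ev a).label.weight (μ o.feat) ∂(P[|(ev a).attrSet])) /
              ∫ o, (ev a).label.weight (μ o.feat) ∂(P[|(ev a).attrSet])) ∧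
        -- for losses convex in the outcome, feasibility for `loss` implies it for `loss_μ`
        ((∀ u ∈ Set.Icc (0 : ℝ) 1, ConvexOn ℝ (Set.Icc (0 : ℝ) 1) fun y => l y u) →
          ∀ Q : PMF F, avg Q (fun f => lossReg P μ l f) ≤ avg Q (fun f => loss P l f)) ∧
        -- the algorithm, run on the oracle data `(Xᵢ, Aᵢ, μ(Xᵢ))`
        ∀ (n N : ℕ) (T : Finset ℝ) (δ C' C'' : ℝ),
          1 ≤ n → 1 ≤ N → cN * (n : ℝ) ^ φ ≤ N → N ≤ CN * (n : ℝ) ^ φ → IsHalfCover N T →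
          0 < δ → δ < 1 →
          2 * C + 2 + √(2 * Real.log (8 * N / δ)) ≤ C' →
          C' ≤ M * (2 * C + 2 + √(2 * Real.log (8 * N / δ))) →
          √(-Real.log (δ / 8) / 2) ≤ C'' →
          C'' ≤ M * √(-Real.log (δ / 8) / 2) →
          ∀ I : (Fin n → Unit4 𝒳) → EGInput F,
          (∀ s, I s = egInput F β ev l N T φ ε C' C'' (cB * (n : ℝ) ^ φ) (cν * (n : ℝ) ^ (-φ))
            (oracleData μ s)) →
          -- number of iterations, on every sample
          (∀ (s : Fin n → Unit4 𝒳) (best : ℝ → F), (I s).IsBestResponse best →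
            ∃ t : ℕ, (I s).StopsAt best t ∧
              (t : ℝ) + 1 ≤ K * (1 + Real.log (1 / δ)) * (n : ℝ) ^ (4 * φ)) ∧
          -- guarantees, outside a set of samples of (outer) probability at most `δ`
          (n₀ ≤ n →
            (Measure.pi fun _ : Fin n => P)
              {s | ¬ ∀ (best : ℝ → F) (t : ℕ),
                (I s).IsBestResponse best → (I s).StopsAt best t →
                (∃ Qhat : PMF F, (I s).returned best t = some Qhat ∧
                  avg Qhat (fun f => lossReg P μ l f) ≤ ε + polylog K k n δ * (n : ℝ) ^ (-φ) ∧
                  ∀ Q : PMF F, avg Q (fun f => lossReg P μ l f) ≤ ε →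
                    avg Qhat (fun f => disparity P β ev f) ≤
                      avg Q (fun f => disparity P β ev f)
                        + polylog K k n δ * (max (groupCount (ev 0) s : ℝ) 1) ^ (-φ)
                        + polylog K k n δ * (max (groupCount (ev 1) s : ℝ) 1) ^ (-φ)) ∨
                ((I s).returned best t = none ∧
                  ¬ ∃ Q : PMF F, avg Q (fun f => lossReg P μ l f) ≤ ε)}
              ≤ ENNReal.ofReal δ) :=
  let ⟨K, k, n₀, h⟩ := theorem2_general β φ C M ε p cν cB cN CN hφ0 hφ hC.le (zero_le_one.trans hM)
    hε hp hcν hcB hcN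
  ⟨K, k, n₀, fun P _ μ l F ev hP hl hF hrad hbin =>
    h P μ l F ev hP.isOutcomeRegression hl hF hrad fun a ha => hbin ⟨a, ha⟩⟩
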